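/- All logarithms are to base $2$. A *weighted graph* is a finite simple undirected graph $G=(V,E,\omega)$ with positive real edge weights; it need not be connected. The length of a path is the sum of its edge weights, $d_G(u,v)$ is the least length of a $u$-$v$ path, and $d_G^{(t)}(u,v)$ is the least length of a $u$-$v$ path with at most $t$ edges (both are $\infty$ if there is no such path). For a weighted graph $H=(V,E_H,\omega_H)$ on the same vertex set, $G\cup H$ is the graph with edge set $E\cup E_H$ in which the edges of $E_H$ have weight $\omega_H$ and the edges of $E\setminus E_H$ have weight $\omega$. For an integer $\beta\ge 1$ and $\epsilon>0$, $H$ is a *$(\beta,\epsilon)$-hopset* for $G$ if $$d_G(u,v)\;\le\; d^{(\beta)}_{G\cup H}(u,v)\;\le\;(1+\epsilon)\,d_G(u,v)\qquad\text{for all }u,v\in V.$$ *Model of computation.* Algorithms are fixed finite programs for a randomized random access machine with words of $O(\log n)$ bits and with real registers. Every operation $+,-,\times,\div$ on words (integers) or on reals, every conversion of a word to a real, comparison, memory access and fair coin toss takes one step; reals cannot be converted to words. The input consists of the number $n$ of vertices, a list (in arbitrary order) of the edges of $G$ with their weights, and the real parameters $\kappa,\rho,\epsilon$; the output is a list of the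 edges of $H$ with their weights. **Theorem.** There are a randomized algorithm in this model, an absolute constant $C>0$ and a function $\beta=\beta(\kappa,\rho,\epsilon)$ with positive integer values (so $\beta$ does not depend on $n$ or on $G$) satisfying $$\beta(\kappa,\rho,\epsilon)\;\le\;\left(C\cdot\frac{\log\kappa+1/\rho}{\epsilon}\right)^{\log\kappa+1/\rho},$$ such that the following holds for all real numbers $\kappa,\rho,\epsilon$ and every integer $n\ge 1$ with $2\le\kappa\le(\log n)/4$, $1/\kappa\le\rho<1/2$ and $0<\epsilon<1/2$, and for every weighted graph $G=(V,E,\omega)$ with $n$ vertices. On the input $G,\kappa,\rho,\epsilon$, and for every outcome of its coin tosses, the algorithm halts and outputs a $(\beta,\epsilon)$-hopset $H$ for $G$. The expected number of edges of $H$ is at most $C\cdot n^{1+1/\kappa}\log n$, and the expected number of steps is at most $$C\cdot(|E|+n\log n)\cdot\frac{n^{\rho}}{\rho}\cdot\log n .$$ -/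

import Mathlib

open MeasureTheory
open scoped ENNReal

namespace Hopset

/-! ### Weighted graphs, hop-limited distances and hopsets -/

/-- An undirected graph on the vertex set `Fin n` with positive real edge weights.
Only the values of `weight` on edges are meaningful. -/
structure WGraph (n : ℕ) where
  graph : SimpleGraph (Fin n)
  weight : Sym2 (Fin n) → ℝ
  weight_pos : ∀ e ∈ graph.edgeSet, 0 < weight e

namespace WGraph

variable {n : ℕ}

/-- The number of edges. -/
noncomputable def numEdges (G : WGraph n) : ℕ := G.graph.edgeSet.ncard

/-- The total weight of a walk. -/
def walkWeight (G : WGraph n) {u v : Fin n} (p : G.graph.Walk u v) : ℝ :=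
  (p.edges.map G.weight).sum

/-- The shortest-path distance; it is `⊤` between different components. Since weights are
positive, the infimum over walks is the minimum over simple paths. -/
noncomputable def dist (G : WGraph n) (u v : Fin n) : ℝ≥0∞ :=
  ⨅ p : G.graph.Walk u v, ENNReal.ofReal (G.walkWeight p)

/-- The `t`-limited distance: the least weight of a `u`-`v` path with at most `t` edges, and `⊤`
if there is none. -/
noncomputable def hopDist (G : WGraph n) (t : ℕ) (u v : Fin n) : ℝ≥0∞ :=
  ⨅ (p : G.graph.Walk u v) (_ : p.length ≤ t), ENNReal.ofReal (G.walkWeight p)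

open Classical in
/-- The union `G ∪ H`: an edge of `H` has its weight in `H`, and every other edge of `G` has its
weight in `G`. -/
noncomputable def union (G H : WGraph n) : WGraph n where
  graph := G.graph ⊔ H.graph
  weight e := if e ∈ H.graph.edgeSet then H.weight e else G.weight e
  weight_pos e he := by
    by_cases h : e ∈ H.graph.edgeSet
    · simpa only [h, if_true] using H.weight_pos e h
    · rw [SimpleGraph.edgeSet_sup] at he
      simpa only [h, if_false] using G.weight_pos e (he.resolve_right h)

/-- `H` is a `(β, ε)`-hopset for `G`. -/
def IsHopset (β : ℕ) (ε : ℝ) (G H : WGraph n) : Prop :=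
  ∀ u v : Fin n, G.dist u v ≤ (G.union H).hopDist β u v ∧
    (G.union H).hopDist β u v ≤ ENNReal.ofReal (1 + ε) * G.dist u v

/-- The list `l` of triples `(u, v, x)` lists the edges `{u, v}` of `G` together with their weights
`x`, in any order and with any orientation of the edges; repetitions are possible. -/
def IsListedBy (G : WGraph n) (l : List (Fin n × Fin n × ℝ)) : Prop :=
  ∀ (u v : Fin n) (x : ℝ),
    ((u, v, x) ∈ l ∨ (v, u, x) ∈ l) ↔ (G.graph.Adj u v ∧ G.weight s(u, v) = x)

/-- The list `l` lists every edge of `G` exactly once, together with its weight. -/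
def IsListedOnceBy (G : WGraph n) (l : List (Fin n × Fin n × ℝ)) : Prop :=
  G.IsListedBy l ∧ (l.map fun e => s(e.1, e.2.1)).Nodup

end WGraph

/-! ### Randomized random access machines

The machine has word registers and word arrays (for integers and addresses), real registers and
real arrays (for edge weights and real parameters). Words are integers below a bound `W`; a word
operation costs one step, and so does a real operation `+, -, *, /`, a comparison, a memory access
and a fair coin toss. There is no conversion from reals to words. Programs are finite
pieces of syntax in a language with branching and loops; registers and arrays are named
by constants of the program, and array cells are addressed by computed words. -/

/-- Word expressions. -/
inductive WExp : Type
  | lit (c : ℕ)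
  | reg (x : ℕ)
  | get (a : ℕ) (i : WExp)
  | add (e f : WExp)
  | sub (e f : WExp)
  | mul (e f : WExp)
  | div (e f : WExp)

/-- Real expressions. -/
inductive RExp : Type
  | reg (x : ℕ)
  | get (a : ℕ) (i : WExp)
  | ofWord (e : WExp)
  | add (e f : RExp)
  | sub (e f : RExp)
  | mul (e f : RExp)
  | div (e f : RExp)

/-- Tests. -/
inductive Test : Type
  | wle (e f : WExp)
  | rle (e f : RExp)
  | neg (b : Test)
  | conj (b c : Test)

/-- Programs. -/
inductive Prog : Type
  | skip
  /-- assign to a word register -/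
  | wset (x : ℕ) (e : WExp)
  /-- assign to cell `i` of the word array `a` -/
  | wput (a : ℕ) (i e : WExp)
  /-- assign to a real register -/
  | rset (x : ℕ) (e : RExp)
  /-- assign to cell `i` of the real array `a` -/
  | rput (a : ℕ) (i : WExp) (e : RExp)
  /-- toss a fair coin and write the outcome, `0` or `1`, to a word register -/
  | flip (x : ℕ)
  | seq (P Q : Prog)
  | ite (b : Test) (P Q : Prog)
  /-- repeat `P` as long as `b` holds -/
  | loop (b : Test) (P : Prog)

/-- The memory of the machine, and the number of coins tossed so far. -/
structure State where
  wreg : ℕ → ℕ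
  rreg : ℕ → ℝ
  warr : ℕ → ℕ → ℕ
  rarr : ℕ → ℕ → ℝ
  tossed : ℕ

/-- Evaluation of word expressions, modulo `W`. Subtraction is truncated at `0`, division is
rounded down. -/
def WExp.eval (W : ℕ) (s : State) : WExp → ℕ
  | .lit c => c % W
  | .reg x => s.wreg x
  | .get a i => s.warr a (i.eval W s)
  | .add e f => (e.eval W s + f.eval W s) % W
  | .sub e f => e.eval W s - f.eval W s
  | .mul e f => (e.eval W s * f.eval W s) % W
  | .div e f => e.eval W s / f.eval W s

/-- The number of steps in the evaluation of a word expression. -/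
def WExp.cost : WExp → ℕ
  | .lit _ => 1
  | .reg _ => 1
  | .get _ i => i.cost + 1
  | .add e f => e.cost + f.cost + 1
  | .sub e f => e.cost + f.cost + 1
  | .mul e f => e.cost + f.cost + 1
  | .div e f => e.cost + f.cost + 1

/-- Evaluation of real expressions. -/
noncomputable def RExp.eval (W : ℕ) (s : State) : RExp → ℝ
  | .reg x => s.rreg x
  | .get a i => s.rarr a (i.eval W s)
  | .ofWord e => (e.eval W s : ℝ)
  | .add e f => e.eval W s + f.eval W s
  | .sub e f => e.eval W s - f.eval W s
  | .mul e f => e.eval W s * f.eval W s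
  | .div e f => e.eval W s / f.eval W s

/-- The number of steps in the evaluation of a real expression. -/
def RExp.cost : RExp → ℕ
  | .reg _ => 1
  | .get _ i => i.cost + 1
  | .ofWord e => e.cost + 1
  | .add e f => e.cost + f.cost + 1
  | .sub e f => e.cost + f.cost + 1
  | .mul e f => e.cost + f.cost + 1
  | .div e f => e.cost + f.cost + 1

/-- The truth of a test. -/
def Test.Holds (W : ℕ) (s : State) : Test → Prop
  | .wle e f => e.eval W s ≤ f.eval W s
  | .rle e f => e.eval W s ≤ f.eval W s
  | .neg b => ¬ b.Holds W s
  | .conj b c => b.Holds W s ∧ c.Holds W s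

/-- The number of steps in the evaluation of a test. -/
def Test.cost : Test → ℕ
  | .wle e f => e.cost + f.cost + 1
  | .rle e f => e.cost + f.cost + 1
  | .neg b => b.cost + 1
  | .conj b c => b.cost + c.cost + 1

/-- Write `k` to the word register `x`. -/
def State.setWord (s : State) (x k : ℕ) : State :=
  { s with wreg := Function.update s.wreg x k }

/-- Write `k` to cell `i` of the word array `a`. -/
def State.putWord (s : State) (a i k : ℕ) : State :=
  { s with warr := Function.update s.warr a (Function.update (s.warr a) i k) }

/-- Write `y` to the real register `x`. -/
noncomputable def State.setReal (s : State) (x : ℕ) (y : ℝ) : State :=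
  { s with rreg := Function.update s.rreg x y }

/-- Write `y` to cell `i` of the real array `a`. -/
noncomputable def State.putReal (s : State) (a i : ℕ) (y : ℝ) : State :=
  { s with rarr := Function.update s.rarr a (Function.update (s.rarr a) i y) }

/-- Toss the next coin, with outcome `b`, and write `b` to the word register `x`. -/
def State.toss (s : State) (x : ℕ) (b : Bool) : State :=
  { s.setWord x b.toNat with tossed := s.tossed + 1 }

/-- `Exec W ω P s t s'`: if words are bounded by `W` and the outcomes of the successive coin tosses
are `ω 0, ω 1, …`, then the program `P`, started in the state `s`, halts after exactly `t` steps
in the state `s'`. -/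
inductive Exec (W : ℕ) (ω : ℕ → Bool) : Prog → State → ℕ → State → Prop
  | skip (s : State) : Exec W ω .skip s 0 s
  | wset (x : ℕ) (e : WExp) (s : State) :
      Exec W ω (.wset x e) s (e.cost + 1) (s.setWord x (e.eval W s))
  | wput (a : ℕ) (i e : WExp) (s : State) :
      Exec W ω (.wput a i e) s (i.cost + e.cost + 1) (s.putWord a (i.eval W s) (e.eval W s))
  | rset (x : ℕ) (e : RExp) (s : State) :
      Exec W ω (.rset x e) s (e.cost + 1) (s.setReal x (e.eval W s))
  | rput (a : ℕ) (i : WExp) (e : RExp) (s : State) :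
      Exec W ω (.rput a i e) s (i.cost + e.cost + 1) (s.putReal a (i.eval W s) (e.eval W s))
  | flip (x : ℕ) (s : State) : Exec W ω (.flip x) s 1 (s.toss x (ω s.tossed))
  | seq {P Q : Prog} {s s₁ s₂ : State} {t₁ t₂ : ℕ} :
      Exec W ω P s t₁ s₁ → Exec W ω Q s₁ t₂ s₂ → Exec W ω (.seq P Q) s (t₁ + t₂) s₂
  | ite_true {b : Test} {P Q : Prog} {s s₁ : State} {t : ℕ} :
      b.Holds W s → Exec W ω P s t s₁ → Exec W ω (.ite b P Q) s (b.cost + t) s₁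
  | ite_false {b : Test} {P Q : Prog} {s s₁ : State} {t : ℕ} :
      ¬ b.Holds W s → Exec W ω Q s t s₁ → Exec W ω (.ite b P Q) s (b.cost + t) s₁
  | loop_stop {b : Test} {P : Prog} {s : State} :
      ¬ b.Holds W s → Exec W ω (.loop b P) s b.cost s
  | loop_step {b : Test} {P : Prog} {s s₁ s₂ : State} {t₁ t₂ : ℕ} :
      b.Holds W s → Exec W ω P s t₁ s₁ → Exec W ω (.loop b P) s₁ t₂ s₂ →
      Exec W ω (.loop b P) s (b.cost + t₁ + t₂) s₂

/-- The law of a sequence of independent fair coin tosses. -/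
noncomputable def coinMeasure : Measure (ℕ → Bool) :=
  Measure.infinitePi fun _ => (PMF.uniformOfFintype Bool).toMeasure

/-! ### Input and output -/

/-- The initial state: word registers `0` and `1` hold the number of vertices and the number of
listed edges, real registers `0`, `1`, `2` hold `κ`, `ρ`, `ε`, the end points and the
weight of the `i`-th listed edge are in the cells `i` of the word arrays `0` and `1` and of the real
array `0`. Everything else is `0`. -/
noncomputable def initState {n : ℕ} (κ ρ ε : ℝ) (l : List (Fin n × Fin n × ℝ)) : State where
  wreg x := if x = 0 then n else if x = 1 then l.length else 0
  rreg x := if x = 0 then κ else if x = 1 then ρ else if x = 2 then ε else 0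
  warr a i := if a = 0 then (l[i]?.elim 0 fun e => (e.1 : ℕ))
    else if a = 1 then (l[i]?.elim 0 fun e => (e.2.1 : ℕ)) else 0
  rarr a i := if a = 0 then (l[i]?.elim 0 fun e => e.2.2) else 0
  tossed := 0

/-- The state `s` holds the weighted graph `H` as its output: word register `0` holds the length
of a list of the edges of `H`, and the end points and the weight of the `i`-th listed edge are in
the cells `i` of the word arrays `0` and `1` and of the real array `0`. -/
def State.Outputs {n : ℕ} (s : State) (H : WGraph n) : Prop :=
  ∃ l : List (Fin n × Fin n × ℝ), H.IsListedBy l ∧ s.wreg 0 = l.length ∧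
    ∀ (i : ℕ) (hi : i < l.length),
      s.warr 0 i = (l[i].1 : ℕ) ∧ s.warr 1 i = (l[i].2.1 : ℕ) ∧ s.rarr 0 i = l[i].2.2

/-- On the input `κ, ρ, ε, l` and with coin tosses `ω`, the program `P`, run with words of
`c * log n` bits, halts after exactly `t` steps with output `H`. -/
def Computes {n : ℕ} (P : Prog) (c : ℕ) (κ ρ ε : ℝ) (l : List (Fin n × Fin n × ℝ))
    (ω : ℕ → Bool) (t : ℕ) (H : WGraph n) : Prop :=
  ∃ s : State, Exec (n ^ c) ω P (initState κ ρ ε l) t s ∧ s.Outputs H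

end Hopset

/-! ### A nested hierarchy of vertex sets with suitable edges is a hopset. -/

namespace Hopset

/-! ### Shortest paths -/

namespace WGraph

variable {n : ℕ} (G : WGraph n)

/-! The hopset is built from a Thorup–Zwick hierarchy of vertex sets `A 0 ⊇ A 1 ⊇ ⋯ ⊇ A L`, where `A
0` contains all vertices and `A (L + 1)` is empty. On level `i`, a vertex `u` of `A i` is joined to
the vertices of `A i` in its cluster, those closer to `u` than to `A (i + 1)`, and to its pivot, a
nearest vertex of `A (i + 1)`. Edges are weighted by distances, so no walk can undercut a distance
(`DistWeighted.dist_le_hopDist`).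

Hopbound. By induction on the level, every connected pair `x, y` either has a walk with few edges
and stretch `1 + e`, or `x` reaches the next set within twice the distance. For the induction step
(`LevelStretch.step`) a shortest path is cut into `N` segments. If some segments fail, the first
failure seen from each end leads to nearby vertices `z, z'` of the current set. Either these two are
adjacent, which bridges everything in between, or the pivot of `z` is near. A level adds `8 / N` to
the error and multiplies the hop count by at most `5 N`. At the top the second alternative is void,
whence `isHopset_of_hierarchy`.

Sampling. Each vertex tosses `l` coins, about `log n`; its rank is the length of the initial run of
heads, and `A i` consists of the vertices of rank at least `thr a b i`. The passage from `A i` to `A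
(i + 1)` has probability `2 ^ (-min (thr a b i + a) b)`, with `a` about `l / κ` and `b` about `ρ l`.
Thus `thr + a` doubles until it reaches `b`, and then `thr` grows by `b` per level, which gives at
most `log κ + 1 / ρ` levels (`LastLevel.le_log`).

Expectations. Order the vertices by distance from `v`. A root `u` whose cluster contains `v` must
precede all vertices of `A (i + 1)`, so the expected number of such roots is at most the inverse
sampling probability (`sum_coinMeasure_firstEvent`). Summed over the levels this is geometric and
then constant, `O(2 ^ b / ρ)` in total (`sum_overlap_le`), which bounds the work. For the size, `v`
must also be in `A i`; independence contributes a factor `2 ^ (-thr a b i)`, leaving at most `2 ^ a`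
pairs per vertex on each level below the top (`sum_pairEvent_le`).

Algorithm. Levels are processed from the top down. Dijkstra's algorithm, pruned by the distance to
the next set, explores exactly the clusters (`DInv.final`), and the same searches yield the pivots
for the level below (`Nearest.add_root`). The whole run reads a fixed finite number of coins, so
running time and output are measurable (`exists_measurable_run`). -/

@[simp] theorem walkWeight_nil (u : Fin n) : G.walkWeight (.nil : G.graph.Walk u u) = 0 := by
  simp [walkWeight]

@[simp] theorem walkWeight_cons {u v w : Fin n} (h : G.graph.Adj u v) (p : G.graph.Walk v w) :
    G.walkWeight (.cons h p) = G.weight s(u, v) + G.walkWeight p := by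
  simp [walkWeight]

theorem walkWeight_append {u v w : Fin n} (p : G.graph.Walk u v) (q : G.graph.Walk v w) :
    G.walkWeight (p.append q) = G.walkWeight p + G.walkWeight q := by
  simp [walkWeight]

theorem walkWeight_reverse {u v : Fin n} (p : G.graph.Walk u v) :
    G.walkWeight p.reverse = G.walkWeight p := by
  simp [walkWeight, List.sum_reverse]

theorem weight_pos_of_adj {u v : Fin n} (h : G.graph.Adj u v) : 0 < G.weight s(u, v) :=
  G.weight_pos _ h

theorem walkWeight_nonneg {u v : Fin n} (p : G.graph.Walk u v) : 0 ≤ G.walkWeight p := by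
  induction p with
  | nil => simp
  | cons h p ih => rw [walkWeight_cons]; linarith [G.weight_pos_of_adj h]

theorem walkWeight_bypass_le {u v : Fin n} (p : G.graph.Walk u v) :
    G.walkWeight p.bypass ≤ G.walkWeight p := by
  refine List.Sublist.sum_le_sum (p.edges_bypass_sublist_edges.map _) ?_
  intro x hx
  obtain ⟨e, he, rfl⟩ := List.mem_map.1 hx
  exact (G.weight_pos e (p.edges_subset_edgeSet he)).le

/-- Removing cycles does not increase the weight, so it suffices to minimise over the finitely many
walks with fewer than `n` edges. -/
theorem exists_shortest_walk {u v : Fin n} (h : G.graph.Reachable u v) :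
    ∃ p : G.graph.Walk u v, ∀ q : G.graph.Walk u v, G.walkWeight p ≤ G.walkWeight q := by
  classical
  have hfin : Finite {p : G.graph.Walk u v // p.length < n} := inferInstance
  obtain ⟨p₀⟩ := h
  have hlt : ∀ p : G.graph.Walk u v, p.bypass.length < n := fun p => by
    simpa using p.bypass_isPath.length_lt
  have : Nonempty {p : G.graph.Walk u v // p.length < n} := ⟨⟨p₀.bypass, hlt p₀⟩⟩
  obtain ⟨p, hp⟩ := Finite.exists_min
    (fun p : {p : G.graph.Walk u v // p.length < n} => G.walkWeight p.1)
  exact ⟨p.1, fun q => (hp ⟨q.bypass, hlt q⟩).trans (G.walkWeight_bypass_le q)⟩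

/-- The distance as a real number; it is meaningful for vertices in the same component. -/
noncomputable def rdist (u v : Fin n) : ℝ := (G.dist u v).toReal

theorem dist_eq_of_shortest {u v : Fin n} (p : G.graph.Walk u v)
    (hp : ∀ q : G.graph.Walk u v, G.walkWeight p ≤ G.walkWeight q) :
    G.dist u v = ENNReal.ofReal (G.walkWeight p) :=
  le_antisymm (iInf_le _ p) (le_iInf fun q => ENNReal.ofReal_le_ofReal (hp q))

theorem exists_walk_eq_rdist {u v : Fin n} (h : G.graph.Reachable u v) :
    ∃ p : G.graph.Walk u v, G.walkWeight p = G.rdist u v := by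
  obtain ⟨p, hp⟩ := G.exists_shortest_walk h
  refine ⟨p, ?_⟩
  rw [rdist, G.dist_eq_of_shortest p hp, ENNReal.toReal_ofReal (G.walkWeight_nonneg p)]

theorem dist_eq_ofReal {u v : Fin n} (h : G.graph.Reachable u v) :
    G.dist u v = ENNReal.ofReal (G.rdist u v) := by
  obtain ⟨p, hp⟩ := G.exists_shortest_walk h
  rw [rdist, G.dist_eq_of_shortest p hp, ENNReal.toReal_ofReal (G.walkWeight_nonneg p)]

theorem dist_eq_top {u v : Fin n} (h : ¬ G.graph.Reachable u v) : G.dist u v = ⊤ := by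
  have : IsEmpty (G.graph.Walk u v) := ⟨fun p => h ⟨p⟩⟩
  exact iInf_of_empty _

theorem rdist_nonneg (u v : Fin n) : 0 ≤ G.rdist u v := ENNReal.toReal_nonneg

theorem rdist_le {u v : Fin n} (p : G.graph.Walk u v) : G.rdist u v ≤ G.walkWeight p := by
  have h : G.dist u v ≤ ENNReal.ofReal (G.walkWeight p) := iInf_le _ p
  exact ENNReal.toReal_le_of_le_ofReal (G.walkWeight_nonneg p) h

@[simp] theorem rdist_self (u : Fin n) : G.rdist u u = 0 :=
  le_antisymm (by simpa using G.rdist_le (.nil : G.graph.Walk u u)) (G.rdist_nonneg u u)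

theorem rdist_le_weight {u v : Fin n} (h : G.graph.Adj u v) : G.rdist u v ≤ G.weight s(u, v) := by
  simpa using G.rdist_le h.toWalk

theorem rdist_triangle {u v w : Fin n} (h : G.graph.Reachable u v) (h' : G.graph.Reachable v w) :
    G.rdist u w ≤ G.rdist u v + G.rdist v w := by
  obtain ⟨p, hp⟩ := G.exists_walk_eq_rdist h
  obtain ⟨q, hq⟩ := G.exists_walk_eq_rdist h'
  rw [← hp, ← hq, ← walkWeight_append]
  exact G.rdist_le _

theorem dist_comm (u v : Fin n) : G.dist u v = G.dist v u := by
  have key : ∀ u v, G.dist u v ≤ G.dist v u := fun u v => le_iInf fun p =>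
    (iInf_le _ p.reverse).trans (by rw [walkWeight_reverse])
  exact le_antisymm (key u v) (key v u)

theorem rdist_comm (u v : Fin n) : G.rdist u v = G.rdist v u := by
  rw [rdist, rdist, dist_comm]

theorem rdist_pos {u v : Fin n} (h : G.graph.Reachable u v) (huv : u ≠ v) : 0 < G.rdist u v := by
  obtain ⟨p, hp⟩ := G.exists_walk_eq_rdist h
  rw [← hp]
  cases p with
  | nil => exact absurd rfl huv
  | cons h p =>
    rw [walkWeight_cons]
    linarith [G.weight_pos_of_adj h, G.walkWeight_nonneg p]

/-- A shortest path longer than `D` has a first edge that leaves the ball of radius `D`. -/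
theorem exists_edge_leaving_ball {x y : Fin n} (h : G.graph.Reachable x y) {D : ℝ} (hD : 0 ≤ D)
    (hxy : D < G.rdist x y) :
    ∃ v v', G.graph.Reachable x v ∧ G.graph.Adj v v' ∧ G.graph.Reachable v' y ∧
      G.rdist x v ≤ D ∧ D < G.rdist x v + G.weight s(v, v') ∧
      G.rdist x v + G.weight s(v, v') + G.rdist v' y ≤ G.rdist x y := by
  obtain ⟨p, hp⟩ := G.exists_walk_eq_rdist h
  suffices H : ∀ (a : Fin n) (q : G.graph.Walk a y), G.graph.Reachable x a → G.rdist x a ≤ D →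
      G.rdist x a + G.walkWeight q ≤ G.rdist x y → ∃ v v', G.graph.Reachable x v ∧
      G.graph.Adj v v' ∧ G.graph.Reachable v' y ∧
      G.rdist x v ≤ D ∧ D < G.rdist x v + G.weight s(v, v') ∧
      G.rdist x v + G.weight s(v, v') + G.rdist v' y ≤ G.rdist x y from
    H x p (.refl x) (by simpa using hD) (by simp [hp])
  intro a q
  induction q with
  | nil => intro _ h1 _; linarith
  | @cons a b c hab q ih =>
    intro hxa h1 h2
    rw [walkWeight_cons] at h2
    by_cases hlt : D < G.rdist x a + G.weight s(a, b)
    · exact ⟨a, b, hxa, hab, ⟨q⟩, h1, hlt, by linarith [G.rdist_le q]⟩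
    · have h3 := G.rdist_triangle hxa hab.reachable
      have h4 := G.rdist_le_weight hab
      exact ih ⟨p⟩ hxy p hp (hxa.trans hab.reachable) (by linarith) (by linarith)

/-! ### Hop-limited walks of bounded weight -/

/-- There is a walk with at most `t` edges and of weight at most `r`. -/
def Hop (K : WGraph n) (t : ℕ) (u v : Fin n) (r : ℝ) : Prop :=
  ∃ p : K.graph.Walk u v, p.length ≤ t ∧ K.walkWeight p ≤ r

variable {G}

theorem Hop.refl (u : Fin n) : G.Hop 0 u u 0 := ⟨.nil, by simp, by simp⟩

theorem Hop.mono {t t' : ℕ} {u v : Fin n} {r r' : ℝ} (h : G.Hop t u v r) (ht : t ≤ t')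
    (hr : r ≤ r') : G.Hop t' u v r' := by
  obtain ⟨p, h1, h2⟩ := h
  exact ⟨p, h1.trans ht, h2.trans hr⟩

theorem Hop.trans {t t' : ℕ} {u v w : Fin n} {r r' : ℝ} (h : G.Hop t u v r)
    (h' : G.Hop t' v w r') : G.Hop (t + t') u w (r + r') := by
  obtain ⟨p, h1, h2⟩ := h
  obtain ⟨q, h3, h4⟩ := h'
  exact ⟨p.append q, by rw [SimpleGraph.Walk.length_append]; omega,
    by rw [walkWeight_append]; linarith⟩

theorem Hop.symm {t : ℕ} {u v : Fin n} {r : ℝ} (h : G.Hop t u v r) : G.Hop t v u r := by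
  obtain ⟨p, h1, h2⟩ := h
  exact ⟨p.reverse, by simpa using h1, by rwa [walkWeight_reverse]⟩

theorem Hop.of_adj {u v : Fin n} (h : G.graph.Adj u v) : G.Hop 1 u v (G.weight s(u, v)) :=
  ⟨h.toWalk, by simp, by simp⟩

theorem Hop.hopDist_le {t : ℕ} {u v : Fin n} {r : ℝ} (h : G.Hop t u v r) :
    G.hopDist t u v ≤ ENNReal.ofReal r := by
  obtain ⟨p, h1, h2⟩ := h
  exact (iInf₂_le p h1).trans (ENNReal.ofReal_le_ofReal h2)

/-! ### Graphs whose edges are weighted by distances -/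

/-- Every edge of `H` joins connected vertices of `G` and is weighted by their distance. -/
def DistWeighted (G H : WGraph n) : Prop :=
  ∀ u v, H.graph.Adj u v → G.graph.Reachable u v ∧ H.weight s(u, v) = G.rdist u v

variable {H : WGraph n}

theorem DistWeighted.of_union_adj (hH : G.DistWeighted H) {u v : Fin n}
    (h : (G.union H).graph.Adj u v) :
    G.graph.Reachable u v ∧ G.rdist u v ≤ (G.union H).weight s(u, v) := by
  by_cases h' : H.graph.Adj u v
  · refine ⟨(hH u v h').1, ?_⟩
    simp only [union, SimpleGraph.mem_edgeSet, h', if_true]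
    exact (hH u v h').2.ge
  · have h2 : G.graph.Adj u v := h.resolve_right h'
    refine ⟨h2.reachable, ?_⟩
    simp only [union, SimpleGraph.mem_edgeSet, h', if_false]
    exact G.rdist_le_weight h2

/-- Every edge of the union weighs at least the distance of its ends, so the triangle inequality
rules out shortcuts in length. This is the lower bound in the hopset condition. -/
theorem DistWeighted.of_walk (hH : G.DistWeighted H) {u v : Fin n}
    (p : (G.union H).graph.Walk u v) :
    G.graph.Reachable u v ∧ G.rdist u v ≤ (G.union H).walkWeight p := by
  induction p with
  | nil => exact ⟨.refl _, by simp⟩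
  | cons h p ih =>
    have h1 := hH.of_union_adj h
    refine ⟨h1.1.trans ih.1, ?_⟩
    rw [walkWeight_cons]
    linarith [G.rdist_triangle h1.1 ih.1]

theorem DistWeighted.of_hop (hH : G.DistWeighted H) {t : ℕ} {u v : Fin n} {r : ℝ}
    (h : (G.union H).Hop t u v r) : G.graph.Reachable u v ∧ G.rdist u v ≤ r := by
  obtain ⟨p, -, h2⟩ := h
  have := hH.of_walk p
  exact ⟨this.1, this.2.trans h2⟩

theorem DistWeighted.hop_of_right (hH : G.DistWeighted H) {u v : Fin n} (h : H.graph.Adj u v) :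
    (G.union H).Hop 1 u v (G.rdist u v) := by
  have h' : (G.union H).graph.Adj u v := Or.inr h
  refine (Hop.of_adj h').mono le_rfl ?_
  simp only [union, SimpleGraph.mem_edgeSet, h, if_true]
  exact (hH u v h).2.le

/-- If `H` overrides the weight of the edge, the new weight is a distance and hence no larger. -/
theorem DistWeighted.hop_of_left (hH : G.DistWeighted H) {u v : Fin n} (h : G.graph.Adj u v) :
    (G.union H).Hop 1 u v (G.weight s(u, v)) := by
  by_cases h' : H.graph.Adj u v
  · exact (hH.hop_of_right h').mono le_rfl (G.rdist_le_weight h)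
  · have h2 : (G.union H).graph.Adj u v := Or.inl h
    refine (Hop.of_adj h2).mono le_rfl ?_
    simp only [union, SimpleGraph.mem_edgeSet, h', if_false]
    exact le_rfl

theorem DistWeighted.dist_le_hopDist (hH : G.DistWeighted H) (t : ℕ) (u v : Fin n) :
    G.dist u v ≤ (G.union H).hopDist t u v := by
  refine le_iInf₂ fun p _ => ?_
  have := hH.of_walk p
  rw [G.dist_eq_ofReal this.1]
  exact ENNReal.ofReal_le_ofReal this.2

/-! ### Stretch and hopbound of a hierarchy -/

/-- The stretch property of one level of the hierarchy: every pair of vertices is either joined by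
a short walk with few edges, or its first vertex is close to the set `B` of vertices of the next
level. -/
def LevelStretch (G H : WGraph n) (h : ℕ) (e : ℝ) (B : Set (Fin n)) : Prop :=
  ∀ x y, G.graph.Reachable x y → (G.union H).Hop h x y ((1 + e) * G.rdist x y) ∨
    ∃ z ∈ B, (G.union H).Hop h x z (2 * G.rdist x y)

/-- Sweeping along a shortest path in segments of length at most `D`. -/
theorem LevelStretch.sweep (hH : G.DistWeighted H) {h : ℕ} {e : ℝ} (he : 0 ≤ e)
    {B : Set (Fin n)} (hl : G.LevelStretch H h e B) {D : ℝ} (hD : 0 ≤ D) (k : ℕ) :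
    ∀ x y, G.graph.Reachable x y → G.rdist x y ≤ k * D →
      (G.union H).Hop (k * (h + 1)) x y ((1 + e) * G.rdist x y) ∨
      ∃ u, ∃ z ∈ B, G.graph.Reachable x u ∧ G.rdist x u + G.rdist u y ≤ G.rdist x y ∧
        (G.union H).Hop (k * (h + 1)) x u ((1 + e) * G.rdist x u) ∧
        (G.union H).Hop h u z (2 * D) := by
  induction k with
  | zero =>
    intro x y hxy hle
    by_cases hne : x = y
    · subst hne
      exact .inl ((Hop.refl x).mono (by simp) (by simp))
    · have := G.rdist_pos hxy hne
      simp only [Nat.cast_zero, zero_mul] at hle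
      linarith
  | succ k ih =>
    intro x y hxy hle
    have hk : h ≤ (k + 1) * (h + 1) := by nlinarith
    by_cases hlt : G.rdist x y ≤ D
    · rcases hl x y hxy with h1 | ⟨z, hz, h1⟩
      · exact .inl (h1.mono hk le_rfl)
      · exact .inr ⟨x, z, hz, .refl x, by simp, (Hop.refl x).mono (by simp) (by simp),
          h1.mono le_rfl (by linarith)⟩
    -- The segment runs to `v`, still within `D` of `x`, and the edge that leaves the ball is taken
    -- as one extra hop because it may itself be long. Together they use up more than `D`, so `k`
    -- segments suffice for the rest.
    · obtain ⟨v, v', hxv, hvv, hvy, hv, hv', hsum⟩ :=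
        G.exists_edge_leaving_ball hxy hD (not_le.1 hlt)
      have hw := G.weight_pos_of_adj hvv
      rcases hl x v hxv with h1 | ⟨z, hz, h1⟩
      · have h2 := h1.trans (hH.hop_of_left hvv)
        push_cast at hle
        have hew : 0 ≤ e * G.weight s(v, v') := by positivity
        rcases ih v' y hvy (by linarith) with h3 | ⟨u, z, hz, hvu, hu, h3, h4⟩
        · refine .inl ((h2.trans h3).mono (by ring_nf; omega) ?_)
          have := mul_le_mul_of_nonneg_left hsum he
          linarith
        · refine .inr ⟨u, z, hz, hxv.trans (hvv.reachable.trans hvu), ?_,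
            (h2.trans h3).mono (by ring_nf; omega) ?_, h4⟩
          · have h5 := G.rdist_triangle (hxv.trans hvv.reachable) hvu
            have h6 := G.rdist_triangle hxv hvv.reachable
            have h7 := G.rdist_le_weight hvv
            linarith
          -- As `v`, `v'` and `u` lie in this order on a shortest path from `x` to `y`, the
          -- distances up to `u` add up, and so do the errors proportional to them.
          · have h5 := G.rdist_triangle (hxv.trans (hvv.reachable.trans hvu))
              (hvu.symm.trans hvy)
            have h6 : G.rdist x v + G.weight s(v, v') + G.rdist v' u ≤ G.rdist x u := by linarith
            have := mul_le_mul_of_nonneg_left h6 he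
            linarith
      · exact .inr ⟨x, z, hz, .refl x, by simp,
          (Hop.refl x).mono (by simp) (by simp), h1.mono le_rfl (by linarith)⟩

/-- The edges that a hopset has to contain on one level: vertices `x`, `y` of `A` are adjacent
unless `x` has a neighbour in `B` that is at most as far from `x` as `y`. -/
def LevelEdges (G H : WGraph n) (A B : Set (Fin n)) : Prop :=
  ∀ x ∈ A, ∀ y ∈ A, G.graph.Reachable x y → x = y ∨ H.graph.Adj x y ∨
    ∃ z ∈ B, (z = x ∨ H.graph.Adj x z) ∧ G.rdist x z ≤ G.rdist x y

/-- When all vertices belong to the level, a single edge of `H` already realises one of the two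
alternatives. -/
theorem LevelStretch.base (hH : G.DistWeighted H) {A B : Set (Fin n)} (hA : ∀ x, x ∈ A)
    (hAB : G.LevelEdges H A B) : G.LevelStretch H 1 0 B := by
  intro x y hxy
  rcases hAB x (hA x) y (hA y) hxy with rfl | h | ⟨z, hz, rfl | h, hle⟩
  · exact .inl ((Hop.refl x).mono (by simp) (by simp))
  · exact .inl ((hH.hop_of_right h).mono le_rfl (by simp))
  · exact .inr ⟨z, hz, (Hop.refl z).mono (by simp) (by linarith [G.rdist_nonneg z y])⟩
  · exact .inr ⟨z, hz, (hH.hop_of_right h).mono le_rfl (by linarith [G.rdist_nonneg x y])⟩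

/-- Sweep in segments of length `D = d(x, y) / N`, from `x` towards `y` and then from `y` back. If
both sweeps fail, at `u` and `u'`, there are `z`, `z'` in `A` within `2 D` of these points. An edge
between `z` and `z'` replaces the whole unexplored middle at an extra cost of `8 D`. Otherwise `z`
has a neighbour in `B` no farther than `z'`, and `x` reaches it with an excess of `6 D`. The hops
are two sweeps, two detours and one edge. -/
theorem LevelStretch.step (hH : G.DistWeighted H) {A B : Set (Fin n)} (hAB : G.LevelEdges H A B)
    {h N : ℕ} {e : ℝ} (he : 0 ≤ e) (hN : 0 < N) (heN : e + 6 / N ≤ 1)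
    (hl : G.LevelStretch H h e A) :
    G.LevelStretch H (2 * N * (h + 1) + 2 * h + 1) (e + 8 / N) B := by
  intro x y hxy
  have hN' : (0 : ℝ) < N := by exact_mod_cast hN
  have hd := G.rdist_nonneg x y
  set D := G.rdist x y / N with hDdef
  have hD : 0 ≤ D := by positivity
  have hND : N * D = G.rdist x y := by rw [hDdef]; field_simp
  have h8 : 8 / N * G.rdist x y = 8 * D := by rw [hDdef]; ring
  have h6 : 6 / N * G.rdist x y = 6 * D := by rw [hDdef]; ring
  have h62 := mul_le_mul_of_nonneg_right heN hd
  rcases hl.sweep hH he hD N x y hxy hND.ge with h1 | ⟨u, z, hz, hxu, hu, h1, h2⟩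
  · exact .inl (h1.mono (by ring_nf; omega) (by nlinarith))
  have hyu : G.graph.Reachable y u := hxy.symm.trans hxu
  have hle : G.rdist y u ≤ N * D := by
    rw [hND, G.rdist_comm y u]; linarith [G.rdist_nonneg x u]
  -- The backward sweep aims at `u` instead of `x`, so that `u` and `u'` occur in this order on the
  -- path and the three parts add up to at most the distance.
  rcases hl.sweep hH he hD N y u hyu hle with h3 | ⟨u', z', hz', hyu', hu', h3, h4⟩
  · refine .inl ((h1.trans h3.symm).mono (by ring_nf; omega) ?_)
    rw [G.rdist_comm y u]
    have := mul_le_mul_of_nonneg_left hu he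
    nlinarith
  have huz := hH.of_hop h2
  have huz' := hH.of_hop h4
  have huu : G.graph.Reachable u' u := hyu'.symm.trans hyu
  have hzz : G.graph.Reachable z z' := huz.1.symm.trans (huu.symm.trans huz'.1)
  have hdzz : G.rdist z z' ≤ 4 * D + G.rdist u' u := by
    have a1 := G.rdist_triangle huz.1.symm (huu.symm.trans huz'.1)
    have a2 := G.rdist_triangle huu.symm huz'.1
    rw [G.rdist_comm z u] at a1
    rw [G.rdist_comm u u'] at a2
    linarith [huz.2, huz'.2]
  have htot : G.rdist x u + G.rdist u' u + G.rdist y u' ≤ G.rdist x y := by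
    rw [G.rdist_comm u y] at hu
    linarith
  have heu : e * (G.rdist x u + G.rdist u' u + G.rdist y u') ≤ e * G.rdist x y :=
    mul_le_mul_of_nonneg_left htot he
  have he1 := mul_nonneg he (G.rdist_nonneg u' u)
  have he2 := mul_nonneg he (G.rdist_nonneg y u')
  -- The excess `8 D` is `4 D` for walking both detours and another `4 D` because `z` and `z'` are
  -- that much farther apart than `u` and `u'`.
  have fin : ∀ {r : ℝ}, (G.union H).Hop 1 z z' r → r ≤ G.rdist z z' →
      (G.union H).Hop (2 * N * (h + 1) + 2 * h + 1) x y ((1 + (e + 8 / N)) * G.rdist x y) := by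
    intro r hr hr'
    refine ((((h1.trans h2).trans hr).trans h4.symm).trans h3.symm).mono (by ring_nf; omega) ?_
    linarith
  rcases hAB z hz z' hz' hzz with rfl | h5 | ⟨w, hw, h5, h6⟩
  · exact .inl (fin ((Hop.refl z).mono (by simp) le_rfl) (by simp))
  · exact .inl (fin (hH.hop_of_right h5) le_rfl)
  · have hz1 : (G.union H).Hop 1 z w (G.rdist z w) := by
      rcases h5 with rfl | h5
      · exact (Hop.refl w).mono (by simp) (by simp)
      · exact hH.hop_of_right h5
    -- One detour costs `2 D` and the edge to `w` at most `4 D` beyond the middle part; `heN` makes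
    -- the resulting `(1 + e) d + 6 D` at most `2 d`.
    refine .inr ⟨w, hw, ((h1.trans h2).trans hz1).mono (by ring_nf; omega) ?_⟩
    have := G.rdist_nonneg y u'
    linarith

/-- A hierarchy `A 0 ⊇ A 1 ⊇ ⋯` with `A 0` everything and `A (L + 1)` empty yields a hopset. -/
theorem isHopset_of_hierarchy (hH : G.DistWeighted H) (A : ℕ → Set (Fin n)) (hA : ∀ x, x ∈ A 0)
    (hAB : ∀ i, G.LevelEdges H (A i) (A (i + 1))) {L N : ℕ} (hL : ∀ x, x ∉ A (L + 1))
    (hN : 0 < N) (hN3 : 8 * (L : ℝ) ≤ N) {ε : ℝ} (hε : 8 * (L : ℝ) / N ≤ ε) :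
    IsHopset ((5 * N) ^ L) ε G H := by
  have hN' : (0 : ℝ) < N := by exact_mod_cast hN
  have key : ∀ i ≤ L, ∃ h : ℕ, 1 ≤ h ∧ h ≤ (5 * N) ^ i ∧
      G.LevelStretch H h (8 * i / N) (A (i + 1)) := by
    intro i
    induction i with
    | zero => intro _; exact ⟨1, le_rfl, by simp, by simpa using LevelStretch.base hH hA (hAB 0)⟩
    | succ i ih =>
      intro hi
      obtain ⟨h, h1, h2, h3⟩ := ih (by omega)
      refine ⟨2 * N * (h + 1) + 2 * h + 1, by omega, ?_, ?_⟩
      · have hi' : (8 : ℝ) * 1 ≤ N := by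
          refine le_trans ?_ hN3
          have : (1 : ℝ) ≤ L := by exact_mod_cast (by omega : 1 ≤ L)
          linarith
        have hN8 : 8 ≤ N := by exact_mod_cast (by linarith : (8 : ℝ) ≤ N)
        -- The additive terms are absorbed thanks to `1 ≤ h` and `8 ≤ N`.
        calc 2 * N * (h + 1) + 2 * h + 1 ≤ 5 * N * h := by nlinarith
          _ ≤ 5 * N * (5 * N) ^ i := Nat.mul_le_mul_left _ h2
          _ = (5 * N) ^ (i + 1) := by ring
      · have := h3.step hH (hAB (i + 1)) (by positivity) hN ?_
        · convert this using 1
          push_cast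
          ring
        · rw [← add_div, div_le_one hN']
          have : (i : ℝ) + 1 ≤ L := by exact_mod_cast hi
          linarith
  obtain ⟨h, -, h2, h3⟩ := key L le_rfl
  intro u v
  refine ⟨hH.dist_le_hopDist _ u v, ?_⟩
  by_cases huv : G.graph.Reachable u v
  · rcases h3 u v huv with h4 | ⟨z, hz, -⟩
    · have h5 := (h4.mono h2 (mul_le_mul_of_nonneg_right
        (add_le_add_right hε 1) (G.rdist_nonneg u v))).hopDist_le
      have hε0 : 0 ≤ ε := le_trans (by positivity) hε
      rwa [ENNReal.ofReal_mul (by linarith), ← G.dist_eq_ofReal huv] at h5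
    · exact absurd hz (hL z)
  · rw [G.dist_eq_top huv, ENNReal.mul_top]
    · exact le_top
    · have hε0 : 0 ≤ ε := le_trans (by positivity) hε
      simpa using by linarith

end WGraph

end Hopset

/-! ### A program logic with frame conditions and running times. -/

namespace Hopset

/-! ### Reasoning about programs -/

namespace State

variable (s : State) (x y a c i k : ℕ) (r : ℝ) (b : Bool)

@[simp] theorem setWord_wreg : (s.setWord x k).wreg y = if y = x then k else s.wreg y := by
  simp [setWord, Function.update_apply]
@[simp] theorem setWord_rreg : (s.setWord x k).rreg = s.rreg := rfl
@[simp] theorem setWord_warr : (s.setWord x k).warr = s.warr := rfl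
@[simp] theorem setWord_rarr : (s.setWord x k).rarr = s.rarr := rfl
@[simp] theorem setWord_tossed : (s.setWord x k).tossed = s.tossed := rfl

@[simp] theorem putWord_wreg : (s.putWord a i k).wreg = s.wreg := rfl
@[simp] theorem putWord_rreg : (s.putWord a i k).rreg = s.rreg := rfl
@[simp] theorem putWord_warr : (s.putWord a i k).warr c =
    if c = a then Function.update (s.warr a) i k else s.warr c := by
  simp [putWord, Function.update_apply]
@[simp] theorem putWord_rarr : (s.putWord a i k).rarr = s.rarr := rfl
@[simp] theorem putWord_tossed : (s.putWord a i k).tossed = s.tossed := rfl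

@[simp] theorem setReal_wreg : (s.setReal x r).wreg = s.wreg := rfl
@[simp] theorem setReal_rreg : (s.setReal x r).rreg y = if y = x then r else s.rreg y := by
  simp [setReal, Function.update_apply]
@[simp] theorem setReal_warr : (s.setReal x r).warr = s.warr := rfl
@[simp] theorem setReal_rarr : (s.setReal x r).rarr = s.rarr := rfl
@[simp] theorem setReal_tossed : (s.setReal x r).tossed = s.tossed := rfl

@[simp] theorem putReal_wreg : (s.putReal a i r).wreg = s.wreg := rfl
@[simp] theorem putReal_rreg : (s.putReal a i r).rreg = s.rreg := rfl
@[simp] theorem putReal_warr : (s.putReal a i r).warr = s.warr := rfl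
@[simp] theorem putReal_rarr : (s.putReal a i r).rarr c =
    if c = a then Function.update (s.rarr a) i r else s.rarr c := by
  simp [putReal, Function.update_apply]
@[simp] theorem putReal_tossed : (s.putReal a i r).tossed = s.tossed := rfl

@[simp] theorem toss_wreg : (s.toss x b).wreg y = if y = x then b.toNat else s.wreg y := by
  simp [toss]
@[simp] theorem toss_rreg : (s.toss x b).rreg = s.rreg := rfl
@[simp] theorem toss_warr : (s.toss x b).warr = s.warr := rfl
@[simp] theorem toss_rarr : (s.toss x b).rarr = s.rarr := rfl
@[simp] theorem toss_tossed : (s.toss x b).tossed = s.tossed + 1 := rfl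

end State

attribute [simp] WExp.eval RExp.eval WExp.cost RExp.cost Test.Holds Test.cost

/-- The word registers that a program may change. -/
def Prog.wregs : Prog → List ℕ
  | .wset x _ => [x]
  | .flip x => [x]
  | .seq P Q => P.wregs ++ Q.wregs
  | .ite _ P Q => P.wregs ++ Q.wregs
  | .loop _ P => P.wregs
  | _ => []

/-- The real registers that a program may change. -/
def Prog.rregs : Prog → List ℕ
  | .rset x _ => [x]
  | .seq P Q => P.rregs ++ Q.rregs
  | .ite _ P Q => P.rregs ++ Q.rregs
  | .loop _ P => P.rregs
  | _ => []

/-- The word arrays that a program may change. -/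
def Prog.warrs : Prog → List ℕ
  | .wput a _ _ => [a]
  | .seq P Q => P.warrs ++ Q.warrs
  | .ite _ P Q => P.warrs ++ Q.warrs
  | .loop _ P => P.warrs
  | _ => []

/-- The real arrays that a program may change. -/
def Prog.rarrs : Prog → List ℕ
  | .rput a _ _ => [a]
  | .seq P Q => P.rarrs ++ Q.rarrs
  | .ite _ P Q => P.rarrs ++ Q.rarrs
  | .loop _ P => P.rarrs
  | _ => []

/-- Whether a program contains coin tosses. -/
def Prog.flips : Prog → Bool
  | .flip _ => true
  | .seq P Q => P.flips || Q.flips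
  | .ite _ P Q => P.flips || Q.flips
  | .loop _ P => P.flips
  | _ => false

/-- The states `s` and `s'` agree on everything that `P` does not change. -/
structure Agree (P : Prog) (s s' : State) : Prop where
  wreg : ∀ x, x ∉ P.wregs → s'.wreg x = s.wreg x
  rreg : ∀ x, x ∉ P.rregs → s'.rreg x = s.rreg x
  warr : ∀ x, x ∉ P.warrs → s'.warr x = s.warr x
  rarr : ∀ x, x ∉ P.rarrs → s'.rarr x = s.rarr x
  tossed : P.flips = false → s'.tossed = s.tossed

theorem Agree.refl (P : Prog) (s : State) : Agree P s s :=
  ⟨fun _ _ => rfl, fun _ _ => rfl, fun _ _ => rfl, fun _ _ => rfl, fun _ => rfl⟩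

theorem Agree.trans {P : Prog} {s s' s'' : State} (h : Agree P s s') (h' : Agree P s' s'') :
    Agree P s s'' where
  wreg x hx := (h'.wreg x hx).trans (h.wreg x hx)
  rreg x hx := (h'.rreg x hx).trans (h.rreg x hx)
  warr x hx := (h'.warr x hx).trans (h.warr x hx)
  rarr x hx := (h'.rarr x hx).trans (h.rarr x hx)
  tossed hx := (h'.tossed hx).trans (h.tossed hx)

theorem Agree.seq_left {P Q : Prog} {s s' : State} (h : Agree P s s') : Agree (.seq P Q) s s' where
  wreg x hx := h.wreg x fun h' => hx (List.mem_append_left _ h')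
  rreg x hx := h.rreg x fun h' => hx (List.mem_append_left _ h')
  warr x hx := h.warr x fun h' => hx (List.mem_append_left _ h')
  rarr x hx := h.rarr x fun h' => hx (List.mem_append_left _ h')
  tossed hx := h.tossed (by simp_all [Prog.flips])

theorem Agree.seq_right {P Q : Prog} {s s' : State} (h : Agree Q s s') : Agree (.seq P Q) s s' where
  wreg x hx := h.wreg x fun h' => hx (List.mem_append_right _ h')
  rreg x hx := h.rreg x fun h' => hx (List.mem_append_right _ h')
  warr x hx := h.warr x fun h' => hx (List.mem_append_right _ h')
  rarr x hx := h.rarr x fun h' => hx (List.mem_append_right _ h')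
  tossed hx := h.tossed (by simp_all [Prog.flips])

/-- The frame rule. The sets of written locations are computed from the syntax, so for concrete
programs the side conditions are closed by `decide`. -/
theorem Exec.agree {W : ℕ} {ω : ℕ → Bool} {P : Prog} {s s' : State} {t : ℕ}
    (h : Exec W ω P s t s') : Agree P s s' := by
  induction h with
  | skip s => exact .refl _ _
  | wset x e s => constructor <;> simp +contextual [Prog.wregs]
  | wput a i e s => constructor <;> simp +contextual [Prog.warrs]
  | rset x e s => constructor <;> simp +contextual [Prog.rregs]
  | rput a i e s => constructor <;> simp +contextual [Prog.rarrs]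
  | flip x s => constructor <;> simp +contextual [Prog.wregs, Prog.flips]
  | seq _ _ h1 h2 => exact h1.seq_left.trans h2.seq_right
  | @ite_true _ _ Q _ _ _ _ _ h =>
    have := h.seq_left (Q := Q)
    exact ⟨this.wreg, this.rreg, this.warr, this.rarr, this.tossed⟩
  | @ite_false _ P _ _ _ _ _ _ h =>
    have := h.seq_right (P := P)
    exact ⟨this.wreg, this.rreg, this.warr, this.rarr, this.tossed⟩
  | loop_stop _ => exact .refl _ _
  | loop_step _ _ _ h1 h2 =>
    exact Agree.trans (P := .loop _ _) ⟨h1.wreg, h1.rreg, h1.warr, h1.rarr, h1.tossed⟩ h2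

theorem Exec.tossed_le {W : ℕ} {ω : ℕ → Bool} {P : Prog} {s s' : State} {t : ℕ}
    (h : Exec W ω P s t s') : s.tossed ≤ s'.tossed := by
  induction h <;> try simp
  all_goals omega

/-- An execution depends only on the coins that it tosses. -/
theorem Exec.congr_coins {W : ℕ} {ω ω' : ℕ → Bool} {P : Prog} {s s' : State} {t : ℕ}
    (h : Exec W ω P s t s') (hω : ∀ i < s'.tossed, ω i = ω' i) : Exec W ω' P s t s' := by
  induction h with
  | skip s => exact .skip s
  | wset x e s => exact .wset x e s
  | wput a i e s => exact .wput a i e s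
  | rset x e s => exact .rset x e s
  | rput a i e s => exact .rput a i e s
  | flip x s => rw [hω s.tossed (by simp)]; exact .flip x s
  | seq _ h h1 h2 => exact .seq (h1 fun i hi => hω i (hi.trans_le h.tossed_le)) (h2 hω)
  | ite_true hb _ h => exact .ite_true hb (h hω)
  | ite_false hb _ h => exact .ite_false hb (h hω)
  | loop_stop hb => exact Exec.loop_stop hb
  | loop_step hb _ h h1 h2 =>
    exact .loop_step hb (h1 fun i hi => hω i (hi.trans_le h.tossed_le)) (h2 hω)

/-- The program `P`, started in `s`, halts after `t` steps in a state `s'` such that `Q t s'`. -/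
def Runs (W : ℕ) (ω : ℕ → Bool) (P : Prog) (s : State) (Q : ℕ → State → Prop) : Prop :=
  ∃ t s', Exec W ω P s t s' ∧ Q t s'

section

variable {W : ℕ} {ω : ℕ → Bool} {P P' : Prog} {s : State} {Q Q' : ℕ → State → Prop}

/-- The rule of consequence, which also hands the frame condition to the continuation. -/
theorem Runs.mono (h : Runs W ω P s Q) (hQ : ∀ t s', Agree P s s' → Q t s' → Q' t s') :
    Runs W ω P s Q' := by
  obtain ⟨t, s', h1, h2⟩ := h
  exact ⟨t, s', h1, hQ t s' h1.agree h2⟩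

@[simp] theorem runs_skip : Runs W ω .skip s Q ↔ Q 0 s :=
  ⟨fun ⟨_, _, h, hQ⟩ => by cases h; exact hQ, fun h => ⟨_, _, .skip s, h⟩⟩

@[simp] theorem runs_wset {x : ℕ} {e : WExp} :
    Runs W ω (.wset x e) s Q ↔ Q (e.cost + 1) (s.setWord x (e.eval W s)) :=
  ⟨fun ⟨_, _, h, hQ⟩ => by cases h; exact hQ, fun h => ⟨_, _, .wset x e s, h⟩⟩

@[simp] theorem runs_wput {a : ℕ} {i e : WExp} : Runs W ω (.wput a i e) s Q ↔
    Q (i.cost + e.cost + 1) (s.putWord a (i.eval W s) (e.eval W s)) :=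
  ⟨fun ⟨_, _, h, hQ⟩ => by cases h; exact hQ, fun h => ⟨_, _, .wput a i e s, h⟩⟩

@[simp] theorem runs_rset {x : ℕ} {e : RExp} :
    Runs W ω (.rset x e) s Q ↔ Q (e.cost + 1) (s.setReal x (e.eval W s)) :=
  ⟨fun ⟨_, _, h, hQ⟩ => by cases h; exact hQ, fun h => ⟨_, _, .rset x e s, h⟩⟩

@[simp] theorem runs_rput {a : ℕ} {i : WExp} {e : RExp} : Runs W ω (.rput a i e) s Q ↔
    Q (i.cost + e.cost + 1) (s.putReal a (i.eval W s) (e.eval W s)) :=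
  ⟨fun ⟨_, _, h, hQ⟩ => by cases h; exact hQ, fun h => ⟨_, _, .rput a i e s, h⟩⟩

@[simp] theorem runs_flip {x : ℕ} :
    Runs W ω (.flip x) s Q ↔ Q 1 (s.toss x (ω s.tossed)) :=
  ⟨fun ⟨_, _, h, hQ⟩ => by cases h; exact hQ, fun h => ⟨_, _, .flip x s, h⟩⟩

@[simp] theorem runs_seq : Runs W ω (.seq P P') s Q ↔
    Runs W ω P s fun t s' => Runs W ω P' s' fun t' s'' => Q (t + t') s'' :=
  ⟨fun ⟨_, _, h, hQ⟩ => by cases h with | seq h1 h2 => exact ⟨_, _, h1, _, _, h2, hQ⟩,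
    fun ⟨_, _, h1, _, _, h2, hQ⟩ => ⟨_, _, .seq h1 h2, hQ⟩⟩

@[simp] theorem runs_ite {b : Test} : Runs W ω (.ite b P P') s Q ↔
    (b.Holds W s → Runs W ω P s fun t s' => Q (b.cost + t) s') ∧
    (¬ b.Holds W s → Runs W ω P' s fun t s' => Q (b.cost + t) s') := by
  constructor
  · rintro ⟨_, _, h, hQ⟩
    cases h with
    | ite_true hb h => exact ⟨fun _ => ⟨_, _, h, hQ⟩, fun hb' => absurd hb hb'⟩
    | ite_false hb h => exact ⟨fun hb' => absurd hb' hb, fun _ => ⟨_, _, h, hQ⟩⟩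
  · rintro ⟨h1, h2⟩
    by_cases hb : b.Holds W s
    · obtain ⟨_, _, h, hQ⟩ := h1 hb
      exact ⟨_, _, .ite_true hb h, hQ⟩
    · obtain ⟨_, _, h, hQ⟩ := h2 hb
      exact ⟨_, _, .ite_false hb h, hQ⟩

/-- The rule for loops: an invariant `Inv a` with a ghost parameter `a`, and a potential `Φ a` that
pays for the remaining steps. -/
theorem Runs.loop {b : Test} {α : Type*} (Inv : α → State → Prop) (Φ : α → ℕ) (a₀ : α)
    (h₀ : Inv a₀ s)
    (step : ∀ a s', Agree P s s' → Inv a s' → b.Holds W s' →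
      Runs W ω P s' fun t s'' => ∃ a', Inv a' s'' ∧ b.cost + t + Φ a' ≤ Φ a) :
    Runs W ω (.loop b P) s fun t s' =>
      ∃ a, Agree P s s' ∧ Inv a s' ∧ ¬ b.Holds W s' ∧ t + Φ a ≤ Φ a₀ + b.cost := by
  -- Every round pays at least for its test, so the potential drops strictly: the cost bound also
  -- proves termination.
  have hcost : ∀ b : Test, 0 < b.cost := fun b => by cases b <;> simp
  suffices H : ∀ k a s', Φ a = k → Agree P s s' → Inv a s' → Runs W ω (.loop b P) s' fun t s'' =>
      ∃ a', Agree P s s'' ∧ Inv a' s'' ∧ ¬ b.Holds W s'' ∧ t + Φ a' ≤ Φ a + b.cost from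
    H _ a₀ s rfl (.refl P s) h₀
  intro k
  induction k using Nat.strong_induction_on with
  | _ k ih =>
    intro a s' hk hs hI
    by_cases hb : b.Holds W s'
    · obtain ⟨t, s₁, h1, a', hI', hc⟩ := step a s' hs hI hb
      obtain ⟨t', s₂, h2, a'', hs'', hI'', hb'', hc'⟩ :=
        ih (Φ a') (by have := hcost b; omega) a' s₁ rfl (hs.trans h1.agree) hI'
      exact ⟨_, _, .loop_step hb h1 h2, a'', hs'', hI'', hb'', by omega⟩
    · exact ⟨_, _, Exec.loop_stop hb, a, hs, hI, hb, by omega⟩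

end

end Hopset

/-! ### The search of a single cluster: priority queue, invariant and program. -/

namespace Hopset

/-! ### Tournament trees

A priority queue for the numbers `x < M` with priorities `key x`: the nodes of a complete binary
tree are numbered `1, …, 2 * M - 1`, the parent of `k` is `k / 2`, and `M + x` is the leaf of `x`.
A node holds the member of the queue of least priority among the leaves below it, or `0`. -/

/-- The leaf of `x` is below the node `k`. -/
def Below (M x k : ℕ) : Prop := x < M ∧ ∃ j, (M + x) / 2 ^ j = k

/-- The node `k` holds the right value. -/
def NodeOK (M : ℕ) (T : ℕ → ℕ) (key : ℕ → ℝ) (k : ℕ) : Prop :=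
  (∀ x, Below M x k → T (M + x) ≠ 0 → T k ≠ 0 ∧ key (T k) ≤ key x) ∧
    (T k ≠ 0 → Below M (T k) k ∧ T (M + T k) = T k)

/-- All nodes hold the right values. -/
def Heap (M : ℕ) (T : ℕ → ℕ) (key : ℕ → ℝ) : Prop := ∀ k, 1 ≤ k → k < 2 * M → NodeOK M T key k

/-- All nodes hold the right values, except possibly the proper ancestors of `c` above `x`. -/
def HeapExcept (M : ℕ) (T : ℕ → ℕ) (key : ℕ → ℝ) (x c : ℕ) : Prop :=
  ∀ k, 1 ≤ k → k < 2 * M → (k ≤ c / 2 → ¬ Below M x k) → NodeOK M T key k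

theorem Below.le_half {M x k : ℕ} (h : Below M x k) (hk : k ≠ M + x) : k ≤ (M + x) / 2 := by
  obtain ⟨_, j, rfl⟩ := h
  cases j with
  | zero => simp at hk
  | succ j =>
    rw [pow_succ', ← Nat.div_div_eq_div_mul]
    exact Nat.div_le_self _ _

theorem Below.half {M x k : ℕ} (h : Below M x k) : Below M x (k / 2) := by
  obtain ⟨h1, j, rfl⟩ := h
  exact ⟨h1, j + 1, by rw [pow_succ, Nat.div_div_eq_div_mul]⟩

theorem Below.child {M x k : ℕ} (h : Below M x k) (hk : k < M) :
    Below M x (2 * k) ∨ Below M x (2 * k + 1) := by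
  obtain ⟨h1, j, hj⟩ := h
  cases j with
  | zero => simp at hj; omega
  | succ j =>
    rw [pow_succ, ← Nat.div_div_eq_div_mul] at hj
    have : (M + x) / 2 ^ j = 2 * k ∨ (M + x) / 2 ^ j = 2 * k + 1 := by omega
    exact this.imp (fun h => ⟨h1, j, h⟩) fun h => ⟨h1, j, h⟩

/-- Two nodes above the same leaf are comparable. -/
theorem Below.le_half_of_lt {M x k c : ℕ} (h : Below M x k) (h' : Below M x c) (hk : k < c) :
    k ≤ c / 2 := by
  obtain ⟨_, j, rfl⟩ := h
  obtain ⟨_, i, rfl⟩ := h'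
  have : i < j := by
    by_contra hij
    have h2 : (2 : ℕ) ^ j ≤ 2 ^ i := pow_le_pow_right₀ (by norm_num) (not_lt.1 hij)
    have := Nat.div_le_div_left (a := M + x) h2 (by positivity)
    omega
  rw [Nat.div_div_eq_div_mul, ← pow_succ]
  exact Nat.div_le_div_left (pow_le_pow_right₀ (by norm_num) this) (by positivity)

/-- A node that is not above the leaf of `x` sees neither the new leaf nor the new key. The same
statement serves insertion, decrease of a key and deletion. -/
theorem Heap.setLeaf {M x val : ℕ} {T : ℕ → ℕ} {key key' : ℕ → ℝ} (h : Heap M T key)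
    (hx : x < M) (hkey : ∀ y, y ≠ x → key' y = key y) (hval : val = 0 ∨ val = x) :
    HeapExcept M (Function.update T (M + x) val) key' x (M + x) := by
  intro k h1 h2 h3
  by_cases hk : k = M + x
  · subst hk
    refine ⟨fun y hy hy' => ?_, fun hne => ?_⟩
    · have hyx : y = x := by
        by_contra hne
        have := hy.le_half (by omega)
        have := hy.1
        omega
      subst hyx
      simp only [Function.update_self] at hy' ⊢
      rcases hval with rfl | rfl
      · exact absurd rfl hy'
      · exact ⟨hy', le_rfl⟩
    · simp only [Function.update_self] at hne ⊢
      rcases hval with rfl | rfl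
      · exact absurd rfl hne
      · exact ⟨⟨hx, 0, by simp⟩, by simp⟩
  · have hb : ¬ Below M x k := fun hb => h3 (hb.le_half hk) hb
    obtain ⟨a1, a2⟩ := h k h1 h2
    have hleaf : ∀ y, Below M y k → Function.update T (M + x) val (M + y) = T (M + y) := by
      intro y hy
      rw [Function.update_of_ne]
      rintro heq
      exact hb (by rwa [← Nat.add_left_cancel heq])
    have hne : ∀ y, Below M y k → y ≠ x := fun y hy hyx => hb (hyx ▸ hy)
    simp only [NodeOK, Function.update_of_ne hk]
    refine ⟨fun y hy hy' => ?_, fun h0 => ?_⟩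
    · rw [hleaf y hy] at hy'
      have h4 := a1 y hy hy'
      rw [hkey y (hne y hy), hkey _ (hne _ (a2 h4.1).1)]
      exact h4
    · rw [hleaf _ (a2 h0).1]
      exact a2 h0

/-- Both children of `c / 2` are already correct, so the better of their values is correct there,
and only the ancestors of `c / 2` remain in doubt. If both children are empty, the second
alternative applies with `p = 0`. -/
theorem HeapExcept.step {M x c p : ℕ} {T : ℕ → ℕ} {key : ℕ → ℝ} (h : HeapExcept M T key x c)
    (hc : Below M x c) (hcM : c < 2 * M)
    (hp : (T (2 * (c / 2)) ≠ 0 ∧ (T (2 * (c / 2) + 1) ≠ 0 →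
        key (T (2 * (c / 2))) ≤ key (T (2 * (c / 2) + 1))) ∧ p = T (2 * (c / 2))) ∨
      ((T (2 * (c / 2)) ≠ 0 → T (2 * (c / 2) + 1) ≠ 0 ∧
        key (T (2 * (c / 2) + 1)) ≤ key (T (2 * (c / 2)))) ∧ p = T (2 * (c / 2) + 1))) :
    HeapExcept M (Function.update T (c / 2) p) key x (c / 2) := by
  have hleaf : ∀ y, Function.update T (c / 2) p (M + y) = T (M + y) := fun y =>
    Function.update_of_ne (by omega) _ _
  intro k h1 h2 h3
  by_cases hk : k = c / 2
  · subst hk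
    obtain ⟨l1, l2⟩ := h (2 * (c / 2)) (by omega) (by omega) (by omega)
    obtain ⟨r1, r2⟩ := h (2 * (c / 2) + 1) (by omega) (by omega) (by omega)
    simp only [NodeOK, hleaf, Function.update_self]
    have hl : ∀ y, Below M y (2 * (c / 2)) → Below M y (c / 2) := fun y hy => by
      have := hy.half; rwa [Nat.mul_div_cancel_left _ (by norm_num)] at this
    have hr : ∀ y, Below M y (2 * (c / 2) + 1) → Below M y (c / 2) := fun y hy => by
      have := hy.half
      rwa [show (2 * (c / 2) + 1) / 2 = c / 2 by omega] at this
    refine ⟨fun y hy hy' => ?_, fun h0 => ?_⟩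
    · rcases hy.child (by omega) with hy | hy
      · have h4 := l1 y hy hy'
        rcases hp with ⟨a1, _, rfl⟩ | ⟨a1, rfl⟩
        · exact h4
        · exact ⟨(a1 h4.1).1, (a1 h4.1).2.trans h4.2⟩
      · have h4 := r1 y hy hy'
        rcases hp with ⟨a1, a2, rfl⟩ | ⟨a1, rfl⟩
        · exact ⟨a1, (a2 h4.1).trans h4.2⟩
        · exact h4
    · rcases hp with ⟨a1, _, rfl⟩ | ⟨a1, rfl⟩
      · exact ⟨hl _ (l2 h0).1, (l2 h0).2⟩
      · exact ⟨hr _ (r2 h0).1, (r2 h0).2⟩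
  · have hn : NodeOK M T key k := by
      refine h k h1 h2 fun hle hb => ?_
      exact h3 (hb.le_half_of_lt hc.half (by omega)) hb
    simpa only [NodeOK, hleaf, Function.update_of_ne hk] using hn

theorem HeapExcept.heap {M x : ℕ} {T : ℕ → ℕ} {key : ℕ → ℝ} (h : HeapExcept M T key x 1) :
    Heap M T key := fun k h1 h2 => h k h1 h2 (by omega)

/-- The number of leaves is a power of two so that every leaf has depth exactly `l`. -/
theorem below_root {l x : ℕ} (hx : x < 2 ^ l) : Below (2 ^ l) x 1 := by
  refine ⟨hx, l, ?_⟩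
  rw [Nat.div_eq_of_lt_le] <;> omega

theorem Heap.root_eq_zero {l : ℕ} {T : ℕ → ℕ} {key : ℕ → ℝ} (h : Heap (2 ^ l) T key)
    (h0 : T 1 = 0) (x : ℕ) (hx : x < 2 ^ l) : T (2 ^ l + x) = 0 := by
  by_contra hne
  exact ((h 1 le_rfl (by have := Nat.two_pow_pos l; omega)).1 x (below_root hx) hne).1 h0

theorem Heap.root_ne_zero {l : ℕ} {T : ℕ → ℕ} {key : ℕ → ℝ} (h : Heap (2 ^ l) T key)
    (h0 : T 1 ≠ 0) : T 1 < 2 ^ l ∧ T (2 ^ l + T 1) = T 1 ∧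
      ∀ x < 2 ^ l, T (2 ^ l + x) ≠ 0 → key (T 1) ≤ key x := by
  obtain ⟨a1, a2⟩ := h 1 le_rfl (by have := Nat.two_pow_pos l; omega)
  exact ⟨(a2 h0).1.1, (a2 h0).2, fun x hx hne => (a1 x (below_root hx) hne).2⟩

/-- Recompute the ancestors of the node in register `11`. The tree is in the word array `7` and
the priorities are in the real array `2`. -/
def fixProg : Prog :=
  .loop (.wle (.lit 2) (.reg 11)) <|
    .seq (.wset 11 (.div (.reg 11) (.lit 2))) <|
    .seq (.wset 17 (.get 7 (.mul (.lit 2) (.reg 11)))) <|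
    .seq (.wset 18 (.get 7 (.add (.mul (.lit 2) (.reg 11)) (.lit 1)))) <|
    .ite (.conj (.neg (.wle (.reg 17) (.lit 0))) (.neg (.conj (.neg (.wle (.reg 18) (.lit 0)))
        (.neg (.rle (.get 2 (.reg 17)) (.get 2 (.reg 18)))))))
      (.wput 7 (.reg 11) (.reg 17)) (.wput 7 (.reg 11) (.reg 18))

theorem fixProg_spec {W : ℕ} {ω : ℕ → Bool} {s : State} {l x : ℕ} (hW : 2 * 2 ^ l + 2 ≤ W)
    (hx : x < 2 ^ l) (hk : s.wreg 11 = 2 ^ l + x)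
    (hheap : HeapExcept (2 ^ l) (s.warr 7) (s.rarr 2) x (2 ^ l + x)) :
    Runs W ω fixProg s fun t s' => t ≤ 50 * (l + 1) ∧ Heap (2 ^ l) (s'.warr 7) (s.rarr 2) ∧
      ∀ k, 2 ^ l ≤ k → s'.warr 7 k = s.warr 7 k := by
  have hl := Nat.two_pow_pos l
  refine (Runs.loop (α := ℕ) (fun j s' => j ≤ l ∧ s'.wreg 11 = (2 ^ l + x) / 2 ^ j ∧
      HeapExcept (2 ^ l) (s'.warr 7) (s.rarr 2) x (s'.wreg 11) ∧
      ∀ k, 2 ^ l ≤ k → s'.warr 7 k = s.warr 7 k) (fun j => 50 * (l - j)) 0 ?_ ?_).mono ?_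
  · simp [hk, hheap]
  · rintro j s' hag ⟨hj, hreg, hh, hleaf⟩ hb
    have h2 : 2 % W = 2 := Nat.mod_eq_of_lt (by omega)
    have h1 : 1 % W = 1 := Nat.mod_eq_of_lt (by omega)
    have hr2 : s'.rarr 2 = s.rarr 2 := hag.rarr 2 (by decide)
    simp only [Test.Holds, WExp.eval, h2] at hb
    have hbelow : Below (2 ^ l) x (s'.wreg 11) := ⟨hx, j, hreg.symm⟩
    have hlt : s'.wreg 11 < 2 * 2 ^ l := by
      rw [hreg]; exact (Nat.div_le_self _ _).trans_lt (by omega)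
    have hjl : j < l := by
      by_contra hjl
      have : j = l := by omega
      rw [hreg, this, Nat.div_eq_of_lt_le (k := 1)] at hb <;> omega
    have hreg' : s'.wreg 11 / 2 = (2 ^ l + x) / 2 ^ (j + 1) := by
      rw [hreg, pow_succ, Nat.div_div_eq_div_mul]
    have hm1 : 2 * (s'.wreg 11 / 2) % W = 2 * (s'.wreg 11 / 2) := Nat.mod_eq_of_lt (by omega)
    have hm2 : (2 * (s'.wreg 11 / 2) + 1) % W = 2 * (s'.wreg 11 / 2) + 1 :=
      Nat.mod_eq_of_lt (by omega)
    simp [h1, h2, hm1, hm2, hr2]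
    refine ⟨fun ha hb => ⟨j + 1, ⟨by omega, hreg', ?_, fun k hk => ?_⟩, by omega⟩,
      fun ha => ⟨j + 1, ⟨by omega, hreg', ?_, fun k hk => ?_⟩, by omega⟩⟩
    · exact hh.step hbelow hlt (.inl ⟨by omega, fun h => hb (by omega), rfl⟩)
    · rw [Function.update_of_ne (by omega)]; exact hleaf k hk
    · refine hh.step hbelow hlt (.inr ⟨fun h => ?_, rfl⟩)
      have := ha (by omega)
      exact ⟨by omega, this.2.le⟩
    · rw [Function.update_of_ne (by omega)]; exact hleaf k hk
  · rintro t s' hag ⟨j, -, ⟨hj, hreg, hh, hleaf⟩, hb, ht⟩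
    have h2 : 2 % W = 2 := Nat.mod_eq_of_lt (by omega)
    simp only [Test.Holds, WExp.eval, h2] at hb
    simp at ht
    refine ⟨by omega, ?_, hleaf⟩
    have h1 : 1 ≤ s'.wreg 11 := by
      rw [hreg, Nat.one_le_div_iff (by positivity)]
      exact (Nat.pow_le_pow_right (by norm_num) hj).trans (by omega)
    rw [show s'.wreg 11 = 1 by omega] at hh
    exact hh.heap

end Hopset

namespace Hopset

/-! ### Dijkstra's algorithm, pruned to a cluster -/

namespace WGraph

variable {n : ℕ} (G : WGraph n)

/-- The distance of `v` from the set `A` is more than `r`. -/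
def FarFrom (A : Set (Fin n)) (v : Fin n) (r : ℝ) : Prop :=
  ∀ p ∈ A, G.graph.Reachable p v → r < G.rdist p v

/-- The cluster of `u`: the vertices that are closer to `u` than to the set `A`. -/
def cluster (A : Set (Fin n)) (u : Fin n) : Set (Fin n) :=
  {v | G.graph.Reachable u v ∧ G.FarFrom A v (G.rdist u v)}

variable {G} {A : Set (Fin n)}

theorem FarFrom.anti {v : Fin n} {r r' : ℝ} (h : G.FarFrom A v r) (hr : r' ≤ r) :
    G.FarFrom A v r' := fun p hp hpv => hr.trans_lt (h p hp hpv)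

/-- Crossing an edge changes the distance from `A` by at most its weight. Hence a walk from the root
that ends far enough from `A` does so at every intermediate vertex, and pruning cuts off no member
of the cluster. -/
theorem FarFrom.of_adj {x y : Fin n} {r : ℝ} (hxy : G.graph.Adj x y)
    (h : G.FarFrom A y (r + G.weight s(x, y))) : G.FarFrom A x r := by
  intro p hp hpx
  have h1 := h p hp (hpx.trans hxy.reachable)
  have h2 := G.rdist_triangle hpx hxy.reachable
  have h3 := G.rdist_le_weight hxy
  linarith

/-- The invariant of the algorithm. The vertices in `X` are settled, those in `Q` are in the queue;
`r` is the key of the last settled vertex, and the edge from `a` to `b` has been relaxed if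
`Done a b`. -/
structure DInv (G : WGraph n) (A : Set (Fin n)) (u : Fin n) (X : Finset (Fin n))
    (Q : Fin n → Prop) (key : Fin n → ℝ) (r : ℝ) (Done : Fin n → Fin n → Prop) : Prop where
  disj : ∀ v ∈ X, ¬ Q v
  walk : ∀ v, v ∈ X ∨ Q v → ∃ p : G.graph.Walk v u, G.walkWeight p = key v
  far : ∀ v, v ∈ X ∨ Q v → G.FarFrom A v (key v)
  settled : ∀ a b, Done a b → a ∈ X
  relaxed : ∀ a b, Done a b → G.graph.Adj a b → G.FarFrom A b (key a + G.weight s(a, b)) →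
    (b ∈ X ∨ Q b) ∧ key b ≤ key a + G.weight s(a, b)
  le_of_mem : ∀ v ∈ X, key v ≤ r
  le_of_queue : ∀ v, Q v → r ≤ key v
  root : G.FarFrom A u 0 → (u ∈ X ∨ Q u) ∧ key u ≤ 0

variable {u : Fin n} {X : Finset (Fin n)} {Q Q' : Fin n → Prop} {key key' : Fin n → ℝ} {r : ℝ}
  {Done Done' : Fin n → Fin n → Prop}

/-- If `u` lies in `A`, the queue starts empty, in accordance with the cluster being empty. -/
theorem DInv.init (hQ : ∀ v, Q v ↔ v = u ∧ G.FarFrom A u 0)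
    (hkey : G.FarFrom A u 0 → key u = 0) :
    G.DInv A u ∅ Q key 0 fun _ _ => False where
  disj := by simp
  walk v hv := by
    obtain ⟨rfl, h⟩ := (hQ v).1 (by simpa using hv)
    exact ⟨.nil, by simp [hkey h]⟩
  far v hv := by
    obtain ⟨rfl, h⟩ := (hQ v).1 (by simpa using hv)
    rwa [hkey h]
  settled _ _ h := h.elim
  relaxed _ _ h := h.elim
  le_of_mem := by simp
  le_of_queue v hv := by
    obtain ⟨rfl, h⟩ := (hQ v).1 hv
    exact (hkey h).ge
  root h := ⟨.inr ((hQ u).2 ⟨rfl, h⟩), (hkey h).le⟩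

theorem DInv.congr (h : G.DInv A u X Q key r Done) (hQ : ∀ v, Q' v ↔ Q v)
    (hkey : ∀ v, key' v = key v) (hDone : ∀ a b, Done' a b → Done a b) :
    G.DInv A u X Q' key' r Done' := by
  obtain rfl : Q' = Q := funext fun v => propext (hQ v)
  obtain rfl : key' = key := funext hkey
  exact ⟨h.disj, h.walk, h.far, fun a b hd => h.settled a b (hDone a b hd),
    fun a b hd => h.relaxed a b (hDone a b hd), h.le_of_mem, h.le_of_queue, h.root⟩

/-- The least key in the queue becomes the new frontier `r`; all settled keys stay below it because
they were below the old one. -/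
theorem DInv.pop {v : Fin n} (h : G.DInv A u X Q key r Done) (hv : Q v)
    (hmin : ∀ y, Q y → key v ≤ key y) (hQ' : ∀ y, Q' y ↔ Q y ∧ y ≠ v) :
    G.DInv A u (insert v X) Q' key (key v) Done := by
  classical
  have hmem : ∀ y, y ∈ insert v X ∨ Q' y ↔ y ∈ X ∨ Q y := fun y => by
    rw [hQ', Finset.mem_insert]
    by_cases hy : y = v
    · subst hy; simp [hv]
    · simp [hy]
  refine ⟨fun y hy hqy => ?_, fun y hy => h.walk y ((hmem y).1 hy),
    fun y hy => h.far y ((hmem y).1 hy), fun a b hd => Finset.mem_insert_of_mem (h.settled a b hd),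
    fun a b hd hab hf => ?_, fun y hy => ?_, fun y hy => hmin y ((hQ' y).1 hy).1, fun hf => ?_⟩
  · obtain ⟨h1, h2⟩ := (hQ' y).1 hqy
    rcases Finset.mem_insert.1 hy with rfl | hy
    · exact h2 rfl
    · exact h.disj y hy h1
  · rw [hmem]
    exact h.relaxed a b hd hab hf
  · rcases Finset.mem_insert.1 hy with rfl | hy
    · exact le_rfl
    · exact (h.le_of_mem y hy).trans (h.le_of_queue v hv)
  · rw [hmem]
    exact h.root hf

theorem DInv.relax_take {v y : Fin n} (h : G.DInv A u X Q key r Done) (hv : v ∈ X)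
    (hr : key v = r) (hvy : G.graph.Adj v y) (hfar : G.FarFrom A y (r + G.weight s(v, y)))
    (hy : ¬ (y ∈ X ∨ Q y) ∨ r + G.weight s(v, y) < key y)
    (hQ' : ∀ a, Q' a ↔ Q a ∨ a = y) (hkey' : ∀ a, a ≠ y → key' a = key a)
    (hkey'y : key' y = r + G.weight s(v, y)) :
    y ∉ X ∧ G.DInv A u X Q' key' r fun a b => Done a b ∨ a = v ∧ b = y := by
  have hw := G.weight_pos_of_adj hvy
  -- Settled keys are at most `r`, while the offered key exceeds `r` because weights are positive; a
  -- settled vertex is never lowered.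
  have hyX : y ∉ X := fun hyX => by
    rcases hy with h1 | h1
    · exact h1 (.inl hyX)
    · linarith [h.le_of_mem y hyX]
  have hne : ∀ a ∈ X, a ≠ y := fun a ha hay => hyX (hay ▸ ha)
  have hmem : ∀ a, a ∈ X ∨ Q' a ↔ (a ∈ X ∨ Q a) ∨ a = y := fun a => by rw [hQ', or_assoc]
  have hle : ∀ a, a ∈ X ∨ Q a → key' a ≤ key a := fun a ha => by
    by_cases hay : a = y
    · subst hay
      rcases hy with h1 | h1
      · exact absurd ha h1
      · rw [hkey'y]; exact h1.le
    · exact (hkey' a hay).le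
  refine ⟨hyX, fun a ha hqa => ?_, fun a ha => ?_, fun a ha => ?_, fun a b hd => ?_,
    fun a b hd hab hf => ?_, fun a ha => ?_, fun a ha => ?_, fun hf => ?_⟩
  · rcases (hQ' a).1 hqa with h1 | h1
    · exact h.disj a ha h1
    · exact hne a ha h1
  · by_cases hay : a = y
    · subst hay
      obtain ⟨p, hp⟩ := h.walk v (.inl hv)
      refine ⟨.cons hvy.symm p, ?_⟩
      rw [walkWeight_cons, hp, hkey'y, hr, Sym2.eq_swap, add_comm]
    · rw [hkey' a hay]
      exact h.walk a (((hmem a).1 ha).resolve_right hay)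
  · by_cases hay : a = y
    · subst hay
      rwa [hkey'y]
    · rw [hkey' a hay]
      exact h.far a (((hmem a).1 ha).resolve_right hay)
  · rcases hd with hd | ⟨rfl, rfl⟩
    · exact h.settled a b hd
    · exact hv
  · rw [hmem]
    rcases hd with hd | ⟨rfl, rfl⟩
    · rw [hkey' a (hne a (h.settled a b hd))] at hf ⊢
      have h1 := h.relaxed a b hd hab hf
      exact ⟨.inl h1.1, (hle b h1.1).trans h1.2⟩
    · rw [hkey' a (hne a hv), hkey'y, hr]
      exact ⟨.inr rfl, le_rfl⟩
  · rw [hkey' a (hne a ha)]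
    exact h.le_of_mem a ha
  · by_cases hay : a = y
    · subst hay
      rw [hkey'y]; linarith
    · rw [hkey' a hay]
      exact h.le_of_queue a (((hQ' a).1 ha).resolve_right hay)
  · rw [hmem]
    have h1 := h.root hf
    exact ⟨.inl h1.1, (hle u h1.1).trans h1.2⟩

theorem DInv.relax_skip {v y : Fin n} (h : G.DInv A u X Q key r Done) (hv : v ∈ X)
    (hr : key v = r) (hskip : G.FarFrom A y (r + G.weight s(v, y)) →
      (y ∈ X ∨ Q y) ∧ key y ≤ r + G.weight s(v, y)) :
    G.DInv A u X Q key r fun a b => Done a b ∨ a = v ∧ b = y := by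
  refine ⟨h.disj, h.walk, h.far, fun a b hd => ?_, fun a b hd hab hf => ?_, h.le_of_mem,
    h.le_of_queue, h.root⟩
  · rcases hd with hd | ⟨rfl, rfl⟩
    · exact h.settled a b hd
    · exact hv
  · rcases hd with hd | ⟨rfl, rfl⟩
    · exact h.relaxed a b hd hab hf
    · rw [hr] at hf ⊢
      exact hskip hf

theorem DInv.rdist_le {v : Fin n} (h : G.DInv A u X Q key r Done) (hv : v ∈ X ∨ Q v) :
    G.graph.Reachable u v ∧ G.rdist u v ≤ key v := by
  obtain ⟨p, hp⟩ := h.walk v hv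
  refine ⟨⟨p.reverse⟩, ?_⟩
  rw [← hp, ← G.walkWeight_reverse]
  exact G.rdist_le _

theorem DInv.mem_cluster {v : Fin n} (h : G.DInv A u X Q key r Done) (hv : v ∈ X ∨ Q v) :
    v ∈ G.cluster A u :=
  ⟨(h.rdist_le hv).1, (h.far v hv).anti (h.rdist_le hv).2⟩

/-- At the end the settled vertices form the cluster, and their keys are their distances. -/
theorem DInv.final (h : G.DInv A u X Q key r Done) (hQ : ∀ v, ¬ Q v)
    (hDone : ∀ a ∈ X, ∀ b, G.graph.Adj a b → Done a b) :
    (∀ v, v ∈ X ↔ v ∈ G.cluster A u) ∧ ∀ v ∈ X, key v = G.rdist u v := by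
  -- Walks are directed towards the root, so that the tail in the induction is the part that the
  -- search covers first; `FarFrom.of_adj` passes the hypothesis to the tail.
  have main : ∀ (v w : Fin n) (p : G.graph.Walk v w), w = u → G.FarFrom A v (G.walkWeight p) →
      v ∈ X ∧ key v ≤ G.walkWeight p := by
    intro v w p
    induction p with
    | nil =>
      rintro rfl hf
      rw [walkWeight_nil] at hf ⊢
      have := h.root hf
      exact ⟨this.1.resolve_right (hQ _), this.2⟩
    | @cons a b c hab p ih =>
      rintro hu hf
      rw [walkWeight_cons, add_comm, Sym2.eq_swap] at hf ⊢
      have h1 := ih hu (hf.of_adj hab.symm)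
      have h2 := h.relaxed b a (hDone b h1.1 a hab.symm) hab.symm (hf.anti (by linarith [h1.2]))
      exact ⟨h2.1.resolve_right (hQ _), by linarith [h1.2, h2.2]⟩
  have main' : ∀ v ∈ G.cluster A u, v ∈ X ∧ key v ≤ G.rdist u v := by
    rintro v ⟨hv, hf⟩
    obtain ⟨p, hp⟩ := G.exists_walk_eq_rdist hv.symm
    rw [G.rdist_comm u v, ← hp] at hf ⊢
    exact main v u p rfl hf
  refine ⟨fun v => ⟨fun hv => h.mem_cluster (.inl hv), fun hv => (main' v hv).1⟩, fun v hv => ?_⟩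
  exact le_antisymm (main' v (h.mem_cluster (.inl hv))).2 (h.rdist_le (.inl hv)).2

end WGraph

end Hopset

namespace Hopset

variable {n : ℕ}

/-! ### Relaxation of an edge -/

/-- Lower the key of the vertex in register `14` to the number in the real register `4` and put
the vertex into the queue, if this is an improvement and the bound of the vertex (in the real array
`3`, no bound if the word array `9` holds `0`) allows it. -/
def relaxProg : Prog :=
  .ite (.conj (.neg (.conj (.neg (.wle (.get 9 (.reg 14)) (.lit 0)))
        (.rle (.get 3 (.reg 14)) (.reg 4))))
      (.neg (.conj (.wle (.reg 13) (.get 8 (.reg 14))) (.rle (.get 2 (.reg 14)) (.reg 4)))))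
    (.seq (.wput 8 (.reg 14) (.reg 13)) <|
      .seq (.rput 2 (.reg 14) (.reg 4)) <|
      .seq (.wset 11 (.add (.reg 3) (.reg 14))) <|
      .seq (.wput 7 (.reg 11) (.reg 14)) fixProg)
    .skip

theorem relaxProg_spec {W : ℕ} {ω : ℕ → Bool} {s : State} {l x : ℕ} (hW : 2 * 2 ^ l + 2 ≤ W)
    (hx : x < 2 ^ l) (hreg : s.wreg 14 = x) (hM : s.wreg 3 = 2 ^ l)
    (hheap : Heap (2 ^ l) (s.warr 7) (s.rarr 2)) :
    Runs W ω relaxProg s fun t s' => t ≤ 90 * (l + 1) ∧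
      ((((s.warr 9 x = 0 ∨ s.rreg 4 < s.rarr 3 x) ∧
          (s.warr 8 x < s.wreg 13 ∨ s.rreg 4 < s.rarr 2 x)) ∧
        s'.warr 8 = Function.update (s.warr 8) x (s.wreg 13) ∧
        s'.rarr 2 = Function.update (s.rarr 2) x (s.rreg 4) ∧
        Heap (2 ^ l) (s'.warr 7) (s'.rarr 2) ∧
        ∀ k, 2 ^ l ≤ k → s'.warr 7 k = Function.update (s.warr 7) (2 ^ l + x) x k) ∨
      (¬ ((s.warr 9 x = 0 ∨ s.rreg 4 < s.rarr 3 x) ∧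
          (s.warr 8 x < s.wreg 13 ∨ s.rreg 4 < s.rarr 2 x)) ∧
        s'.warr 8 = s.warr 8 ∧ s'.rarr 2 = s.rarr 2 ∧ s'.warr 7 = s.warr 7)) := by
  have hm : (2 ^ l + x) % W = 2 ^ l + x := Nat.mod_eq_of_lt (by omega)
  simp only [relaxProg, runs_ite, runs_seq, runs_wput, runs_rput, runs_wset, runs_skip]
  constructor
  · intro hb
    refine (fixProg_spec (l := l) (x := x) hW hx (by simp [hreg, hM, hm]) ?_).mono ?_
    · simp [hreg, hM, hm]
      exact hheap.setLeaf hx (fun y hy => by simp [hy]) (.inr rfl)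
    · rintro t s' hag ⟨ht, hh, hl⟩
      have e1 := hag.warr 8 (by decide)
      have e2 := hag.rarr 2 (by decide)
      simp [hreg, hM, hm] at e1 e2 hh hl hb ⊢
      refine ⟨by omega, .inl ⟨⟨?_, ?_⟩, e1, e2, by rwa [e2], hl⟩⟩
      · by_cases h0 : s.warr 9 x = 0
        · exact .inl h0
        · exact .inr (hb.1 h0)
      · by_cases h0 : s.warr 8 x < s.wreg 13
        · exact .inl h0
        · exact .inr (hb.2 (by omega))
  · intro hb
    simp [hreg] at hb ⊢
    exact ⟨by omega, .inr fun h1 => hb fun h0 => h1.resolve_left h0⟩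

/-! ### The state of the search -/

/-- The word array `piv` and the real array `D` hold, for every vertex, a nearest vertex of `A` and
its distance, or `0` if there is none in the component. Vertices are numbered from `1`. -/
def Nearest (G : WGraph n) (A : Set (Fin n)) (piv : ℕ → ℕ) (D : ℕ → ℝ) : Prop :=
  ∀ v : Fin n, (piv (v + 1) = 0 ∧ ∀ p ∈ A, ¬ G.graph.Reachable p v) ∨
    ∃ p ∈ A, G.graph.Reachable p v ∧ piv (v + 1) = p + 1 ∧ D (v + 1) = G.rdist p v ∧
      ∀ q ∈ A, G.graph.Reachable q v → G.rdist p v ≤ G.rdist q v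

/-- The pruning condition, a statement about all of `A`, becomes a test of two array cells. -/
theorem Nearest.farFrom_iff {G : WGraph n} {A : Set (Fin n)} {piv : ℕ → ℕ} {D : ℕ → ℝ}
    (h : Nearest G A piv D) (v : Fin n) (r : ℝ) :
    (piv (v + 1) = 0 ∨ r < D (v + 1)) ↔ G.FarFrom A v r := by
  rcases h v with ⟨h1, h2⟩ | ⟨p, hp, hpv, h1, h2, h3⟩
  · exact ⟨fun _ q hq hqv => absurd hqv (h2 q hq), fun _ => .inl h1⟩
  · rw [h1, h2]
    refine ⟨fun h q hq hqv => ?_, fun h => .inr (h p hp hpv)⟩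
    exact (h.resolve_left (by omega)).trans_le (h3 q hq hqv)

/-- A vertex reachable from `u` but outside its cluster has a vertex of `A ⊆ B` at least as near as
`u`. So it is enough to update the vertices met in the search from `u`, and no separate search for
nearest vertices is needed. -/
theorem Nearest.add_root {G : WGraph n} {A B : Set (Fin n)} {piv piv' : ℕ → ℕ} {D D' : ℕ → ℝ}
    (h : Nearest G B piv D) (hAB : A ⊆ B) {u : Fin n}
    (hout : ∀ v, v ∉ G.cluster A u → piv' (v + 1) = piv (v + 1) ∧ D' (v + 1) = D (v + 1))
    (hin : ∀ v ∈ G.cluster A u,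
      ((piv (v + 1) = 0 ∨ G.rdist u v < D (v + 1)) ∧ piv' (v + 1) = u + 1 ∧
        D' (v + 1) = G.rdist u v) ∨
      (¬ (piv (v + 1) = 0 ∨ G.rdist u v < D (v + 1)) ∧ piv' (v + 1) = piv (v + 1) ∧
        D' (v + 1) = D (v + 1))) :
    Nearest G (insert u B) piv' D' := by
  have keep : ∀ v : Fin n, piv' (v + 1) = piv (v + 1) → D' (v + 1) = D (v + 1) →
      (G.graph.Reachable u v → ¬ G.FarFrom B v (G.rdist u v)) →
      (piv' (v + 1) = 0 ∧ ∀ p ∈ insert u B, ¬ G.graph.Reachable p v) ∨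
      ∃ p ∈ insert u B, G.graph.Reachable p v ∧ piv' (v + 1) = p + 1 ∧ D' (v + 1) = G.rdist p v ∧
      ∀ q ∈ insert u B, G.graph.Reachable q v → G.rdist p v ≤ G.rdist q v := by
    intro v e1 e2 hf
    rw [e1, e2]
    rcases h v with ⟨h1, h2⟩ | ⟨p, hp, hpv, h1, h2, h3⟩
    · refine .inl ⟨h1, fun p hp hpv => ?_⟩
      rcases hp with rfl | hp
      · exact hf hpv fun q hq hqv => absurd hqv (h2 q hq)
      · exact h2 p hp hpv
    · refine .inr ⟨p, .inr hp, hpv, h1, h2, fun q hq hqv => ?_⟩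
      rcases hq with rfl | hq
      · by_contra hlt
        exact hf hqv fun q' hq' hqv' => (not_le.1 hlt).trans_le (h3 q' hq' hqv')
      · exact h3 q hq hqv
  intro v
  by_cases hv : v ∈ G.cluster A u
  · rcases hin v hv with ⟨h1, h2, h3⟩ | ⟨h1, h2, h3⟩
    · rw [h.farFrom_iff] at h1
      refine .inr ⟨u, .inl rfl, hv.1, h2, h3, fun q hq hqv => ?_⟩
      rcases hq with rfl | hq
      · exact le_rfl
      · exact (h1 q hq hqv).le
    · rw [h.farFrom_iff] at h1
      exact keep v h2 h3 fun _ => h1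
  · exact keep v (hout v hv).1 (hout v hv).2 fun huv hf =>
      hv ⟨huv, fun p hp => hf p (hAB hp)⟩

/-- A linked list: `l` is the list of the cells that are reached from `e`, and `0` is its end. -/
def Chain (next : ℕ → ℕ) : ℕ → List ℕ → Prop
  | e, [] => e = 0
  | e, i :: l => e = i ∧ i ≠ 0 ∧ Chain next (next i) l

/-- The adjacency lists of the graph are stored in the word arrays `2` (first cell of a vertex), `3`
(next cell) and `4` (neighbour), and in the real array `1` (weight). -/
structure AdjLists (G : WGraph n) (adj : Fin n → List ℕ) (s : State) : Prop where
  chain : ∀ v : Fin n, Chain (s.warr 3) (s.warr 2 (v + 1)) (adj v)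
  sound : ∀ v, ∀ i ∈ adj v, ∃ y : Fin n, G.graph.Adj v y ∧ s.warr 4 i = y + 1 ∧
    s.rarr 1 i = G.weight s(v, y)
  complete : ∀ v y : Fin n, G.graph.Adj v y → ∃ i ∈ adj v, s.warr 4 i = y + 1

theorem AdjLists.congr {G : WGraph n} {adj : Fin n → List ℕ} {s s' : State}
    (h : AdjLists G adj s) (h2 : s'.warr 2 = s.warr 2) (h3 : s'.warr 3 = s.warr 3)
    (h4 : s'.warr 4 = s.warr 4) (h1 : s'.rarr 1 = s.rarr 1) : AdjLists G adj s' := by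
  constructor
  · rw [h2, h3]; exact h.chain
  · rw [h4, h1]; exact h.sound
  · rw [h4]; exact h.complete

/-- The vertex `v` is in the queue. -/
def InQueue (l : ℕ) (s : State) (v : Fin n) : Prop := s.warr 7 (2 ^ l + (v + 1)) ≠ 0

/-- The queue and the stamps of the vertices seen so far, in accordance with `WGraph.DInv`. -/
structure Search (G : WGraph n) (l : ℕ) (A : Set (Fin n)) (u : Fin n) (X : Finset (Fin n)) (r : ℝ)
    (Done : Fin n → Fin n → Prop) (s : State) : Prop where
  heap : Heap (2 ^ l) (s.warr 7) (s.rarr 2)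
  leaf : ∀ x < 2 ^ l, s.warr 7 (2 ^ l + x) ≠ 0 → ∃ v : Fin n, x = v + 1
  stamp_le : ∀ v : Fin n, s.warr 8 (v + 1) ≤ s.wreg 13
  stamp : ∀ v : Fin n, s.warr 8 (v + 1) = s.wreg 13 ↔ v ∈ X ∨ InQueue l s v
  dinv : G.DInv A u X (InQueue l s) (fun v => s.rarr 2 (v + 1)) r Done

/-- Between two searches the queue is empty. -/
structure Idle (n l : ℕ) (s : State) : Prop where
  heap : Heap (2 ^ l) (s.warr 7) (s.rarr 2)
  empty : ∀ x < 2 ^ l, s.warr 7 (2 ^ l + x) = 0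
  stamp_le : ∀ v : Fin n, s.warr 8 (v + 1) ≤ s.wreg 13

theorem Idle.congr {l : ℕ} {s s' : State} (h : Idle n l s) (h7 : s'.warr 7 = s.warr 7)
    (h2 : s'.rarr 2 = s.rarr 2) (h8 : s'.warr 8 = s.warr 8) (h13 : s'.wreg 13 = s.wreg 13) :
    Idle n l s' := by
  constructor
  · rw [h7, h2]; exact h.heap
  · rw [h7]; exact h.empty
  · rw [h8, h13]; exact h.stamp_le

section

variable {G : WGraph n} {l W : ℕ} {ω : ℕ → Bool} {A : Set (Fin n)} {u : Fin n}
  {X : Finset (Fin n)} {r : ℝ} {Done Done' : Fin n → Fin n → Prop} {s s' : State}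

theorem Search.congr (h : Search G l A u X r Done s) (h7 : s'.warr 7 = s.warr 7)
    (h2 : s'.rarr 2 = s.rarr 2) (h8 : s'.warr 8 = s.warr 8) (h13 : s'.wreg 13 = s.wreg 13)
    (hDone : ∀ a b, Done' a b → Done a b) : Search G l A u X r Done' s' := by
  constructor
  · rw [h7, h2]; exact h.heap
  · rw [h7]; exact h.leaf
  · rw [h8, h13]; exact h.stamp_le
  · simp only [InQueue, h7, h8, h13]; exact h.stamp
  · exact h.dinv.congr (fun v => by simp only [InQueue, h7]) (fun v => by rw [h2]) hDone

theorem inQueue_update {x : Fin n} {val : ℕ}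
    (h : ∀ k, 2 ^ l ≤ k → s'.warr 7 k = Function.update (s.warr 7) (2 ^ l + (x + 1)) val k)
    (v : Fin n) : InQueue l s' v ↔ if v = x then val ≠ 0 else InQueue l s v := by
  rw [InQueue, h _ (by omega)]
  split_ifs with hv
  · subst hv; simp
  · rw [Function.update_of_ne, InQueue]
    intro heq
    exact hv (Fin.ext (by omega))

/-- A stamp below the number of the current search marks a vertex not seen yet, whose stale key is
ignored. The arrays therefore need no clearing between searches, which would cost `n` steps each
time. -/
theorem relaxProg_search (hW : 2 * 2 ^ l + 2 ≤ W) (hn : n < 2 ^ l) (hM : s.wreg 3 = 2 ^ l)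
    (hnear : Nearest G A (s.warr 9) (s.rarr 3)) (h : Search G l A u X r Done s) {v y : Fin n}
    (hv : v ∈ X) (hr : s.rarr 2 (v + 1) = r) (hvy : G.graph.Adj v y) (hy : s.wreg 14 = y + 1)
    (hnd : s.rreg 4 = r + G.weight s(v, y)) :
    Runs W ω relaxProg s fun t s' => t ≤ 90 * (l + 1) ∧
      (Search G l A u X r (fun a b => Done a b ∨ a = v ∧ b = y) s' ∧
        ∀ a ∈ X, s'.rarr 2 (a + 1) = s.rarr 2 (a + 1)) := by
  have hyl : (y : ℕ) + 1 < 2 ^ l := by omega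
  refine (relaxProg_spec hW hyl hy hM h.heap).mono ?_
  rintro t s' hag ⟨ht, ⟨⟨hC1, hC2⟩, h8, h2, hh, h7⟩ | ⟨hC, h8, h2, h7⟩⟩
  · refine ⟨ht, ?_⟩
    have h13 : s'.wreg 13 = s.wreg 13 := hag.wreg 13 (by decide)
    have hfar := (hnear.farFrom_iff y _).1 hC1
    rw [hnd] at hfar hC2
    have hiq : ∀ a, InQueue l s' a ↔ InQueue l s a ∨ a = y := fun a => by
      rw [inQueue_update h7]
      by_cases hay : a = y <;> simp [hay]
    have hkey : ∀ a : Fin n, a ≠ y → s'.rarr 2 (a + 1) = s.rarr 2 (a + 1) := fun a ha => by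
      rw [h2, Function.update_of_ne]
      intro heq
      exact ha (Fin.ext (by omega))
    obtain ⟨hyX, hd⟩ := h.dinv.relax_take hv hr hvy hfar
      (hC2.imp_left fun hlt hmem => by rw [(h.stamp y).2 hmem] at hlt; omega)
      hiq hkey (by simp [h2, hnd])
    refine ⟨⟨hh, fun x hx hne => ?_, fun a => ?_, fun a => ?_, hd⟩,
      fun a ha => hkey a fun hay => hyX (hay ▸ ha)⟩
    · by_cases hxy : x = y + 1
      · exact ⟨y, hxy⟩
      · rw [h7 _ (by omega), Function.update_of_ne (by omega)] at hne
        exact h.leaf x hx hne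
    · rw [h8, h13]
      by_cases hay : a = y
      · subst hay; simp
      · rw [Function.update_of_ne (fun heq => hay (Fin.ext (by omega)))]
        exact h.stamp_le a
    · rw [h8, h13, hiq, ← or_assoc, ← h.stamp]
      by_cases hay : a = y
      · subst hay; simp
      · rw [Function.update_of_ne (fun heq => hay (Fin.ext (by omega)))]
        simp [hay]
  · have h13 : s'.wreg 13 = s.wreg 13 := hag.wreg 13 (by decide)
    refine ⟨ht, ?_, fun a _ => by rw [h2]⟩
    rw [hnear.farFrom_iff, hnd] at hC
    refine ⟨by rw [h7, h2]; exact h.heap, by rw [h7]; exact h.leaf, by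
      rw [h8, h13]; exact h.stamp_le, by simp only [InQueue, h7, h8, h13]; exact h.stamp, ?_⟩
    refine (h.dinv.relax_skip hv hr fun hf => ?_).congr (fun a => by simp only [InQueue, h7])
      (fun a => by rw [h2]) fun _ _ h => h
    rw [not_and_or, not_or] at hC
    have hC' := hC.resolve_left (not_not.2 hf)
    exact ⟨(h.stamp y).1 (le_antisymm (h.stamp_le y) (not_lt.1 hC'.1)), not_lt.1 hC'.2⟩

/-- Relax all edges at the vertex in register `10`, whose distance is in the real register `3`. -/
def scanProg : Prog :=
  .seq (.wset 12 (.get 2 (.reg 10))) <|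
  .loop (.wle (.lit 1) (.reg 12)) <|
    .seq (.wset 14 (.get 4 (.reg 12))) <|
    .seq (.rset 4 (.add (.reg 3) (.get 1 (.reg 12)))) <|
    .seq relaxProg (.wset 12 (.get 3 (.reg 12)))

theorem scanProg_spec (hW : 2 * 2 ^ l + 2 ≤ W) (hn : n < 2 ^ l) (hM : s.wreg 3 = 2 ^ l)
    {adj : Fin n → List ℕ} (hadj : AdjLists G adj s)
    (hnear : Nearest G A (s.warr 9) (s.rarr 3)) {v : Fin n} (hv : v ∈ X)
    (h : Search G l A u X r (fun a _ => a ∈ X ∧ a ≠ v) s)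
    (hr : s.rarr 2 (v + 1) = r) (hreg : s.wreg 10 = v + 1) (hd : s.rreg 3 = r) :
    Runs W ω scanProg s fun t s' => t ≤ 110 * (l + 1) * (adj v).length + 10 ∧
      Search G l A u X r (fun a _ => a ∈ X) s' ∧
        ∀ a ∈ X, s'.rarr 2 (a + 1) = s.rarr 2 (a + 1) := by
  have h1 : 1 % W = 1 := Nat.mod_eq_of_lt (by have := Nat.two_pow_pos l; omega)
  simp only [scanProg, runs_seq, runs_wset]
  -- The ghost parameter splits the adjacency list of `v` into the scanned and the remaining cells.
  -- Edges at other settled vertices count as relaxed throughout.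
  refine (Runs.loop (α := List ℕ × List ℕ) (fun p s' => adj v = p.1 ++ p.2 ∧
      Chain (s.warr 3) (s'.wreg 12) p.2 ∧
      Search G l A u X r (fun a b => a ∈ X ∧ (a = v → ∃ i ∈ p.1, s.warr 4 i = b + 1)) s' ∧
      ∀ a ∈ X, s'.rarr 2 (a + 1) = s.rarr 2 (a + 1))
    (fun p => 110 * (l + 1) * p.2.length) ([], adj v) ?_ ?_).mono ?_
  · refine ⟨rfl, by simpa [hreg] using hadj.chain v, h.congr (by simp) (by simp) (by simp)
      (by simp) ?_, by simp⟩
    rintro a b ⟨ha, hav⟩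
    exact ⟨ha, fun hav' => by simpa using hav hav'⟩
  · rintro ⟨pre, rem⟩ s' hag ⟨happ, hch, hS, hk⟩ hb
    simp only [Test.Holds, WExp.eval, h1] at hb
    cases rem with
    | nil => simp [Chain] at hch; omega
    | cons i rem =>
      obtain ⟨e1, e2, hch⟩ := hch
      simp only at happ
      obtain ⟨y, hvy, hto, hwt⟩ := hadj.sound v i (by rw [happ]; simp)
      have a4 : s'.warr 4 = s.warr 4 := hag.warr 4 (by decide)
      have a1 : s'.rarr 1 = s.rarr 1 := hag.rarr 1 (by decide)
      have a3 : s'.warr 3 = s.warr 3 := hag.warr 3 (by decide)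
      have r3 : s'.rreg 3 = s.rreg 3 := hag.rreg 3 (by decide)
      have w3 : s'.wreg 3 = s.wreg 3 := by simpa using hag.wreg 3 (by decide)
      have a9 : s'.warr 9 = s.warr 9 := hag.warr 9 (by decide)
      have ar3 : s'.rarr 3 = s.rarr 3 := hag.rarr 3 (by decide)
      simp only [runs_seq, runs_wset, runs_rset]
      refine (relaxProg_search (G := G) (A := A) (u := u) (X := X) (r := r) hW hn (v := v) (y := y)
        (Done := fun a b => a ∈ X ∧ (a = v → ∃ i ∈ pre, s.warr 4 i = b + 1))
        (by simp [w3, hM]) (by simp [a9, ar3, hnear])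
        (hS.congr (by simp) (by simp) (by simp) (by simp) fun _ _ h => h) hv
        (by simp [hk v hv, hr]) hvy (by simp [e1, a4, hto]) (by simp [e1, a1, hwt, r3, hd])).mono ?_
      rintro t s₂ hag₂ ⟨ht, hS₂, hk₂⟩
      refine ⟨(pre ++ [i], rem), ⟨by simp [happ], ?_, hS₂.congr (by simp) (by simp) (by simp)
        (by simp) ?_, ?_⟩, ?_⟩
      · have b3 : s₂.warr 3 = s.warr 3 := by simpa [a3] using hag₂.warr 3 (by decide)
        have b12 : s₂.wreg 12 = i := by simpa [e1] using hag₂.wreg 12 (by decide)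
        simpa [b3, b12] using hch
      · rintro a b ⟨ha, hab⟩
        by_cases hav : a = v
        · obtain ⟨j, hj, hjb⟩ := hab hav
          rcases List.mem_append.1 hj with hj | hj
          · exact .inl ⟨ha, fun _ => ⟨j, hj, hjb⟩⟩
          · rw [List.mem_singleton.1 hj, hto] at hjb
            exact .inr ⟨hav, Fin.ext (by omega)⟩
        · exact .inl ⟨ha, fun h => absurd h hav⟩
      · intro a ha
        simpa [hk a ha] using hk₂ a ha
      · simp only [Test.cost, WExp.cost, RExp.cost, List.length_cons, Nat.mul_add]
        omega
  · rintro t s' hag ⟨⟨pre, rem⟩, -, ⟨happ, hch, hS, hk⟩, hb, ht⟩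
    simp only [Test.Holds, WExp.eval, h1] at hb
    cases rem with
    | cons i rem => obtain ⟨e1, e2, hch⟩ := hch; omega
    | nil =>
      simp at ht happ ⊢
      refine ⟨by omega, ?_, hk⟩
      obtain ⟨c1, c2, c3, c4, c5⟩ := hS
      refine ⟨c1, c2, c3, c4, c5.disj, c5.walk, c5.far, fun _ _ h => h, fun a b ha hab => ?_,
        c5.le_of_mem, c5.le_of_queue, c5.root⟩
      refine c5.relaxed a b ⟨ha, fun hav => ?_⟩ hab
      subst hav
      rw [← happ]
      exact hadj.complete a b hab

end

end Hopset

namespace Hopset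

variable {n : ℕ}

/-! ### A search from one vertex -/

/-- The list of edges that has been output so far. -/
def OutList (s : State) (out : List (Fin n × Fin n × ℝ)) : Prop :=
  s.wreg 9 = out.length ∧ ∀ (i : ℕ) (hi : i < out.length),
    s.warr 0 i = (out[i].1 : ℕ) ∧ s.warr 1 i = (out[i].2.1 : ℕ) ∧ s.rarr 0 i = out[i].2.2

theorem OutList.congr {s s' : State} {out : List (Fin n × Fin n × ℝ)} (h : OutList s out)
    (h9 : s'.wreg 9 = s.wreg 9) (h0 : s'.warr 0 = s.warr 0) (h1 : s'.warr 1 = s.warr 1)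
    (hr : s'.rarr 0 = s.rarr 0) : OutList s' out := by
  rw [OutList, h9, h0, h1, hr]
  exact h

/-- Output the edge between the vertices in the registers `8` and `10`, with the weight in the real
register `3`. -/
def emitProg : Prog :=
  .seq (.wput 0 (.reg 9) (.sub (.reg 8) (.lit 1))) <|
  .seq (.wput 1 (.reg 9) (.sub (.reg 10) (.lit 1))) <|
  .seq (.rput 0 (.reg 9) (.reg 3)) (.wset 9 (.add (.reg 9) (.lit 1)))

theorem emitProg_spec {W : ℕ} {ω : ℕ → Bool} {s : State} {out : List (Fin n × Fin n × ℝ)}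
    {u v : Fin n} (h : OutList s out) (hW : out.length + 1 < W) (hu : s.wreg 8 = u + 1)
    (hv : s.wreg 10 = v + 1) :
    Runs W ω emitProg s fun t s' => t ≤ 17 ∧ OutList s' (out ++ [(u, v, s.rreg 3)]) := by
  have h1 : 1 % W = 1 := Nat.mod_eq_of_lt (by omega)
  have h2 : (out.length + 1) % W = out.length + 1 := Nat.mod_eq_of_lt hW
  obtain ⟨h9, hi⟩ := h
  simp [emitProg, h1, h9, h2, hu, hv, OutList]
  intro i hlt
  by_cases hil : i = out.length
  · subst hil
    simp
  · have hil' : i < out.length := by omega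
    simp only [Function.update_of_ne hil, List.getElem_append_left hil']
    exact hi i hil'

/-- Process the vertex in register `10`, whose distance from the vertex in register `8` is in the
real register `3`. -/
def visitProg : Prog :=
  .seq (.ite (.neg (.conj (.neg (.wle (.get 10 (.reg 10)) (.lit 0)))
        (.rle (.get 4 (.reg 10)) (.reg 3))))
      (.seq (.wput 10 (.reg 10) (.reg 8)) (.rput 4 (.reg 10) (.reg 3))) .skip) <|
  .ite (.conj (.wle (.reg 6) (.get 5 (.reg 10)))
      (.neg (.conj (.wle (.reg 10) (.reg 8)) (.wle (.reg 8) (.reg 10))))) emitProg .skip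

open Classical in
theorem visitProg_spec {W : ℕ} {ω : ℕ → Bool} {s : State} {out : List (Fin n × Fin n × ℝ)}
    {u v : Fin n} (h : OutList s out) (hW : out.length + 1 < W) (hu : s.wreg 8 = u + 1)
    (hv : s.wreg 10 = v + 1) :
    Runs W ω visitProg s fun t s' => t ≤ 60 ∧
      (((s.warr 10 (v + 1) = 0 ∨ s.rreg 3 < s.rarr 4 (v + 1)) ∧
          s'.warr 10 = Function.update (s.warr 10) (v + 1) (u + 1) ∧
          s'.rarr 4 = Function.update (s.rarr 4) (v + 1) (s.rreg 3)) ∨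
        (¬ (s.warr 10 (v + 1) = 0 ∨ s.rreg 3 < s.rarr 4 (v + 1)) ∧
          s'.warr 10 = s.warr 10 ∧ s'.rarr 4 = s.rarr 4)) ∧
      OutList s' (if s.wreg 6 ≤ s.warr 5 (v + 1) ∧ v ≠ u then out ++ [(u, v, s.rreg 3)]
        else out) := by
  have second : ∀ s₁ : State, OutList s₁ out → s₁.wreg 8 = u + 1 → s₁.wreg 10 = v + 1 →
      s₁.wreg 6 = s.wreg 6 → s₁.warr 5 = s.warr 5 → s₁.rreg 3 = s.rreg 3 →
      Runs W ω (.ite (.conj (.wle (.reg 6) (.get 5 (.reg 10)))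
        (.neg (.conj (.wle (.reg 10) (.reg 8)) (.wle (.reg 8) (.reg 10))))) emitProg .skip) s₁
        fun t s' => t ≤ 30 ∧ s'.warr 10 = s₁.warr 10 ∧ s'.rarr 4 = s₁.rarr 4 ∧
        OutList s' (if s.wreg 6 ≤ s.warr 5 (v + 1) ∧ v ≠ u then out ++ [(u, v, s.rreg 3)]
          else out) := by
    intro s₁ ho h8 h10 h6 h5 h3
    rw [runs_ite]
    have hiff : (Test.conj (.wle (.reg 6) (.get 5 (.reg 10)))
        (.neg (.conj (.wle (.reg 10) (.reg 8)) (.wle (.reg 8) (.reg 10))))).Holds W s₁ ↔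
        s.wreg 6 ≤ s.warr 5 (v + 1) ∧ v ≠ u := by
      simp only [Test.Holds, WExp.eval, h6, h5, h8, h10, ne_eq, Fin.ext_iff]
      constructor <;> rintro ⟨a1, a2⟩ <;> exact ⟨a1, by omega⟩
    rw [hiff]
    refine ⟨fun hb => ?_, fun hb => ?_⟩
    · refine (emitProg_spec ho hW h8 h10).mono fun t s' hag ⟨ht, hs'⟩ => ?_
      rw [if_pos hb, ← h3]
      exact ⟨by simp; omega, hag.warr 10 (by decide), hag.rarr 4 (by decide), hs'⟩
    · rw [runs_skip, if_neg hb]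
      exact ⟨by simp, rfl, rfl, ho⟩
  simp only [visitProg, runs_seq]
  rw [runs_ite]
  have hiff : (Test.neg (.conj (.neg (.wle (.get 10 (.reg 10)) (.lit 0)))
        (.rle (.get 4 (.reg 10)) (.reg 3)))).Holds W s ↔
      (s.warr 10 (v + 1) = 0 ∨ s.rreg 3 < s.rarr 4 (v + 1)) := by
    simp [hv, or_iff_not_imp_left]
  rw [hiff]
  refine ⟨fun hb => ?_, fun hb => ?_⟩
  · simp only [runs_seq, runs_wput, runs_rput]
    refine (second _ (h.congr (by simp) (by simp) (by simp) (by simp)) (by simp [hu])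
      (by simp [hv]) (by simp) (by simp) (by simp)).mono fun t s' _ ⟨ht, e1, e2, e3⟩ => ?_
    refine ⟨by simp; omega, .inl ⟨hb, by simp [e1, hv, hu], by simp [e2, hv]⟩, e3⟩
  · rw [runs_skip]
    refine (second s h hu hv rfl rfl rfl).mono fun t s' _ ⟨ht, e1, e2, e3⟩ => ?_
    exact ⟨by simp; omega, .inr ⟨hb, e1, e2⟩, e3⟩

/-- Remove the vertex with the least key from the queue. -/
def popProg : Prog :=
  .seq (.wset 10 (.get 7 (.lit 1))) <|
  .seq (.rset 3 (.get 2 (.reg 10))) <|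
  .seq (.wset 11 (.add (.reg 3) (.reg 10))) <|
  .seq (.wput 7 (.reg 11) (.lit 0)) fixProg

section

variable {G : WGraph n} {l W : ℕ} {ω : ℕ → Bool} {A : Set (Fin n)} {u : Fin n}
  {X : Finset (Fin n)} {r : ℝ} {Done Done' : Fin n → Fin n → Prop} {s s' : State}

theorem popProg_spec (hW : 2 * 2 ^ l + 2 ≤ W) (hn : n < 2 ^ l) (hM : s.wreg 3 = 2 ^ l)
    (h : Search G l A u X r Done s) (hne : s.warr 7 1 ≠ 0) :
    Runs W ω popProg s fun t s' => t ≤ 70 * (l + 1) ∧ ∃ v, v ∉ X ∧ v ∈ G.cluster A u ∧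
      s'.wreg 10 = v + 1 ∧ s'.rreg 3 = s.rarr 2 (v + 1) ∧
      Search G l A u (insert v X) (s.rarr 2 (v + 1)) Done s' := by
  have h1 : 1 % W = 1 := Nat.mod_eq_of_lt (by have := Nat.two_pow_pos l; omega)
  obtain ⟨a1, a2, a3⟩ := h.heap.root_ne_zero hne
  obtain ⟨v, hv⟩ := h.leaf _ a1 (by rwa [a2])
  have hm : (2 ^ l + (v + 1)) % W = 2 ^ l + (v + 1) := Nat.mod_eq_of_lt (by omega)
  rw [hv] at a1 a2 a3
  have hvq : InQueue l s v := by rw [InQueue, a2]; omega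
  simp only [popProg, runs_seq, runs_wset, runs_rset, runs_wput]
  refine (fixProg_spec (l := l) (x := v + 1) hW a1 (by simp [h1, hv, hM, hm]) ?_).mono ?_
  · simp [h1, hv, hM, hm]
    exact h.heap.setLeaf a1 (fun _ _ => rfl) (.inl rfl)
  rintro t s' hag ⟨ht, hh, hl⟩
  have e2 := hag.rarr 2 (by decide)
  have e8 := hag.warr 8 (by decide)
  have e10 := hag.wreg 10 (by decide)
  have e13 := hag.wreg 13 (by decide)
  have e3 := hag.rreg 3 (by decide)
  simp [h1, hv, hM, hm] at e2 e8 e10 e13 e3 hh hl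
  have hiq : ∀ y, InQueue l s' y ↔ InQueue l s y ∧ y ≠ v := fun y => by
    rw [inQueue_update hl]
    by_cases hy : y = v <;> simp [hy]
  refine ⟨by simp; omega, v, fun hX => h.dinv.disj v hX hvq, h.dinv.mem_cluster (.inr hvq), e10,
    e3, by rwa [e2], fun x hx hne' => ?_, by rw [e8, e13]; exact h.stamp_le, fun y => ?_, ?_⟩
  · rw [hl _ (by omega)] at hne'
    by_cases hxv : x = v + 1
    · exact ⟨v, hxv⟩
    · rw [Function.update_of_ne (by omega)] at hne'
      exact h.leaf x hx hne'
  · rw [e8, e13, h.stamp, hiq, Finset.mem_insert]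
    by_cases hy : y = v
    · subst hy; simp [hvq]
    · simp [hy]
  · refine (h.dinv.pop hvq (fun y hy => ?_) hiq).congr (fun _ => Iff.rfl) (fun y => by rw [e2])
      fun _ _ h => h
    exact a3 (y + 1) (by omega) hy

/-- Search the cluster of the vertex in register `8`. -/
def dijkstraProg : Prog :=
  .seq (.wset 13 (.add (.reg 13) (.lit 1))) <|
  .seq (.wset 14 (.reg 8)) <|
  .seq (.rset 4 (.ofWord (.lit 0))) <|
  .seq relaxProg <|
  .loop (.wle (.lit 1) (.get 7 (.lit 1))) (.seq popProg (.seq visitProg scanProg))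

/-- The record of the visits to the vertices in `X`: the changes to the array of nearest vertices,
and the list `new` of the edges that have been output. -/
structure Visits (u : Fin n) (out : List (Fin n × Fin n × ℝ)) (s : State) (X : Finset (Fin n))
    (new : List (Fin n × Fin n × ℝ)) (s' : State) : Prop where
  outside : ∀ v : Fin n, v ∉ X → s'.warr 10 (v + 1) = s.warr 10 (v + 1) ∧
    s'.rarr 4 (v + 1) = s.rarr 4 (v + 1)
  inside : ∀ v ∈ X, ((s.warr 10 (v + 1) = 0 ∨ s'.rarr 2 (v + 1) < s.rarr 4 (v + 1)) ∧
      s'.warr 10 (v + 1) = u + 1 ∧ s'.rarr 4 (v + 1) = s'.rarr 2 (v + 1)) ∨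
    (¬ (s.warr 10 (v + 1) = 0 ∨ s'.rarr 2 (v + 1) < s.rarr 4 (v + 1)) ∧
      s'.warr 10 (v + 1) = s.warr 10 (v + 1) ∧ s'.rarr 4 (v + 1) = s.rarr 4 (v + 1))
  outList : OutList s' (out ++ new)
  mem_new : ∀ e, e ∈ new ↔ ∃ v ∈ X, v ≠ u ∧ s.wreg 6 ≤ s.warr 5 (v + 1) ∧
    e = (u, v, s'.rarr 2 (v + 1))
  length_le : new.length ≤ (X.filter fun v => v ≠ u ∧ s.wreg 6 ≤ s.warr 5 (v + 1)).card

theorem Visits.congr {out new : List (Fin n × Fin n × ℝ)} {s s₁ s₂ : State}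
    (h : Visits u out s X new s₁) (h9 : s₂.wreg 9 = s₁.wreg 9) (h0 : s₂.warr 0 = s₁.warr 0)
    (h1 : s₂.warr 1 = s₁.warr 1) (hr0 : s₂.rarr 0 = s₁.rarr 0) (h10 : s₂.warr 10 = s₁.warr 10)
    (h4 : s₂.rarr 4 = s₁.rarr 4) (hk : ∀ v ∈ X, s₂.rarr 2 (v + 1) = s₁.rarr 2 (v + 1)) :
    Visits u out s X new s₂ where
  outside v hv := by rw [h10, h4]; exact h.outside v hv
  inside v hv := by rw [h10, h4, hk v hv]; exact h.inside v hv
  outList := h.outList.congr h9 h0 h1 hr0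
  mem_new e := by
    rw [h.mem_new]
    refine exists_congr fun v => and_congr_right fun hv => ?_
    rw [hk v hv]
  length_le := h.length_le

theorem visitProg_visits {out new : List (Fin n × Fin n × ℝ)} {s s₁ : State} {v : Fin n}
    (h : Visits u out s X new s₁) (hvX : v ∉ X) (hW : out.length + n < W)
    (hu : s₁.wreg 8 = u + 1) (hv : s₁.wreg 10 = v + 1) (h6 : s₁.wreg 6 = s.wreg 6)
    (h5 : s₁.warr 5 = s.warr 5) (hd : s₁.rreg 3 = s₁.rarr 2 (v + 1)) :
    Runs W ω visitProg s₁ fun t s' => t ≤ 60 ∧ ∃ new', Visits u out s (insert v X) new' s' := by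
  -- The entries so far are charged to distinct settled vertices and `v` is not among them, so the
  -- length of the list still fits into a word.
  have hcard : new.length + 1 ≤ n := by
    refine le_trans (Nat.add_le_add_right (h.length_le.trans (Finset.card_filter_le _ _)) 1) ?_
    rw [← Finset.card_insert_of_notMem hvX]
    simpa using (insert v X).card_le_univ
  refine (visitProg_spec h.outList (by rw [List.length_append]; omega) hu hv).mono ?_
  rintro t s' hag ⟨ht, hpiv, hout⟩
  have e2 : s'.rarr 2 = s₁.rarr 2 := hag.rarr 2 (by decide)
  rw [h6, h5] at hout
  have hne : ∀ y : Fin n, y ≠ v → (y : ℕ) + 1 ≠ v + 1 := fun y hy heq => hy (Fin.ext (by omega))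
  have hold : ∀ y : Fin n, y ≠ v → s'.warr 10 (y + 1) = s₁.warr 10 (y + 1) ∧
      s'.rarr 4 (y + 1) = s₁.rarr 4 (y + 1) := by
    intro y hy
    rcases hpiv with ⟨-, e10, e4⟩ | ⟨-, e10, e4⟩ <;> rw [e10, e4]
    · rw [Function.update_of_ne (hne y hy), Function.update_of_ne (hne y hy)]
      exact ⟨rfl, rfl⟩
    · exact ⟨rfl, rfl⟩
  have hnew : ∃ new', out ++ new' = (if s.wreg 6 ≤ s.warr 5 (v + 1) ∧ v ≠ u then
      (out ++ new) ++ [(u, v, s₁.rreg 3)] else out ++ new) ∧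
      new' = if s.wreg 6 ≤ s.warr 5 (v + 1) ∧ v ≠ u then new ++ [(u, v, s₁.rreg 3)] else new := by
    refine ⟨_, ?_, rfl⟩
    split_ifs <;> simp
  obtain ⟨new', hn1, hn2⟩ := hnew
  refine ⟨ht, new', fun y hy => ?_, fun y hy => ?_, by rwa [hn1], fun e => ?_, ?_⟩
  · rw [Finset.mem_insert, not_or] at hy
    rw [(hold y hy.1).1, (hold y hy.1).2]
    exact h.outside y hy.2
  · by_cases hyv : y = v
    · subst hyv
      obtain ⟨o1, o2⟩ := h.outside y hvX
      rw [o1, o2, hd] at hpiv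
      rw [e2]
      rcases hpiv with ⟨c, e10, e4⟩ | ⟨c, e10, e4⟩
      · exact .inl ⟨c, by simp [e10], by simp [e4]⟩
      · exact .inr ⟨c, by rw [e10, o1], by rw [e4, o2]⟩
    · rw [(hold y hyv).1, (hold y hyv).2, e2]
      exact h.inside y ((Finset.mem_insert.1 hy).resolve_left hyv)
  · rw [hn2, e2]
    split_ifs with hc
    · rw [List.mem_append, h.mem_new, List.mem_singleton]
      constructor
      · rintro (⟨y, hy, h1, h2, rfl⟩ | rfl)
        · exact ⟨y, Finset.mem_insert_of_mem hy, h1, h2, rfl⟩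
        · exact ⟨v, Finset.mem_insert_self _ _, hc.2, hc.1, by rw [hd]⟩
      · rintro ⟨y, hy, h1, h2, rfl⟩
        rcases Finset.mem_insert.1 hy with rfl | hy
        · exact .inr (by rw [hd])
        · exact .inl ⟨y, hy, h1, h2, rfl⟩
    · rw [h.mem_new]
      constructor
      · rintro ⟨y, hy, h1, h2, rfl⟩
        exact ⟨y, Finset.mem_insert_of_mem hy, h1, h2, rfl⟩
      · rintro ⟨y, hy, h1, h2, rfl⟩
        rcases Finset.mem_insert.1 hy with rfl | hy
        · exact absurd ⟨h2, h1⟩ hc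
        · exact ⟨y, hy, h1, h2, rfl⟩
  · rw [hn2, Finset.filter_insert]
    have := h.length_le
    by_cases hc : s.wreg 6 ≤ s.warr 5 (v + 1) ∧ v ≠ u
    · rw [if_pos hc, if_pos ⟨hc.2, hc.1⟩, Finset.card_insert_of_notMem (by simp [hvX])]
      simpa using this
    · rwa [if_neg hc, if_neg fun hc' => hc ⟨hc'.2, hc'.1⟩]

open Classical in
-- Only members of the cluster ever enter the queue, and each is removed once. The potential is the
-- sum of degree plus one over the members not yet settled, times `O(l)` for the updates of the
-- queue.
theorem dijkstraProg_spec (hW : 2 * 2 ^ l + 2 ≤ W) (hn : n < 2 ^ l) (hM : s.wreg 3 = 2 ^ l)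
    {adj : Fin n → List ℕ} (hadj : AdjLists G adj s) {B : Set (Fin n)} (hAB : A ⊆ B)
    (hA : Nearest G A (s.warr 9) (s.rarr 3)) (hB : Nearest G B (s.warr 10) (s.rarr 4))
    (hidle : Idle n l s) (hu : s.wreg 8 = u + 1) (hcur : s.wreg 13 + 1 < W)
    {out : List (Fin n × Fin n × ℝ)} (hout : OutList s out) (hlen : out.length + n < W) :
    Runs W ω dijkstraProg s fun t s' =>
      t ≤ 300 * (l + 1) * (∑ v with v ∈ G.cluster A u, ((adj v).length + 1)) + 200 * (l + 1) ∧
      Nearest G (insert u B) (s'.warr 10) (s'.rarr 4) ∧ Idle n l s' ∧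
      s'.wreg 13 = s.wreg 13 + 1 ∧ ∃ new, OutList s' (out ++ new) ∧
        (∀ e, e ∈ new ↔ ∃ v ∈ G.cluster A u, v ≠ u ∧ s.wreg 6 ≤ s.warr 5 (v + 1) ∧
          e = (u, v, G.rdist u v)) ∧
        new.length ≤ ((Finset.univ.filter (· ∈ G.cluster A u)).filter
          fun v => v ≠ u ∧ s.wreg 6 ≤ s.warr 5 (v + 1)).card := by
  have hl := Nat.two_pow_pos l
  have h1 : 1 % W = 1 := Nat.mod_eq_of_lt (by omega)
  have hc1 : (s.wreg 13 + 1) % W = s.wreg 13 + 1 := Nat.mod_eq_of_lt hcur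
  have hul : (u : ℕ) + 1 < 2 ^ l := by omega
  simp only [dijkstraProg, runs_seq, runs_wset, runs_rset]
  refine (relaxProg_spec (l := l) (x := u + 1) hW hul (by simp [hu]) (by simp [hM])
    (by simpa using hidle.heap)).mono ?_
  rintro t₀ s₀ hag₀ ⟨ht₀, hrel⟩
  have a13 := hag₀.wreg 13 (by decide)
  simp [h1, hc1, Nat.lt_succ_of_le (hidle.stamp_le u)] at a13 hrel
  have hS₀ : Search G l A u ∅ 0 (fun a _ => a ∈ (∅ : Finset (Fin n))) s₀ := by
    have hff := hA.farFrom_iff u 0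
    have hiq₀ : ∀ v : Fin n, ¬ InQueue l s v := fun v hv => hv (hidle.empty _ (by omega))
    rcases hrel with ⟨hC, h8, h2, hh, h7⟩ | ⟨hC, h8, h2, h7⟩
    · have hiq : ∀ v, InQueue l s₀ v ↔ v = u := fun v => by
        rw [inQueue_update h7]
        by_cases hv : v = u <;> simp [hv, hiq₀]
      refine ⟨hh, fun x hx hne => ?_, fun v => ?_, fun v => ?_, ?_⟩
      · by_cases hxu : x = u + 1
        · exact ⟨u, hxu⟩
        · rw [h7 _ (by omega), Function.update_of_ne (by omega)] at hne
          exact absurd (hidle.empty x hx) hne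
      · rw [h8, a13, Function.update_apply]
        split_ifs
        · exact le_rfl
        · exact (hidle.stamp_le v).trans (Nat.le_succ _)
      · rw [h8, a13, hiq]
        by_cases hv : v = u
        · simp [hv]
        · rw [Function.update_of_ne (fun heq => hv (Fin.ext (by omega)))]
          have := hidle.stamp_le v
          simp [hv]
          omega
      · refine (WGraph.DInv.init (Q := InQueue l s₀) (fun v => ?_) (fun _ => by simp [h2])).congr
          (fun _ => Iff.rfl) (fun _ => rfl) (by simp)
        rw [hiq, ← hff]
        exact (and_iff_left hC).symm
    · have hiq : ∀ v : Fin n, ¬ InQueue l s₀ v := fun v hv => hiq₀ v (by rwa [InQueue, h7] at hv)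
      refine ⟨by rw [h7, h2]; exact hidle.heap, fun x hx hne => ?_, fun v => ?_, fun v => ?_, ?_⟩
      · rw [h7] at hne
        exact absurd (hidle.empty x hx) hne
      · rw [h8, a13]
        exact (hidle.stamp_le v).trans (Nat.le_succ _)
      · rw [h8, a13]
        have := hidle.stamp_le v
        simp [hiq]
        omega
      · have hC' : ¬ G.FarFrom A u 0 := by
          rw [← hff, not_or, not_lt]
          exact hC
        exact (WGraph.DInv.init (Q := InQueue l s₀) (fun v => by simp [hiq, hC'])
          (fun h => absurd h hC')).congr (fun _ => Iff.rfl) (fun _ => rfl) (by simp)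
  have hV₀ : Visits u out s ∅ [] s₀ := by
    have e10 := hag₀.warr 10 (by decide)
    have e4 := hag₀.rarr 4 (by decide)
    simp at e10 e4
    refine ⟨fun v _ => by rw [e10, e4]; exact ⟨rfl, rfl⟩, by simp, ?_, by simp, by simp⟩
    rw [List.append_nil]
    refine hout.congr ?_ ?_ ?_ ?_
    · simpa using hag₀.wreg 9 (by decide)
    · simpa using hag₀.warr 0 (by decide)
    · simpa using hag₀.warr 1 (by decide)
    · simpa using hag₀.rarr 0 (by decide)
  have b3 : s₀.wreg 3 = 2 ^ l := by simpa [hM] using hag₀.wreg 3 (by decide)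
  have b8 : s₀.wreg 8 = u + 1 := by simpa [hu] using hag₀.wreg 8 (by decide)
  have b6 : s₀.wreg 6 = s.wreg 6 := by simpa using hag₀.wreg 6 (by decide)
  have b5 : s₀.warr 5 = s.warr 5 := by simpa using hag₀.warr 5 (by decide)
  have b9 : s₀.warr 9 = s.warr 9 := by simpa using hag₀.warr 9 (by decide)
  have br3 : s₀.rarr 3 = s.rarr 3 := by simpa using hag₀.rarr 3 (by decide)
  have badj : AdjLists G adj s₀ := hadj.congr (by simpa using hag₀.warr 2 (by decide))
    (by simpa using hag₀.warr 3 (by decide)) (by simpa using hag₀.warr 4 (by decide))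
    (by simpa using hag₀.rarr 1 (by decide))
  refine (Runs.loop (α := Finset (Fin n)) (fun X s' => (∃ r, Search G l A u X r
      (fun a _ => a ∈ X) s') ∧ ∃ new, Visits u out s X new s')
    (fun X => ∑ v with v ∈ G.cluster A u ∧ v ∉ X, 300 * (l + 1) * ((adj v).length + 1))
    ∅ ⟨⟨0, hS₀⟩, [], hV₀⟩ ?_).mono ?_
  · rintro X s₁ hag₁ ⟨⟨r, hS⟩, new, hV⟩ hb
    simp only [Test.Holds, WExp.eval, h1] at hb
    have c3 : s₁.wreg 3 = 2 ^ l := (hag₁.wreg 3 (by decide)).trans b3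
    have c8 : s₁.wreg 8 = u + 1 := (hag₁.wreg 8 (by decide)).trans b8
    have c6 : s₁.wreg 6 = s.wreg 6 := (hag₁.wreg 6 (by decide)).trans b6
    have c5 : s₁.warr 5 = s.warr 5 := (hag₁.warr 5 (by decide)).trans b5
    have c9 : s₁.warr 9 = s.warr 9 := (hag₁.warr 9 (by decide)).trans b9
    have cr3 : s₁.rarr 3 = s.rarr 3 := (hag₁.rarr 3 (by decide)).trans br3
    have cadj : AdjLists G adj s₁ := badj.congr (hag₁.warr 2 (by decide))
      (hag₁.warr 3 (by decide)) (hag₁.warr 4 (by decide)) (hag₁.rarr 1 (by decide))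
    simp only [runs_seq]
    refine (popProg_spec hW hn c3 hS (by omega)).mono ?_
    rintro t₂ s₂ hag₂ ⟨ht₂, v, hvX, hvC, hr10, hr3, hS₂⟩
    have e2 : s₂.rarr 2 = s₁.rarr 2 := hag₂.rarr 2 (by decide)
    have d8 : s₂.wreg 8 = u + 1 := (hag₂.wreg 8 (by decide)).trans c8
    refine (visitProg_visits (hV.congr (hag₂.wreg 9 (by decide)) (hag₂.warr 0 (by decide))
      (hag₂.warr 1 (by decide)) (hag₂.rarr 0 (by decide)) (hag₂.warr 10 (by decide))
      (hag₂.rarr 4 (by decide)) (fun y _ => by rw [e2])) hvX hlen d8 hr10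
      ((hag₂.wreg 6 (by decide)).trans c6) ((hag₂.warr 5 (by decide)).trans c5)
      (by rw [hr3, e2])).mono ?_
    rintro t₃ s₃ hag₃ ⟨ht₃, new', hV₃⟩
    have e2' : s₃.rarr 2 = s₂.rarr 2 := hag₃.rarr 2 (by decide)
    -- Just before the scan, the edges at `v` are the only ones at settled vertices that need not
    -- have been relaxed.
    have hS₃ := hS₂.congr (hag₃.warr 7 (by decide)) e2' (hag₃.warr 8 (by decide))
      (hag₃.wreg 13 (by decide)) (Done' := fun a _ => a ∈ insert v X ∧ a ≠ v)
      fun a _ ha => (Finset.mem_insert.1 ha.1).resolve_left ha.2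
    have cadj₃ : AdjLists G adj s₃ := (cadj.congr (hag₂.warr 2 (by decide))
      (hag₂.warr 3 (by decide)) (hag₂.warr 4 (by decide)) (hag₂.rarr 1 (by decide))).congr
      (hag₃.warr 2 (by decide)) (hag₃.warr 3 (by decide)) (hag₃.warr 4 (by decide))
      (hag₃.rarr 1 (by decide))
    have d9 : s₃.warr 9 = s.warr 9 :=
      ((hag₃.warr 9 (by decide)).trans (hag₂.warr 9 (by decide))).trans c9
    have dr3 : s₃.rarr 3 = s.rarr 3 :=
      ((hag₃.rarr 3 (by decide)).trans (hag₂.rarr 3 (by decide))).trans cr3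
    refine (scanProg_spec hW hn
      (((hag₃.wreg 3 (by decide)).trans (hag₂.wreg 3 (by decide))).trans c3) cadj₃
      (by rw [d9, dr3]; exact hA) (Finset.mem_insert_self v X) hS₃ (by rw [e2', e2])
      ((hag₃.wreg 10 (by decide)).trans hr10) ((hag₃.rreg 3 (by decide)).trans hr3)).mono ?_
    rintro t₄ s₄ hag₄ ⟨ht₄, hS₄, hk₄⟩
    refine ⟨insert v X, ⟨⟨_, hS₄⟩, new', hV₃.congr (hag₄.wreg 9 (by decide))
      (hag₄.warr 0 (by decide)) (hag₄.warr 1 (by decide)) (hag₄.rarr 0 (by decide))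
      (hag₄.warr 10 (by decide)) (hag₄.rarr 4 (by decide)) hk₄⟩, ?_⟩
    have hins : (Finset.univ.filter fun y => y ∈ G.cluster A u ∧ y ∉ X) =
        insert v (Finset.univ.filter fun y => y ∈ G.cluster A u ∧ y ∉ insert v X) := by
      ext y
      simp only [Finset.mem_filter, Finset.mem_univ, true_and, Finset.mem_insert, not_or]
      by_cases hy : y = v
      · subst hy; simp [hvC, hvX]
      · simp [hy]
    rw [hins, Finset.sum_insert (by simp)]
    simp only [Test.cost, WExp.cost]
    ring_nf at ht₂ ht₄ ⊢
    omega
  · rintro t s₁ hag₁ ⟨X, -, ⟨⟨r, hS⟩, new, hV⟩, hb, ht⟩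
    simp only [Test.Holds, WExp.eval, h1] at hb
    have hempty := hS.heap.root_eq_zero (by omega)
    obtain ⟨f1, f2⟩ := hS.dinv.final (fun v hv => hv (hempty _ (by omega))) fun a ha _ _ => ha
    refine ⟨?_, hB.add_root hAB (fun v hv => hV.outside v (mt (f1 v).1 hv)) (fun v hv => ?_),
      ⟨hS.heap, hempty, hS.stamp_le⟩, (hag₁.wreg 13 (by decide)).trans a13, new, hV.outList,
      fun e => ?_, ?_⟩
    · simp only [Finset.notMem_empty, not_false_eq_true, and_true, ← Finset.mul_sum] at ht
      simp at ht ⊢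
      omega
    · have := hV.inside v ((f1 v).2 hv)
      rwa [f2 v ((f1 v).2 hv)] at this
    · rw [hV.mem_new]
      constructor
      · rintro ⟨v, hv, g1, g2, g3⟩
        exact ⟨v, (f1 v).1 hv, g1, g2, by rw [g3, ← f2 v hv]⟩
      · rintro ⟨v, hv, g1, g2, g3⟩
        exact ⟨v, (f1 v).2 hv, g1, g2, by rw [g3, ← f2 v ((f1 v).2 hv)]⟩
    · convert hV.length_le using 3
      ext v
      simp [f1 v]

end

end Hopset

/-! ### The machine computation of the hierarchy, level by level. -/

namespace Hopset

variable {n : ℕ}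

/-! ### Loops over all vertices -/

/-- Run `body` with `1, …, n` in register `8`, where `n` is in register `0`. -/
def forProg (body : Prog) : Prog :=
  .seq (.wset 8 (.lit 1)) <| .loop (.wle (.reg 8) (.reg 0)) <|
    .seq body (.wset 8 (.add (.reg 8) (.lit 1)))

/-- The counter lives in register `8`, so the invariant has to be insensitive to that register
(`hstable`); the `10` extra steps per round pay for the test and the increment. -/
theorem forProg_spec {W : ℕ} {ω : ℕ → Bool} {body : Prog} {s : State} (h8 : 8 ∉ body.wregs)
    (h0 : 0 ∉ body.wregs) (hn : s.wreg 0 = n) (hW : n + 2 ≤ W) (Inv : ℕ → State → Prop)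
    (c : ℕ → ℕ) (hstable : ∀ k s' i, Inv k s' → Inv k (s'.setWord 8 i)) (hinit : Inv 0 s)
    (step : ∀ k < n, ∀ s', Agree (forProg body) s s' → Inv k s' → s'.wreg 8 = k + 1 →
      Runs W ω body s' fun t s'' => t ≤ c k ∧ Inv (k + 1) s'') :
    Runs W ω (forProg body) s fun t s' => t ≤ (∑ k ∈ Finset.range n, (c k + 10)) + 10 ∧
      Inv n s' := by
  have h1 : 1 % W = 1 := Nat.mod_eq_of_lt (by omega)
  simp only [forProg, runs_seq, runs_wset]
  refine (Runs.loop (α := ℕ) (fun k s' => k ≤ n ∧ Inv k s' ∧ s'.wreg 8 = k + 1 ∧ s'.wreg 0 = n)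
    (fun k => ∑ j ∈ Finset.Ico k n, (c j + 10)) 0 ?_ ?_).mono ?_
  · exact ⟨Nat.zero_le _, hstable _ _ _ hinit, by simp [h1], by simp [hn]⟩
  · rintro k s' hag ⟨hk, hI, hr8, hr0⟩ hb
    simp only [Test.Holds, WExp.eval, hr8, hr0] at hb
    have hagree : Agree (forProg body) s s' := by
      refine Agree.trans (Exec.wset (W := W) (ω := ω) 8 (.lit 1) s).agree.seq_left
        (Agree.seq_right ?_)
      exact ⟨hag.wreg, hag.rreg, hag.warr, hag.rarr, hag.tossed⟩
    simp only [runs_seq, runs_wset]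
    refine (step k hb s' hagree hI hr8).mono ?_
    rintro t s₂ hag₂ ⟨ht, hI₂⟩
    have e8 : s₂.wreg 8 = k + 1 := (hag₂.wreg 8 h8).trans hr8
    refine ⟨k + 1, ⟨hb, hstable _ _ _ hI₂, ?_, ?_⟩, ?_⟩
    · simp [e8, h1]
      exact Nat.mod_eq_of_lt (by omega)
    · simpa using (hag₂.wreg 0 h0).trans hr0
    · rw [Finset.sum_eq_sum_Ico_succ_bot (by omega : k < n) (fun j => c j + 10)]
      simp
      omega
  · rintro t s' - ⟨k, -, ⟨hk, hI, hr8, hr0⟩, hb, ht⟩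
    simp only [Test.Holds, WExp.eval, hr8, hr0] at hb
    obtain rfl : k = n := by omega
    simp at ht ⊢
    exact ⟨by omega, hI⟩

/-! ### One level of the hierarchy -/

/-- Search from all vertices whose rank (in the word array `5`) is at least the number in register
`6`. -/
def rootsProg : Prog := forProg (.ite (.wle (.reg 6) (.get 5 (.reg 8))) dijkstraProg .skip)

/-- The vertices of rank at least the number in register `6`. -/
def levelSet (n : ℕ) (s : State) : Set (Fin n) := {v | s.wreg 6 ≤ s.warr 5 (v + 1)}

section

variable {G : WGraph n} {l W : ℕ} {ω : ℕ → Bool} {A : Set (Fin n)} {s : State}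

open Classical in
/-- The work of the searches from the vertices of `A'`. -/
noncomputable def searchWork (G : WGraph n) (adj : Fin n → List ℕ) (A A' : Set (Fin n)) : ℕ :=
  ∑ u with u ∈ A', ∑ v with v ∈ G.cluster A u, ((adj v).length + 1)

open Classical in
/-- The number of pairs in `A'` in a common cluster. -/
noncomputable def numPairs (G : WGraph n) (A A' : Set (Fin n)) : ℕ :=
  ∑ u with u ∈ A', ((Finset.univ.filter (· ∈ G.cluster A u)).filter
    fun v => v ≠ u ∧ v ∈ A').card

theorem sum_range_dite_eq (f : Fin n → ℕ) :
    ∑ k ∈ Finset.range n, (if h : k < n then f ⟨k, h⟩ else 0) = ∑ v, f v := by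
  rw [← Fin.sum_univ_eq_sum_range (fun k => if h : k < n then f ⟨k, h⟩ else 0)]
  simp

open Classical in
theorem rootsProg_spec (hW : 2 * 2 ^ l + 2 ≤ W) (hn : n < 2 ^ l) (h0 : s.wreg 0 = n)
    (hM : s.wreg 3 = 2 ^ l) {adj : Fin n → List ℕ} (hadj : AdjLists G adj s)
    (hAA' : A ⊆ levelSet n s) (hA : Nearest G A (s.warr 9) (s.rarr 3))
    (hB : Nearest G A (s.warr 10) (s.rarr 4)) (hidle : Idle n l s)
    (hcur : s.wreg 13 + n < W) {out : List (Fin n × Fin n × ℝ)} (hout : OutList s out)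
    (hlen : out.length + n * n < W) :
    Runs W ω rootsProg s fun t s' =>
      t ≤ 300 * (l + 1) * searchWork G adj A (levelSet n s) + 250 * (l + 1) * (n + 1) ∧
      Nearest G (levelSet n s) (s'.warr 10) (s'.rarr 4) ∧ Idle n l s' ∧
      s'.wreg 13 ≤ s.wreg 13 + n ∧ ∃ new, OutList s' (out ++ new) ∧
        (∀ e, e ∈ new ↔ ∃ u ∈ levelSet n s, ∃ v ∈ G.cluster A u, v ≠ u ∧ v ∈ levelSet n s ∧
          e = (u, v, G.rdist u v)) ∧
        new.length ≤ numPairs G A (levelSet n s) := by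
  have hl := Nat.two_pow_pos l
  set A' := levelSet n s with hA'
  let f : Fin n → ℕ := fun u => if u ∈ A' then
    300 * (l + 1) * (∑ v with v ∈ G.cluster A u, ((adj v).length + 1)) else 0
  let g : Fin n → ℕ := fun u => if u ∈ A' then ((Finset.univ.filter (· ∈ G.cluster A u)).filter
    fun v => v ≠ u ∧ v ∈ A').card else 0
  have hg : ∀ u, g u ≤ n := fun u => by
    simp only [g]
    split_ifs
    · refine (Finset.card_le_univ _).trans (by simp)
    · exact Nat.zero_le _
  -- Pruning always uses the fixed arrays for `A`, whereas the second pair of arrays grows from `A`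
  -- by the roots handled so far. It ends with the whole level because `A ⊆ A'`.
  refine (forProg_spec (n := n) (by decide) (by decide) h0 (by omega) (fun k s' =>
    Nearest G (A ∪ {v | v ∈ A' ∧ (v : ℕ) < k}) (s'.warr 10) (s'.rarr 4) ∧ Idle n l s' ∧
    s'.wreg 13 ≤ s.wreg 13 + k ∧ ∃ new, OutList s' (out ++ new) ∧
      (∀ e, e ∈ new ↔ ∃ u ∈ A', (u : ℕ) < k ∧ ∃ v ∈ G.cluster A u, v ≠ u ∧ v ∈ A' ∧
          e = (u, v, G.rdist u v)) ∧
      new.length ≤ ∑ j ∈ Finset.range k, (if h : j < n then g ⟨j, h⟩ else 0))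
    (fun k => (if h : k < n then f ⟨k, h⟩ else 0) + 210 * (l + 1)) ?_ ?_ ?_).mono ?_
  · rintro k s' i ⟨h1, h2, h3, new, h4, h5⟩
    exact ⟨by simpa using h1, h2.congr (by simp) (by simp) (by simp) (by simp), by simpa using h3,
      new, h4.congr (by simp) (by simp) (by simp) (by simp), h5⟩
  · refine ⟨by simpa using hB, hidle, by simp, [], by simpa using hout, by simp, by simp⟩
  · rintro k hk s₁ hag ⟨h1, h2, h3, new, h4, h5, h6⟩ hr8
    have e6 : s₁.wreg 6 = s.wreg 6 := hag.wreg 6 (by decide)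
    have e5 : s₁.warr 5 = s.warr 5 := hag.warr 5 (by decide)
    have hmemA' : ∀ v : Fin n, v ∈ A' ↔ s₁.wreg 6 ≤ s₁.warr 5 (v + 1) := fun v => by
      rw [e6, e5]; exact Iff.rfl
    set u : Fin n := ⟨k, hk⟩ with hu
    rw [runs_ite]
    have hiff : (Test.wle (.reg 6) (.get 5 (.reg 8))).Holds W s₁ ↔ u ∈ A' := by
      rw [hmemA']; simp [hr8, hu]
    rw [hiff]
    have hsum : ∑ j ∈ Finset.range k, (if h : j < n then g ⟨j, h⟩ else 0) ≤ k * n := by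
      refine (Finset.sum_le_card_nsmul _ _ n fun j _ => ?_).trans (by simp)
      split_ifs
      · exact hg _
      · exact Nat.zero_le _
    refine ⟨fun hb => ?_, fun hb => ?_⟩
    · have hkn : k * n + n ≤ n * n := by
        have := Nat.mul_le_mul_right n (Nat.succ_le_of_lt hk)
        rwa [Nat.succ_mul] at this
      refine (dijkstraProg_spec (G := G) (A := A) (u := u) hW hn
        ((hag.wreg 3 (by decide)).trans hM)
        (hadj.congr (hag.warr 2 (by decide)) (hag.warr 3 (by decide)) (hag.warr 4 (by decide))
          (hag.rarr 1 (by decide))) (Set.subset_union_left (t := {v | v ∈ A' ∧ (v : ℕ) < k}))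
        (by rw [hag.warr 9 (by decide), hag.rarr 3 (by decide)]; exact hA) h1 h2 hr8 (by omega)
        h4 (by rw [List.length_append]; omega)).mono ?_
      rintro t s₂ - ⟨ht, hN, hI, h13, new', hO, hmem, hlen'⟩
      refine ⟨?_, ?_, hI, by omega, new ++ new', by rwa [← List.append_assoc], fun e => ?_, ?_⟩
      · rw [dif_pos hk]
        simp only [Test.cost, WExp.cost, f, ← hu, if_pos hb]
        omega
      · convert hN using 1
        ext v
        simp only [Set.mem_union, Set.mem_ofPred_eq, Set.mem_insert_iff, Fin.ext_iff, hu]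
        constructor
        · rintro (h | ⟨h, h'⟩)
          · exact .inr (.inl h)
          · by_cases hvk : (v : ℕ) = k
            · exact .inl hvk
            · exact .inr (.inr ⟨h, by omega⟩)
        · rintro (h | h | ⟨h, h'⟩)
          · obtain rfl : v = u := Fin.ext h
            exact .inr ⟨hb, by omega⟩
          · exact .inl h
          · exact .inr ⟨h, by omega⟩
      · rw [List.mem_append, h5, hmem]
        constructor
        · rintro (⟨u', hu', hlt, hv⟩ | ⟨v, hv, hvu, hv6, he⟩)
          · exact ⟨u', hu', by omega, hv⟩
          · exact ⟨u, hb, Nat.lt_succ_self k, v, hv, hvu, (hmemA' v).2 hv6, he⟩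
        · rintro ⟨u', hu', hlt, v, hv, hvu, hv6, he⟩
          by_cases huk : (u' : ℕ) = k
          · obtain rfl : u' = u := Fin.ext huk
            exact .inr ⟨v, hv, hvu, (hmemA' v).1 hv6, he⟩
          · exact .inl ⟨u', hu', by omega, v, hv, hvu, hv6, he⟩
      · rw [Finset.sum_range_succ, List.length_append]
        refine Nat.add_le_add h6 (hlen'.trans ?_)
        simp only [hk, dite_true, g]
        rw [if_pos hb]
        simp only [hmemA']
        exact le_rfl
    · rw [runs_skip]
      refine ⟨by simp; omega, ?_, h2, by omega, new, h4, fun e => ?_, ?_⟩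
      · convert h1 using 1
        ext v
        simp only [Set.mem_union, Set.mem_ofPred_eq]
        refine or_congr_right (and_congr_right fun hv => ⟨fun h => ?_, fun h => by omega⟩)
        by_contra hvk
        exact hb ((Fin.ext (by simp [hu]; omega) : v = u) ▸ hv)
      · rw [h5]
        refine exists_congr fun u' => and_congr_right fun hu' =>
          and_congr_left fun _ => ⟨fun h => by omega, fun h => ?_⟩
        by_contra hvk
        exact hb ((Fin.ext (by simp [hu]; omega) : u' = u) ▸ hu')
      · rw [Finset.sum_range_succ]
        exact h6.trans (Nat.le_add_right _ _)
  · rintro t s' - ⟨ht, h1, h2, h3, new, h4, h5, h6⟩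
    refine ⟨?_, ?_, h2, h3, new, h4, fun e => ?_, ?_⟩
    · rw [Finset.sum_add_distrib, Finset.sum_add_distrib, sum_range_dite_eq] at ht
      have hf : ∑ u, f u = 300 * (l + 1) * searchWork G adj A A' := by
        simp only [f, searchWork, Finset.mul_sum, ← Finset.sum_filter]
      rw [hf] at ht
      refine ht.trans ?_
      simp only [Finset.sum_const, Finset.card_range, smul_eq_mul]
      nlinarith
    · convert h1 using 1
      ext v
      simp only [Set.mem_union, Set.mem_ofPred_eq, v.2, and_true]
      exact ⟨.inr, fun h => h.elim (fun h => hAA' h) id⟩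
    · rw [h5]
      simp
    · rw [sum_range_dite_eq] at h6
      simpa only [g, ← Finset.sum_filter, numPairs] using h6

/-- Output the edges to the nearest vertices of the next level, and make the nearest vertices of
this level the current ones. -/
def pivotsProg : Prog := forProg <|
  .seq (.wset 10 (.get 9 (.reg 8))) <|
  .seq (.rset 3 (.get 3 (.reg 8))) <|
  .seq (.ite (.conj (.wle (.reg 6) (.get 5 (.reg 8))) (.conj (.wle (.lit 1) (.reg 10))
      (.neg (.conj (.wle (.reg 10) (.reg 8)) (.wle (.reg 8) (.reg 10)))))) emitProg .skip) <|
  .seq (.wput 9 (.reg 8) (.get 10 (.reg 8))) (.rput 3 (.reg 8) (.get 4 (.reg 8)))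

open Classical in
theorem pivotsProg_spec (hW : n + 2 ≤ W) (h0 : s.wreg 0 = n)
    (hA : Nearest G A (s.warr 9) (s.rarr 3))
    {out : List (Fin n × Fin n × ℝ)} (hout : OutList s out) (hlen : out.length + n < W) :
    Runs W ω pivotsProg s fun t s' => t ≤ 100 * (n + 1) ∧
      (∀ v : Fin n, s'.warr 9 (v + 1) = s.warr 10 (v + 1) ∧
        s'.rarr 3 (v + 1) = s.rarr 4 (v + 1)) ∧
      ∃ new, OutList s' (out ++ new) ∧
        (∀ e, e ∈ new ↔ ∃ u ∈ levelSet n s, ∃ p : Fin n, p ≠ u ∧ s.warr 9 (u + 1) = p + 1 ∧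
          e = (u, p, s.rarr 3 (u + 1))) ∧
        new.length ≤ (Finset.univ.filter (· ∈ levelSet n s)).card := by
  set A' := levelSet n s with hA'
  have h1 : 1 % W = 1 := Nat.mod_eq_of_lt (by omega)
  let g : Fin n → ℕ := fun u => if u ∈ A' then 1 else 0
  refine (forProg_spec (n := n) (by decide) (by decide) h0 (by omega) (fun k s' =>
    (∀ v : Fin n, (v : ℕ) < k → s'.warr 9 (v + 1) = s.warr 10 (v + 1) ∧
        s'.rarr 3 (v + 1) = s.rarr 4 (v + 1)) ∧
    (∀ v : Fin n, k ≤ (v : ℕ) → s'.warr 9 (v + 1) = s.warr 9 (v + 1) ∧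
        s'.rarr 3 (v + 1) = s.rarr 3 (v + 1)) ∧
    ∃ new, OutList s' (out ++ new) ∧
      (∀ e, e ∈ new ↔ ∃ u ∈ A', (u : ℕ) < k ∧ ∃ p : Fin n, p ≠ u ∧ s.warr 9 (u + 1) = p + 1 ∧
          e = (u, p, s.rarr 3 (u + 1))) ∧
      new.length ≤ ∑ j ∈ Finset.range k, (if h : j < n then g ⟨j, h⟩ else 0))
    (fun k => 70) ?_ ?_ ?_).mono ?_
  · rintro k s' i ⟨h1, h2, new, h4, h5⟩
    exact ⟨by simpa using h1, by simpa using h2,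
      new, h4.congr (by simp) (by simp) (by simp) (by simp), h5⟩
  · exact ⟨by simp, by simp, [], by simpa using hout, by simp, by simp⟩
  · rintro k hk s₁ hag ⟨h2, h3, new, h4, h5, h6⟩ hr8
    have e6 : s₁.wreg 6 = s.wreg 6 := hag.wreg 6 (by decide)
    have e5 : s₁.warr 5 = s.warr 5 := hag.warr 5 (by decide)
    have e10 : s₁.warr 10 = s.warr 10 := hag.warr 10 (by decide)
    have e4 : s₁.rarr 4 = s.rarr 4 := hag.rarr 4 (by decide)
    set u : Fin n := ⟨k, hk⟩ with hu
    have hne : ∀ v : Fin n, (v : ℕ) ≠ k → (v : ℕ) + 1 ≠ k + 1 := fun v hv => by omega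
    -- The common tail of both branches. The old pivot of vertex `k` has been used by now and may be
    -- overwritten, while later vertices still hold theirs.
    have rest : ∀ (t₀ : ℕ) (s₂ : State) (new' : List (Fin n × Fin n × ℝ)), t₀ ≤ 60 →
        s₂.warr 9 = s₁.warr 9 → s₂.rarr 3 = s₁.rarr 3 → s₂.warr 10 = s.warr 10 →
        s₂.rarr 4 = s.rarr 4 → s₂.wreg 8 = k + 1 → OutList s₂ (out ++ new') →
        (∀ e, e ∈ new' ↔ e ∈ new ∨ (u ∈ A' ∧ ∃ p : Fin n, p ≠ u ∧ s.warr 9 (u + 1) = p + 1 ∧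
          e = (u, p, s.rarr 3 (u + 1)))) → new'.length ≤ new.length + g u →
        Runs W ω (.seq (.wput 9 (.reg 8) (.get 10 (.reg 8))) (.rput 3 (.reg 8) (.get 4 (.reg 8))))
        s₂ fun t s' => t₀ + t ≤ 70 ∧ (∀ v : Fin n, (v : ℕ) < k + 1 →
          s'.warr 9 (v + 1) = s.warr 10 (v + 1) ∧ s'.rarr 3 (v + 1) = s.rarr 4 (v + 1)) ∧
        (∀ v : Fin n, k + 1 ≤ (v : ℕ) → s'.warr 9 (v + 1) = s.warr 9 (v + 1) ∧
          s'.rarr 3 (v + 1) = s.rarr 3 (v + 1)) ∧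
        ∃ new, OutList s' (out ++ new) ∧
        (∀ e, e ∈ new ↔ ∃ u ∈ A', (u : ℕ) < k + 1 ∧ ∃ p : Fin n, p ≠ u ∧
          s.warr 9 (u + 1) = p + 1 ∧ e = (u, p, s.rarr 3 (u + 1))) ∧
        new.length ≤ ∑ j ∈ Finset.range (k + 1), (if h : j < n then g ⟨j, h⟩ else 0) := by
      intro t₀ s₂ new' ht₀ f9 f3 f10 f4 f8 hO hmem hlen'
      simp only [runs_seq, runs_wput, runs_rput]
      refine ⟨by simp; omega, fun v hv => ?_, fun v hv => ?_, new', hO.congr (by simp) (by simp)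
        (by simp) (by simp), fun e => ?_, ?_⟩
      · by_cases hvk : (v : ℕ) = k
        · simp [f8, hvk, f10, f4]
        · simp [f8, Function.update_of_ne (hne v hvk), f9, f3]
          exact h2 v (by omega)
      · have hvk : (v : ℕ) ≠ k := by omega
        simp [f8, Function.update_of_ne (hne v hvk), f9, f3]
        exact h3 v (by omega)
      · rw [hmem, h5]
        constructor
        · rintro (⟨u', hu', hlt, hp⟩ | ⟨hu', hp⟩)
          · exact ⟨u', hu', by omega, hp⟩
          · exact ⟨u, hu', Nat.lt_succ_self k, hp⟩
        · rintro ⟨u', hu', hlt, hp⟩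
          by_cases huk : (u' : ℕ) = k
          · obtain rfl : u' = u := Fin.ext huk
            exact .inr ⟨hu', hp⟩
          · exact .inl ⟨u', hu', by omega, hp⟩
      · rw [Finset.sum_range_succ, dif_pos hk]
        exact hlen'.trans (Nat.add_le_add_right h6 _)
    have k9 := (h3 u le_rfl).1
    have k3 := (h3 u le_rfl).2
    have hval : s₁.warr 9 (k + 1) = s.warr 9 (u + 1) := k9
    have hval3 : s₁.rarr 3 (k + 1) = s.rarr 3 (u + 1) := k3
    rw [runs_seq, runs_wset, runs_seq, runs_rset, runs_seq, runs_ite]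
    have hiff : (Test.conj (.wle (.reg 6) (.get 5 (.reg 8))) (.conj (.wle (.lit 1) (.reg 10))
      (.neg (.conj (.wle (.reg 10) (.reg 8)) (.wle (.reg 8) (.reg 10)))))).Holds W
        ((s₁.setWord 10 (WExp.eval W s₁ (.get 9 (.reg 8)))).setReal 3 (RExp.eval W
          (s₁.setWord 10 (WExp.eval W s₁ (.get 9 (.reg 8)))) (.get 3 (.reg 8)))) ↔
        u ∈ A' ∧ 1 ≤ s.warr 9 (u + 1) ∧ s.warr 9 (u + 1) ≠ u + 1 := by
      simp only [Test.Holds, WExp.eval, State.setReal_wreg, State.setWord_wreg, State.setReal_warr,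
        State.setWord_warr, hr8, hval, e6, e5, h1]
      have huk : (u : ℕ) = k := rfl
      have hA'u : u ∈ A' ↔ s.wreg 6 ≤ s.warr 5 (k + 1) := Iff.rfl
      rw [hA'u]
      norm_num
      exact fun _ _ => by omega
    rw [hiff]
    refine ⟨fun ⟨hb1, hb2, hb3⟩ => ?_, fun hb => ?_⟩
    · have hp : ∃ p : Fin n, s.warr 9 (u + 1) = p + 1 := by
        rcases hA u with ⟨hz, -⟩ | ⟨p, -, -, hp, -⟩
        · omega
        · exact ⟨p, hp⟩
      obtain ⟨p, hp⟩ := hp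
      have hnl : new.length ≤ k := by
        refine h6.trans ((Finset.sum_le_card_nsmul _ _ 1 fun j _ => ?_).trans (by simp))
        split_ifs
        · simp only [g]; split_ifs <;> omega
        · exact Nat.zero_le _
      refine (emitProg_spec (out := out ++ new) (u := u) (v := p)
        (h4.congr (by simp) (by simp) (by simp) (by simp))
        (by rw [List.length_append]; omega) (by simp [hr8, hu]) (by simp [hr8, hval, hp])).mono ?_
      rintro t s₂ hag₂ ⟨ht, hO⟩
      refine (rest (t + 40) s₂ (new ++ [(u, p, s.rarr 3 (u + 1))]) (by omega)
        ((hag₂.warr 9 (by decide)).trans (by simp)) ((hag₂.rarr 3 (by decide)).trans (by simp))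
        ((hag₂.warr 10 (by decide)).trans (by simp [e10]))
        ((hag₂.rarr 4 (by decide)).trans (by simp [e4]))
        ((hag₂.wreg 8 (by decide)).trans (by simp [hr8])) ?_ (fun e => ?_) ?_).mono ?_
      · rw [← List.append_assoc]
        simpa [hr8, hval3] using hO
      · rw [List.mem_append, List.mem_singleton]
        refine or_congr_right ⟨fun he => ⟨hb1, p, fun hpu => ?_, hp, he⟩, ?_⟩
        · rw [hpu] at hp; exact hb3 hp
        · rintro ⟨-, p', -, hp', rfl⟩
          rw [hp] at hp'
          rw [Fin.ext (by omega : (p : ℕ) = p')]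
      · simp [g, hb1]
      · rintro t' s₃ - ⟨ht', hrest⟩
        exact ⟨by simp; omega, hrest⟩
    · rw [runs_skip]
      refine (rest 40 _ new (by omega) (by simp) (by simp) (by simp [e10]) (by simp [e4])
        (by simp [hr8]) (h4.congr (by simp) (by simp) (by simp) (by simp)) (fun e => ?_)
        (Nat.le_add_right _ _)).mono ?_
      · refine ⟨.inl, fun h => h.resolve_right ?_⟩
        rintro ⟨hu', p, hpu, hp, -⟩
        refine hb ⟨hu', by omega, fun heq => hpu (Fin.ext (by omega))⟩
      · rintro t' s₃ - ⟨ht', hrest⟩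
        exact ⟨by simp; omega, hrest⟩
  · rintro t s' - ⟨ht, h2, -, new, h4, h5, h6⟩
    refine ⟨?_, fun v => h2 v v.2, new, h4, fun e => ?_, ?_⟩
    · simp at ht
      omega
    · rw [h5]
      simp
    · rw [sum_range_dite_eq] at h6
      simpa [g] using h6

/-- The list `new` contains suitable hopset edges for the level `A'`, if the next level is `A`. -/
structure LevelOut (G : WGraph n) (A A' : Set (Fin n)) (new : List (Fin n × Fin n × ℝ)) :
    Prop where
  sound : ∀ e ∈ new, G.graph.Reachable e.1 e.2.1 ∧ e.1 ≠ e.2.1 ∧ e.2.2 = G.rdist e.1 e.2.1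
  complete : ∀ x ∈ A', ∀ y ∈ A', G.graph.Reachable x y → x = y ∨ (∃ w, (y, x, w) ∈ new) ∨
    ∃ z ∈ A, (z = x ∨ ∃ w, (x, z, w) ∈ new) ∧ G.rdist x z ≤ G.rdist x y

/-- Either `x` is in the cluster of `y`, and the search from `y` has listed the pair, or the pivot
of `x` is at most as far as `y`. This dichotomy is the reason for the two kinds of edges. -/
theorem LevelOut.of_mem {A' : Set (Fin n)} {piv : ℕ → ℕ} {D : ℕ → ℝ} (hA : Nearest G A piv D)
    {new₁ new₂ : List (Fin n × Fin n × ℝ)}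
    (h₁ : ∀ e, e ∈ new₁ ↔ ∃ u ∈ A', ∃ v ∈ G.cluster A u, v ≠ u ∧ v ∈ A' ∧ e = (u, v, G.rdist u v))
    (h₂ : ∀ e, e ∈ new₂ ↔ ∃ u ∈ A', ∃ p : Fin n, p ≠ u ∧ piv (u + 1) = p + 1 ∧
      e = (u, p, D (u + 1))) : LevelOut G A A' (new₁ ++ new₂) := by
  constructor
  · intro e he
    rcases List.mem_append.1 he with he | he
    · obtain ⟨u, -, v, hv, hvu, -, rfl⟩ := (h₁ e).1 he
      exact ⟨hv.1, hvu.symm, rfl⟩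
    · obtain ⟨u, -, p, hpu, hp, rfl⟩ := (h₂ e).1 he
      rcases hA u with ⟨hz, -⟩ | ⟨p', -, hr, hp', hD, -⟩
      · omega
      · obtain rfl : p = p' := Fin.ext (by omega)
        exact ⟨hr.symm, hpu.symm, by simp only [hD]; exact G.rdist_comm _ _⟩
  · intro x hx y hy hxy
    by_cases hne : x = y
    · exact .inl hne
    by_cases hf : G.FarFrom A x (G.rdist y x)
    · exact .inr (.inl ⟨_, List.mem_append_left _ ((h₁ _).2 ⟨y, hy, x, ⟨hxy.symm, hf⟩, hne, hx, rfl⟩)⟩)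
    · rw [← hA.farFrom_iff, not_or, not_lt] at hf
      rcases hA x with ⟨hz, -⟩ | ⟨p, hpA, hr, hp, hD, -⟩
      · exact absurd hz hf.1
      · refine .inr (.inr ⟨p, hpA, ?_, ?_⟩)
        · by_cases hpx : p = x
          · exact .inl hpx
          · exact .inr ⟨_, List.mem_append_right _ ((h₂ _).2 ⟨x, hx, p, hpx, hp, rfl⟩)⟩
        · rw [G.rdist_comm x p, G.rdist_comm x y, ← hD]
          exact hf.2

/-- Process one level. -/
def levelProg : Prog := .seq rootsProg pivotsProg

open Classical in
theorem levelProg_spec (hW : 2 * 2 ^ l + 2 ≤ W) (hn : n < 2 ^ l) (h0 : s.wreg 0 = n)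
    (hM : s.wreg 3 = 2 ^ l) {adj : Fin n → List ℕ} (hadj : AdjLists G adj s)
    (hAA' : A ⊆ levelSet n s) (hA : Nearest G A (s.warr 9) (s.rarr 3))
    (hB : Nearest G A (s.warr 10) (s.rarr 4)) (hidle : Idle n l s)
    (hcur : s.wreg 13 + n < W) {out : List (Fin n × Fin n × ℝ)} (hout : OutList s out)
    (hlen : out.length + n * n + n < W) :
    Runs W ω levelProg s fun t s' =>
      t ≤ 300 * (l + 1) * searchWork G adj A (levelSet n s) + 350 * (l + 1) * (n + 1) ∧
      Nearest G (levelSet n s) (s'.warr 9) (s'.rarr 3) ∧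
      Nearest G (levelSet n s) (s'.warr 10) (s'.rarr 4) ∧ Idle n l s' ∧
      s'.wreg 13 ≤ s.wreg 13 + n ∧ ∃ new, OutList s' (out ++ new) ∧
        LevelOut G A (levelSet n s) new ∧ new.length ≤ numPairs G A (levelSet n s) +
          (Finset.univ.filter (· ∈ levelSet n s)).card := by
  simp only [levelProg, runs_seq]
  refine (rootsProg_spec hW hn h0 hM hadj hAA' hA hB hidle hcur hout (by omega)).mono ?_
  rintro t₁ s₁ hag₁ ⟨ht₁, hN, hI, h13, new₁, hO, hmem₁, hlen₁⟩
  have e9 : s₁.warr 9 = s.warr 9 := hag₁.warr 9 (by decide)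
  have e3 : s₁.rarr 3 = s.rarr 3 := hag₁.rarr 3 (by decide)
  have hset : levelSet n s₁ = levelSet n s := by
    simp only [levelSet, hag₁.wreg 6 (by decide), hag₁.warr 5 (by decide)]
  have hpairs : numPairs G A (levelSet n s) ≤ n * n := by
    refine (Finset.sum_le_card_nsmul _ _ n fun u _ => ?_).trans ?_
    · exact (Finset.card_le_univ _).trans (by simp)
    · exact Nat.mul_le_mul_right _ ((Finset.card_le_univ _).trans (by simp))
  refine (pivotsProg_spec (n := n) (A := A) (G := G) (by omega)
    ((hag₁.wreg 0 (by decide)).trans h0) (by rw [e9, e3]; exact hA) hO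
    (by rw [List.length_append]; omega)).mono ?_
  rintro t₂ s₂ hag₂ ⟨ht₂, hcopy, new₂, hO₂, hmem₂, hlen₂⟩
  rw [hset, e9, e3] at hmem₂
  rw [hset] at hlen₂
  have e10 : s₂.warr 10 = s₁.warr 10 := hag₂.warr 10 (by decide)
  have e4 : s₂.rarr 4 = s₁.rarr 4 := hag₂.rarr 4 (by decide)
  refine ⟨by nlinarith, fun v => ?_, by rw [e10, e4]; exact hN, hI.congr
    (hag₂.warr 7 (by decide)) (hag₂.rarr 2 (by decide)) (hag₂.warr 8 (by decide))
    (hag₂.wreg 13 (by decide)), by rw [hag₂.wreg 13 (by decide)]; exact h13, new₁ ++ new₂,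
    by rwa [← List.append_assoc], LevelOut.of_mem hA hmem₁ hmem₂, ?_⟩
  · rw [(hcopy v).1, (hcopy v).2]
    exact hN v
  · rw [List.length_append]
    exact Nat.add_le_add hlen₁ hlen₂

end

end Hopset

namespace Hopset

variable {n : ℕ}

/-! ### All levels of the hierarchy -/

/-- The `i`-th set of the hierarchy with the ranks `g` and the thresholds `J 0, …, J L`. -/
def hierarchy (g : Fin n → ℕ) (J : ℕ → ℕ) (L i : ℕ) : Set (Fin n) := {v | i ≤ L ∧ J i ≤ g v}

theorem hierarchy_succ_subset (g : Fin n → ℕ) {J : ℕ → ℕ} (hJ : Monotone J) (L i : ℕ) :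
    hierarchy g J L (i + 1) ⊆ hierarchy g J L i :=
  fun _ ⟨h1, h2⟩ => ⟨by omega, (hJ (Nat.le_succ i)).trans h2⟩

/-- Process the levels from the top down to the bottom. Their number is in register `7`, and the
thresholds are in the word array `6`. -/
def levelsProg : Prog :=
  .loop (.wle (.lit 1) (.reg 7)) <|
    .seq (.wset 7 (.sub (.reg 7) (.lit 1))) <|
    .seq (.wset 6 (.get 6 (.reg 7))) levelProg

section

variable {G : WGraph n} {l W : ℕ} {ω : ℕ → Bool} {s : State}

theorem LevelOut.append {A A' : Set (Fin n)} {out new : List (Fin n × Fin n × ℝ)}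
    (h : LevelOut G A A' out)
    (hs : ∀ e ∈ new, G.graph.Reachable e.1 e.2.1 ∧ e.1 ≠ e.2.1 ∧ e.2.2 = G.rdist e.1 e.2.1) :
    LevelOut G A A' (out ++ new) where
  sound e he := (List.mem_append.1 he).elim (h.sound e) (hs e)
  complete x hx y hy hxy :=
    (h.complete x hx y hy hxy).imp_right <| Or.imp
      (fun ⟨w, hw⟩ => ⟨w, List.mem_append_left _ hw⟩) fun ⟨z, hz, h1, h2⟩ =>
      ⟨z, hz, h1.imp_right fun ⟨w, hw⟩ => ⟨w, List.mem_append_left _ hw⟩, h2⟩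

theorem LevelOut.prepend {A A' : Set (Fin n)} {out new : List (Fin n × Fin n × ℝ)}
    (h : LevelOut G A A' new)
    (hs : ∀ e ∈ out, G.graph.Reachable e.1 e.2.1 ∧ e.1 ≠ e.2.1 ∧ e.2.2 = G.rdist e.1 e.2.1) :
    LevelOut G A A' (out ++ new) where
  sound e he := (List.mem_append.1 he).elim (hs e) (h.sound e)
  complete x hx y hy hxy :=
    (h.complete x hx y hy hxy).imp_right <| Or.imp
      (fun ⟨w, hw⟩ => ⟨w, List.mem_append_right _ hw⟩) fun ⟨z, hz, h1, h2⟩ =>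
      ⟨z, hz, h1.imp_right fun ⟨w, hw⟩ => ⟨w, List.mem_append_right _ hw⟩, h2⟩

open Classical in
/-- The bound on the number of edges that are output on one level. -/
noncomputable def levelSize (G : WGraph n) (A A' : Set (Fin n)) : ℕ :=
  numPairs G A A' + (Finset.univ.filter (· ∈ A')).card

theorem levelSize_le (A A' : Set (Fin n)) : levelSize G A A' ≤ n * n + n := by
  classical
  refine Nat.add_le_add ?_ ((Finset.card_le_univ _).trans (by simp))
  refine (Finset.sum_le_card_nsmul _ _ n fun u _ => ?_).trans ?_
  · exact (Finset.card_le_univ _).trans (by simp)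
  · exact Nat.mul_le_mul_right _ ((Finset.card_le_univ _).trans (by simp))

/-- Level `i` needs the pivots of level `i + 1`, hence the order from the top down. The start is
correct because the zero arrays describe the empty set above the top level. -/
theorem levelsProg_spec (hW : 2 * 2 ^ l + 2 ≤ W) (hn : n < 2 ^ l) (h0 : s.wreg 0 = n)
    (hM : s.wreg 3 = 2 ^ l) {adj : Fin n → List ℕ} (hadj : AdjLists G adj s)
    {g : Fin n → ℕ} (hg : ∀ v : Fin n, s.warr 5 (v + 1) = g v) {J : ℕ → ℕ} (hJ : Monotone J)
    {L : ℕ} (hJL : ∀ i ≤ L, s.warr 6 i = J i) (h7 : s.wreg 7 = L + 1)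
    (h9 : ∀ i, s.warr 9 i = 0) (h10 : ∀ i, s.warr 10 i = 0) (hidle : Idle n l s)
    (h13 : s.wreg 13 = 0) (hcnt : s.wreg 9 = 0) (hlen : (L + 2) * (n * n + n) < W) :
    Runs W ω levelsProg s fun t s' =>
      t ≤ (∑ i ∈ Finset.range (L + 1), (300 * (l + 1) * searchWork G adj
        (hierarchy g J L (i + 1)) (hierarchy g J L i) + 400 * (l + 1) * (n + 1))) + 10 ∧
      ∃ out, OutList s' out ∧
        (∀ i ≤ L, LevelOut G (hierarchy g J L (i + 1)) (hierarchy g J L i) out) ∧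
        out.length ≤ ∑ i ∈ Finset.range (L + 1),
          levelSize G (hierarchy g J L (i + 1)) (hierarchy g J L i) := by
  have h1 : 1 % W = 1 := Nat.mod_eq_of_lt (by omega)
  have htop : hierarchy g J L (L + 1) = ∅ := by ext v; simp [hierarchy]
  refine (Runs.loop (α := ℕ) (fun j s' => j ≤ L + 1 ∧ s'.wreg 7 = j ∧
    Nearest G (hierarchy g J L j) (s'.warr 9) (s'.rarr 3) ∧
    Nearest G (hierarchy g J L j) (s'.warr 10) (s'.rarr 4) ∧ Idle n l s' ∧
    s'.wreg 13 + j * n ≤ (L + 1) * n ∧ ∃ out, OutList s' out ∧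
      (∀ e ∈ out, G.graph.Reachable e.1 e.2.1 ∧ e.1 ≠ e.2.1 ∧ e.2.2 = G.rdist e.1 e.2.1) ∧
      (∀ i, j ≤ i → i ≤ L → LevelOut G (hierarchy g J L (i + 1)) (hierarchy g J L i) out) ∧
      out.length ≤ ∑ i ∈ Finset.Ico j (L + 1),
          levelSize G (hierarchy g J L (i + 1)) (hierarchy g J L i))
    (fun j => ∑ i ∈ Finset.range j, (300 * (l + 1) * searchWork G adj
        (hierarchy g J L (i + 1)) (hierarchy g J L i) + 400 * (l + 1) * (n + 1)))
    (L + 1) ?_ ?_).mono ?_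
  · refine ⟨le_rfl, h7, ?_, ?_, hidle, by omega, [], ⟨by simpa using hcnt, by simp⟩, by simp,
      fun i hi hi' => by omega, by simp⟩
    · exact fun v => .inl ⟨h9 _, by simp [htop]⟩
    · exact fun v => .inl ⟨h10 _, by simp [htop]⟩
  · rintro j s₁ hag ⟨hj, hr7, hN, hN', hI, hst, out, hO, hs, hlev, hlen'⟩ hb
    simp only [Test.Holds, WExp.eval, h1, hr7] at hb
    obtain ⟨i, rfl⟩ : ∃ i, j = i + 1 := ⟨j - 1, by omega⟩
    have e5 : s₁.warr 5 = s.warr 5 := hag.warr 5 (by decide)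
    have e6 : s₁.warr 6 = s.warr 6 := hag.warr 6 (by decide)
    simp only [runs_seq, runs_wset]
    have hset : levelSet n ((s₁.setWord 7 (WExp.eval W s₁ (.sub (.reg 7) (.lit 1)))).setWord 6
        (WExp.eval W (s₁.setWord 7 (WExp.eval W s₁ (.sub (.reg 7) (.lit 1)))) (.get 6 (.reg 7)))) =
        hierarchy g J L i := by
      ext v
      simp [levelSet, hierarchy, hr7, h1, e5, e6, hg, hJL i (by omega), (by omega : i ≤ L)]
    have hout : out.length ≤ (L - i) * (n * n + n) := by
      refine hlen'.trans ((Finset.sum_le_card_nsmul _ _ (n * n + n) fun i _ =>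
        levelSize_le _ _).trans ?_)
      simp
    have hout' : out.length + n * n + n ≤ (L + 2) * (n * n + n) := by
      have : (L - i + 1) * (n * n + n) ≤ (L + 2) * (n * n + n) :=
        Nat.mul_le_mul_right _ (by omega)
      rw [Nat.add_mul (L - i) 1] at this
      omega
    have hst' : s₁.wreg 13 + n ≤ (L + 2) * (n * n + n) := by
      have : (L + 2) * n ≤ (L + 2) * (n * n + n) := Nat.mul_le_mul_left _ (by omega)
      rw [Nat.add_mul] at this hst
      rw [Nat.add_mul L 1] at hst
      omega
    refine (levelProg_spec (G := G) (A := hierarchy g J L (i + 1)) (adj := adj) (out := out) hW hn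
      (by simpa using (hag.wreg 0 (by decide)).trans h0)
      (by simpa using (hag.wreg 3 (by decide)).trans hM)
      (hadj.congr (by simpa using hag.warr 2 (by decide)) (by simpa using hag.warr 3 (by decide))
        (by simpa using hag.warr 4 (by decide)) (by simpa using hag.rarr 1 (by decide)))
      (by rw [hset]; exact hierarchy_succ_subset g hJ L i)
      (by simpa using hN) (by simpa using hN') (hI.congr (by simp) (by simp) (by simp) (by simp))
      (by simp; omega) (hO.congr (by simp) (by simp) (by simp) (by simp)) (by omega)).mono ?_
    rw [hset]
    rintro t s₂ hag₂ ⟨ht, hA, hA', hI₂, h13₂, new, hO₂, hL, hlen₂⟩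
    simp only [State.setWord_wreg] at h13₂
    norm_num at h13₂
    refine ⟨i, ⟨by omega, ?_, hA, hA', hI₂, ?_, out ++ new, hO₂, ?_, ?_, ?_⟩, ?_⟩
    · rw [hag₂.wreg 7 (by decide)]
      simp [hr7, h1]
    · rw [Nat.add_mul i 1] at hst
      omega
    · exact fun e he => (List.mem_append.1 he).elim (hs e) (hL.sound e)
    · intro i' hi' hiL
      by_cases heq : i' = i
      · subst heq
        exact hL.prepend hs
      · exact (hlev i' (by omega) hiL).append hL.sound
    · rw [Finset.sum_eq_sum_Ico_succ_bot (by omega), List.length_append, add_comm]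
      exact Nat.add_le_add hlen₂ hlen'
    · rw [Finset.sum_range_succ]
      simp only [Test.cost, WExp.cost]
      have : 350 * (l + 1) * (n + 1) + 50 ≤ 400 * (l + 1) * (n + 1) := by
        have : 1 ≤ (l + 1) * (n + 1) := Nat.mul_pos (by omega) (by omega)
        rw [mul_assoc, mul_assoc]
        omega
      omega
  · rintro t s₁ hag ⟨j, -, ⟨hj, hr7, hN, hN', hI, hst, out, hO, hs, hlev, hlen'⟩, hb, ht⟩
    simp only [Test.Holds, WExp.eval, h1, hr7] at hb
    obtain rfl : j = 0 := by omega
    refine ⟨by simp at ht ⊢; omega, out, hO, fun i hi => hlev i (Nat.zero_le _) hi, ?_⟩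
    rwa [Finset.range_eq_Ico]

end

end Hopset

/-! ### Preprocessing: sampling parameters, thresholds, coins and adjacency lists. -/

namespace Hopset

variable {n : ℕ}

/-! ### Parameters -/

/-- Compute the least power of two that exceeds `n` (register `3`) and its exponent (register
`2`). -/
def sizesProg : Prog :=
  .seq (.wset 2 (.lit 0)) <| .seq (.wset 3 (.lit 1)) <|
  .loop (.wle (.reg 3) (.reg 0)) <|
    .seq (.wset 3 (.mul (.reg 3) (.lit 2))) (.wset 2 (.add (.reg 2) (.lit 1)))

theorem sizesProg_spec {W : ℕ} {ω : ℕ → Bool} {s : State} (hn : 0 < n) (h0 : s.wreg 0 = n)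
    (hW : 2 * n + 2 ≤ W) :
    Runs W ω sizesProg s fun t s' => t ≤ 20 * (n.log2 + 2) ∧ s'.wreg 2 = n.log2 + 1 ∧
      s'.wreg 3 = 2 ^ (n.log2 + 1) := by
  have h1 : 1 % W = 1 := Nat.mod_eq_of_lt (by omega)
  have h2 : 2 % W = 2 := Nat.mod_eq_of_lt (by omega)
  simp only [sizesProg, runs_seq, runs_wset]
  refine (Runs.loop (α := ℕ) (fun j s' => j ≤ n.log2 + 1 ∧ s'.wreg 2 = j ∧ s'.wreg 3 = 2 ^ j)
    (fun j => 20 * (n.log2 + 1 - j)) 0 (by simp [h1]) ?_).mono ?_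
  · rintro j s' hag ⟨hj, e2, e3⟩ hb
    have e0 : s'.wreg 0 = n := by simpa [h0] using hag.wreg 0 (by decide)
    simp only [Test.Holds, WExp.eval, e0, e3] at hb
    have hjl : j ≤ n.log2 := (Nat.le_log2 (by omega)).2 hb
    have hjn : j < n := Nat.lt_two_pow_self.trans_le hb
    simp only [runs_seq, runs_wset]
    refine ⟨j + 1, ⟨by omega, ?_, ?_⟩, by simp; omega⟩
    · simp [e2, h1]
      exact Nat.mod_eq_of_lt (by omega)
    · simp [e3, h2, pow_succ]
      exact Nat.mod_eq_of_lt (by omega)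
  · rintro t s' hag ⟨j, -, ⟨hj, e2, e3⟩, hb, ht⟩
    have e0 : s'.wreg 0 = n := by simpa [h0] using hag.wreg 0 (by decide)
    simp only [Test.Holds, WExp.eval, e0, e3] at hb
    have hjl : ¬ j ≤ n.log2 := fun h => hb ((Nat.le_log2 (by omega)).1 h)
    obtain rfl : j = n.log2 + 1 := by omega
    exact ⟨by simp at ht ⊢; omega, e2, e3⟩

/-- Increase the register `x`, starting from `c`, until `b` holds. -/
def searchProg (x c : ℕ) (b : Test) : Prog :=
  .seq (.wset x (.lit c)) (.loop (.neg b) (.wset x (.add (.reg x) (.lit 1))))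

/-- Reals cannot be converted to words, so ceilings are found by counting up and comparing. This is
cheap as the bounds `N` used later are logarithmic in `n`. -/
theorem searchProg_spec {W : ℕ} {ω : ℕ → Bool} {s : State} {x c N : ℕ} {b : Test} {q : ℕ → Prop}
    (hcN : c ≤ N) (hNW : N + 1 < W) (hN : q N) (hq : ∀ s', Agree (searchProg x c b) s s' →
      (b.Holds W s' ↔ q (s'.wreg x))) :
    Runs W ω (searchProg x c b) s fun t s' => t ≤ (b.cost + 6) * (N + 2) ∧ s'.wreg x ≤ N ∧
      c ≤ s'.wreg x ∧ q (s'.wreg x) ∧ ∀ k, c ≤ k → k < s'.wreg x → ¬ q k := by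
  have h1 : 1 % W = 1 := Nat.mod_eq_of_lt (by omega)
  have hc : c % W = c := Nat.mod_eq_of_lt (by omega)
  have hag₀ : Agree (.wset x (.lit c)) s (s.setWord x (WExp.eval W s (.lit c))) :=
    (Exec.wset (W := W) (ω := ω) x (.lit c) s).agree
  simp only [searchProg, runs_seq, runs_wset]
  refine (Runs.loop (α := ℕ) (fun j s' => j ≤ N ∧ c ≤ j ∧ s'.wreg x = j ∧ ∀ k, c ≤ k → k < j → ¬ q k)
    (fun j => (b.cost + 6) * (N - j)) c ⟨hcN, le_rfl, by simp [hc], fun k _ _ => by omega⟩ ?_).mono ?_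
  · rintro j s' hag ⟨hj, hcj, hr, hk⟩ hb
    have hagree : Agree (searchProg x c b) s s' := hag₀.seq_left.trans
      (Agree.seq_right ⟨hag.wreg, hag.rreg, hag.warr, hag.rarr, hag.tossed⟩)
    rw [Test.Holds, hq s' hagree, hr] at hb
    have hjN : j < N := lt_of_le_of_ne hj fun h => hb (h ▸ hN)
    rw [runs_wset]
    refine ⟨j + 1, ⟨hjN, by omega, ?_, fun k hck hkj => ?_⟩, ?_⟩
    · simp [hr, h1]
      exact Nat.mod_eq_of_lt (by omega)
    · by_cases hkj' : k = j
      · rwa [hkj']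
      · exact hk k hck (by omega)
    · obtain ⟨d, rfl⟩ : ∃ d, N = j + 1 + d := ⟨N - (j + 1), by omega⟩
      simp only [Test.cost, WExp.cost, show j + 1 + d - j = d + 1 by omega,
        show j + 1 + d - (j + 1) = d by omega, Nat.mul_succ]
      omega
  · rintro t s' hag ⟨j, -, ⟨hj, hcj, hr, hk⟩, hb, ht⟩
    have hagree : Agree (searchProg x c b) s s' := hag₀.seq_left.trans
      (Agree.seq_right ⟨hag.wreg, hag.rreg, hag.warr, hag.rarr, hag.tossed⟩)
    rw [Test.Holds, hq s' hagree, hr, not_not] at hb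
    rw [hr]
    refine ⟨?_, hj, hcj, hb, hk⟩
    have : (b.cost + 6) * (N - c) ≤ (b.cost + 6) * N := Nat.mul_le_mul_left _ (Nat.sub_le _ _)
    simp only [Test.cost, WExp.cost, Nat.mul_add] at ht ⊢
    omega

/-- Put `min (l, ⌈l / κ⌉) + 1` into register `4` and `⌈ρ * l⌉` into register `5`. -/
def paramsProg : Prog :=
  .seq (searchProg 4 1 (.rle (.add (.ofWord (.reg 2)) (.reg 0)) (.mul (.ofWord (.reg 4)) (.reg 0))))
    (searchProg 5 0 (.rle (.mul (.reg 1) (.ofWord (.reg 2))) (.ofWord (.reg 5))))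

/-- The numbers `a` and `b` control the sampling probabilities. -/
structure Params (κ ρ : ℝ) (l a b : ℕ) : Prop where
  one_le : 1 ≤ a
  le_mul : (l : ℝ) + κ ≤ a * κ
  mul_lt : ((a : ℝ) - 1) * κ < l + κ
  a_le : a ≤ l + 1
  le_b : ρ * l ≤ b
  b_lt : (b : ℝ) < ρ * l + 1
  b_le : b ≤ l

theorem paramsProg_spec {W : ℕ} {ω : ℕ → Bool} {s : State} {κ ρ : ℝ} {l : ℕ} (hl : 0 < l)
    (hκ : 1 ≤ κ) (hρ : 0 < ρ) (hρ1 : ρ ≤ 1) (h2 : s.wreg 2 = l) (h0 : s.rreg 0 = κ)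
    (h1 : s.rreg 1 = ρ) (hW : l + 2 < W) :
    Runs W ω paramsProg s fun t s' => t ≤ 50 * (l + 3) ∧ Params κ ρ l (s'.wreg 4) (s'.wreg 5) := by
  have hl0 : (0 : ℝ) < l := by exact_mod_cast hl
  simp only [paramsProg, runs_seq]
  -- The least such `a` is `⌈l / κ⌉ + 1`; the value `l + 1` passes the test because `1 ≤ κ`.
  refine (searchProg_spec (N := l + 1) (q := fun a => (l : ℝ) + κ ≤ a * κ) (by omega) (by omega)
    (by push_cast; nlinarith) fun s' hag => ?_).mono ?_
  · have e0 : s'.rreg 0 = κ := (hag.rreg 0 (by decide)).trans h0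
    have e2 : s'.wreg 2 = l := (hag.wreg 2 (by decide)).trans h2
    simp [e0, e2]
  rintro t₁ s₁ hag₁ ⟨ht₁, ha1, ha2, ha3, ha4⟩
  refine (searchProg_spec (N := l) (q := fun b => ρ * l ≤ b) (by omega) (by omega)
    (by nlinarith) fun s' hag => ?_).mono ?_
  · have e0 : s'.rreg 1 = ρ := ((hag.rreg 1 (by decide)).trans (hag₁.rreg 1 (by decide))).trans h1
    have e2 : s'.wreg 2 = l := ((hag.wreg 2 (by decide)).trans (hag₁.wreg 2 (by decide))).trans h2
    simp [e0, e2]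
  rintro t₂ s₂ hag₂ ⟨ht₂, hb1, hb2, hb3, hb4⟩
  rw [hag₂.wreg 4 (by decide)]
  refine ⟨?_, ha2, ha3, ?_, ha1, hb3, ?_, hb1⟩
  · simp only [Test.cost, RExp.cost, WExp.cost] at ht₁ ht₂
    omega
  · by_cases h : s₁.wreg 4 = 1
    · rw [h]; norm_num; linarith
    · have := ha4 (s₁.wreg 4 - 1) (by omega) (by omega)
      rw [Nat.cast_sub ha2, Nat.cast_one] at this
      exact not_le.1 this
  · by_cases h : s₂.wreg 5 = 0
    · rw [h]; norm_num; positivity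
    · have := hb4 (s₂.wreg 5 - 1) (by omega) (by omega)
      rw [Nat.cast_sub (by omega), Nat.cast_one] at this
      linarith [not_le.1 this]

/-- The thresholds: `2 ^ (-thr a b i)` is the probability that a vertex is in the `i`-th set. -/
def thr (a b : ℕ) : ℕ → ℕ
  | 0 => 0
  | i + 1 => thr a b i + min (thr a b i + a) b

theorem thr_mono (a b : ℕ) : Monotone (thr a b) :=
  monotone_nat_of_le_succ fun _ => Nat.le_add_right _ _

/-- The thresholds grow until they are within `b + 2` of `l`. -/
structure LastLevel (l a b L : ℕ) : Prop where
  le : l ≤ thr a b L + b + 2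
  lt : ∀ i < L, thr a b i + b + 2 < l

/-- The last increment is at most `b` and was made with more than `b + 2` to spare. Hence `l` coins
per vertex decide membership in every set. -/
theorem LastLevel.thr_le {l a b L : ℕ} (h : LastLevel l a b L) : thr a b L ≤ l := by
  cases L with
  | zero => simp [thr]
  | succ L => have := h.lt L (by omega); simp only [thr]; omega

theorem le_thr {a b : ℕ} (ha : 1 ≤ a) (hb : 1 ≤ b) (i : ℕ) : i ≤ thr a b i := by
  induction i with
  | zero => simp
  | succ i ih => simp only [thr]; omega

theorem LastLevel.le_length {l a b L : ℕ} (h : LastLevel l a b L) (ha : 1 ≤ a) (hb : 1 ≤ b) :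
    L ≤ l := (le_thr ha hb L).trans h.thr_le

/-- Store the thresholds in the word array `6` and their number in register `7`. -/
def thresholdsProg : Prog :=
  .seq (.wset 7 (.lit 0)) <| .seq (.wset 6 (.lit 0)) <|
  .seq (.loop (.neg (.wle (.reg 2) (.add (.add (.reg 6) (.reg 5)) (.lit 2)))) <|
    .seq (.wset 14 (.add (.reg 6) (.reg 4))) <|
    .seq (.ite (.wle (.reg 5) (.reg 14)) (.wset 14 (.reg 5)) .skip) <|
    .seq (.wset 6 (.add (.reg 6) (.reg 14))) <|
    .seq (.wset 7 (.add (.reg 7) (.lit 1))) (.wput 6 (.reg 7) (.reg 6))) <|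
  .wset 7 (.add (.reg 7) (.lit 1))

theorem thresholdsProg_spec {W : ℕ} {ω : ℕ → Bool} {s : State} {l a b : ℕ} (ha : 1 ≤ a)
    (hb : 1 ≤ b) (hal : a ≤ l + 1) (hbl : b ≤ l) (h2 : s.wreg 2 = l) (h4 : s.wreg 4 = a)
    (h5 : s.wreg 5 = b) (h6 : s.warr 6 0 = 0) (hW : 3 * l + 5 < W) :
    Runs W ω thresholdsProg s fun t s' => t ≤ 50 * (l + 1) ∧ ∃ L, LastLevel l a b L ∧
      s'.wreg 7 = L + 1 ∧ ∀ i ≤ L, s'.warr 6 i = thr a b i := by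
  have m1 : 1 % W = 1 := Nat.mod_eq_of_lt (by omega)
  have m2 : 2 % W = 2 := Nat.mod_eq_of_lt (by omega)
  simp only [thresholdsProg, runs_seq, runs_wset]
  refine (Runs.loop (α := ℕ) (fun j s' => s'.wreg 7 = j ∧ s'.wreg 6 = thr a b j ∧
    (∀ i ≤ j, s'.warr 6 i = thr a b i) ∧ thr a b j ≤ l ∧ ∀ i < j, thr a b i + b + 2 < l)
    (fun j => 40 * (l - j)) 0 ?_ ?_).mono ?_
  · simp [thr, h6]
  · rintro j s' hag ⟨e7, e6, e6', hle, hlt⟩ htest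
    have e2 : s'.wreg 2 = l := by simpa [h2] using hag.wreg 2 (by decide)
    have e4 : s'.wreg 4 = a := by simpa [h4] using hag.wreg 4 (by decide)
    have e5 : s'.wreg 5 = b := by simpa [h5] using hag.wreg 5 (by decide)
    have m3 : (thr a b j + b) % W = thr a b j + b := Nat.mod_eq_of_lt (by omega)
    have m4 : (thr a b j + b + 2) % W = thr a b j + b + 2 := Nat.mod_eq_of_lt (by omega)
    have m5 : (thr a b j + a) % W = thr a b j + a := Nat.mod_eq_of_lt (by omega)
    simp only [Test.Holds, WExp.eval, e2, e5, e6, m2, m3, m4, not_le] at htest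
    have hj := le_thr ha hb j
    have m6 : (j + 1) % W = j + 1 := Nat.mod_eq_of_lt (by omega)
    have hthr : thr a b (j + 1) = thr a b j + min (thr a b j + a) b := rfl
    have htail : ∀ x, x = min (thr a b j + a) b → (thr a b j + x) % W = thr a b (j + 1) := by
      rintro x rfl
      rw [Nat.mod_eq_of_lt (by omega), hthr]
    have hcells : ∀ i ≤ j + 1, Function.update (s'.warr 6) (j + 1) (thr a b (j + 1)) i =
        thr a b i := by
      intro i hi
      by_cases hij : i = j + 1
      · subst hij; simp
      · rw [Function.update_of_ne hij]
        exact e6' i (by omega)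
    have hlt' : ∀ i < j + 1, thr a b i + b + 2 < l := fun i hi => by
      by_cases hij : i = j
      · subst hij; exact htest
      · exact hlt i (by omega)
    rw [runs_seq, runs_wset, runs_seq, runs_ite]
    refine ⟨fun hc => ?_, fun hc => ?_⟩
    · simp [e4, e5, e6, m5] at hc
      simp only [runs_seq, runs_wset, runs_wput]
      refine ⟨j + 1, ?_, by simp; omega⟩
      have := htail b (by omega)
      simp [e4, e5, e6, e7, m1, m5, m6, this]
      exact ⟨hcells, by omega, fun i hi => by have := hlt' i (by omega); omega⟩
    · simp [e4, e5, e6, m5] at hc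
      simp only [runs_skip, runs_seq, runs_wset, runs_wput]
      refine ⟨j + 1, ?_, by simp; omega⟩
      have := htail (thr a b j + a) (by omega)
      simp [e4, e6, e7, m1, m5, m6, this]
      exact ⟨hcells, by omega, fun i hi => by have := hlt' i (by omega); omega⟩
  · rintro t s' hag ⟨j, -, ⟨e7, e6, e6', hle, hlt⟩, htest, ht⟩
    have e2 : s'.wreg 2 = l := by simpa [h2] using hag.wreg 2 (by decide)
    have e5 : s'.wreg 5 = b := by simpa [h5] using hag.wreg 5 (by decide)
    have m3 : (thr a b j + b) % W = thr a b j + b := Nat.mod_eq_of_lt (by omega)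
    have m4 : (thr a b j + b + 2) % W = thr a b j + b + 2 := Nat.mod_eq_of_lt (by omega)
    simp only [Test.Holds, WExp.eval, e2, e5, e6, m2, m3, m4, not_not] at htest
    have hj := le_thr ha hb j
    have m6 : (j + 1) % W = j + 1 := Nat.mod_eq_of_lt (by omega)
    refine ⟨by simp at ht ⊢; omega, j, ⟨htest, hlt⟩, by simp [e7, m1, m6], by simpa using e6'⟩

/-! ### Ranks -/

/-- `1` if the first `t` coins of `c` are heads, and `0` otherwise. -/
def allHeads (c : ℕ → Bool) (t : ℕ) : ℕ := if ∀ i < t, c i = true then 1 else 0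

theorem allHeads_succ (c : ℕ → Bool) (t : ℕ) :
    allHeads c (t + 1) = allHeads c t * (c t).toNat := by
  simp only [allHeads, Nat.forall_lt_succ_right]
  cases c t <;> simp

theorem allHeads_le (c : ℕ → Bool) (t : ℕ) : allHeads c t ≤ 1 := by
  rw [allHeads]; split_ifs <;> simp

/-- The number of heads at the beginning of the first `l` coins of `c`. -/
def lead (c : ℕ → Bool) : ℕ → ℕ
  | 0 => 0
  | t + 1 => lead c t + allHeads c (t + 1)

theorem lead_le (c : ℕ → Bool) (t : ℕ) : lead c t ≤ t := by
  induction t with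
  | zero => rfl
  | succ t ih => exact Nat.add_le_add ih (allHeads_le c _)

theorem lead_eq (c : ℕ → Bool) {t : ℕ} (h : ∀ i < t, c i = true) : lead c t = t := by
  induction t with
  | zero => rfl
  | succ t ih => rw [lead, ih fun i hi => h i (by omega), allHeads, if_pos h]

/-- Threshold events for ranks become events that a block of coins shows only heads, and
independence applies to these. -/
theorem le_lead_iff (c : ℕ → Bool) {l j : ℕ} (hj : j ≤ l) :
    j ≤ lead c l ↔ ∀ i < j, c i = true := by
  induction l with
  | zero => simp [Nat.le_zero.1 hj, lead]
  | succ l ih =>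
    by_cases h : ∀ i < l + 1, c i = true
    · rw [lead_eq c h]
      exact ⟨fun _ i hi => h i (by omega), fun _ => hj⟩
    · rw [lead, allHeads, if_neg h, add_zero]
      rcases Nat.lt_or_ge l j with hlj | hlj
      · obtain rfl : j = l + 1 := by omega
        have := lead_le c l
        exact ⟨fun hle => by omega, fun h' => absurd h' h⟩
      · exact ih hlj

/-- The rank of the vertex `v`. -/
def rank (l : ℕ) (ω : ℕ → Bool) (v : ℕ) : ℕ := lead (fun i => ω (v * l + i)) l

/-- Toss the coins for the ranks of the vertices, and store the ranks in the word array `5`. -/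
def ranksProg : Prog := forProg <|
  .seq (.wset 16 (.lit 0)) <| .seq (.wset 17 (.lit 0)) <| .seq (.wset 18 (.lit 1)) <|
  .seq (.loop (.wle (.add (.reg 16) (.lit 1)) (.reg 2)) <|
    .seq (.flip 15) <|
    .seq (.wset 18 (.mul (.reg 18) (.reg 15))) <|
    .seq (.wset 17 (.add (.reg 17) (.reg 18))) (.wset 16 (.add (.reg 16) (.lit 1)))) <|
  .wput 5 (.reg 8) (.reg 17)

/-- All `l` coins of a vertex are tossed even after a tail. So the vertices use fixed disjoint
blocks of coins, and the total number of tosses does not depend on the outcome. -/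
theorem ranksProg_spec {W : ℕ} {ω : ℕ → Bool} {s : State} {l : ℕ} (h0 : s.wreg 0 = n)
    (h2 : s.wreg 2 = l) (htoss : s.tossed = 0) (hW : n + 2 ≤ W) (hlW : l + 2 ≤ W) :
    Runs W ω ranksProg s fun t s' => t ≤ 60 * (l + 1) * (n + 1) ∧ s'.tossed = n * l ∧
      ∀ v : Fin n, s'.warr 5 (v + 1) = rank l ω v := by
  have m1 : 1 % W = 1 := Nat.mod_eq_of_lt (by omega)
  refine (forProg_spec (n := n) (by decide) (by decide) h0 hW (fun k s' =>
    s'.tossed = k * l ∧ ∀ v : Fin n, (v : ℕ) < k → s'.warr 5 (v + 1) = rank l ω v)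
    (fun _ => 30 * l + 40) ?_ ?_ ?_).mono ?_
  · rintro k s' i ⟨e1, e2⟩
    exact ⟨by simpa using e1, by simpa using e2⟩
  · exact ⟨by simpa using htoss, by simp⟩
  · rintro k hk s₁ hag ⟨e1, e2⟩ hr8
    have f2 : s₁.wreg 2 = l := (hag.wreg 2 (by decide)).trans h2
    simp only [runs_seq, runs_wset]
    refine (Runs.loop (α := ℕ) (fun t s' => t ≤ l ∧ s'.tossed = k * l + t ∧ s'.wreg 16 = t ∧
      s'.wreg 17 = lead (fun i => ω (k * l + i)) t ∧
      s'.wreg 18 = allHeads (fun i => ω (k * l + i)) t)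
      (fun t => 30 * (l - t)) 0 ?_ ?_).mono ?_
    · simp [e1, lead, m1, allHeads]
    · rintro t s' hag' ⟨ht, g1, g2, g3, g4⟩ hb
      have e2 : s'.wreg 2 = l := by simpa [f2] using hag'.wreg 2 (by decide)
      have m3 : (t + 1) % W = t + 1 := Nat.mod_eq_of_lt (by omega)
      simp only [Test.Holds, WExp.eval, g2, m1, m3, e2] at hb
      have hle := lead_le (fun i => ω (k * l + i)) t
      simp only [runs_seq, runs_wset, runs_flip]
      have hif : allHeads (fun i => ω (k * l + i)) t * (ω (k * l + t)).toNat % W =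
          allHeads (fun i => ω (k * l + i)) (t + 1) := by
        have := allHeads_le (fun i => ω (k * l + i)) (t + 1)
        rw [allHeads_succ] at this ⊢
        exact Nat.mod_eq_of_lt (by omega)
      have hadd : (lead (fun i => ω (k * l + i)) t + allHeads (fun i => ω (k * l + i)) (t + 1)) % W =
          lead (fun i => ω (k * l + i)) (t + 1) := by
        have := allHeads_le (fun i => ω (k * l + i)) (t + 1)
        rw [lead]
        exact Nat.mod_eq_of_lt (by omega)
      refine ⟨t + 1, ⟨hb, ?_, ?_, ?_, ?_⟩, ?_⟩
      · simp [g1, add_assoc]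
      · simp [g2, m1, m3]
      · simp [g1, g3, g4, hif, hadd]
      · simp [g1, g4, hif]
      · simp
        omega
    · rintro t s' hag' ⟨t', -, ⟨ht, g1, g2, g3, g4⟩, hb, hc⟩
      have e2' : s'.wreg 2 = l := by simpa [f2] using hag'.wreg 2 (by decide)
      have e5 : s'.warr 5 = s₁.warr 5 := by simpa using hag'.warr 5 (by decide)
      have e8 : s'.wreg 8 = k + 1 := by simpa [hr8] using hag'.wreg 8 (by decide)
      have m3 : (t' + 1) % W = t' + 1 := Nat.mod_eq_of_lt (by omega)
      simp only [Test.Holds, WExp.eval, g2, m1, m3, e2'] at hb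
      obtain rfl : t' = l := by omega
      simp at hc
      rw [runs_wput]
      refine ⟨by simp; omega, by simp [g1, Nat.succ_mul], fun v hv => ?_⟩
      simp only [State.putWord_warr, WExp.eval, if_true, e8, g3, e5]
      by_cases hvk : (v : ℕ) = k
      · rw [hvk, Function.update_self, rank]
      · rw [Function.update_of_ne (by omega)]
        exact e2 v (by omega)
  · rintro t s' - ⟨ht, e1, e2⟩
    refine ⟨?_, e1, fun v => e2 v v.2⟩
    simp only [Finset.sum_const, Finset.card_range, smul_eq_mul] at ht
    nlinarith

/-! ### Adjacency lists -/

/-- Put an edge into the adjacency list of the vertex in register `p`; its other end point is in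
register `q`, its weight is in the cell of the real array `0` given by register `12`, and the new
cell of the list is in register `14`. -/
def linkProg (p q : ℕ) : Prog :=
  .seq (.wput 4 (.reg 14) (.reg q)) <|
  .seq (.rput 1 (.reg 14) (.get 0 (.reg 12))) <|
  .seq (.wput 3 (.reg 14) (.get 2 (.reg p))) (.wput 2 (.reg p) (.reg 14))

/-- The adjacency lists hold the directed edges in `hs`. -/
structure Links (hs : List (Fin n × Fin n × ℝ)) (adj : Fin n → List ℕ) (s : State) : Prop where
  chain : ∀ v : Fin n, Chain (s.warr 3) (s.warr 2 (v + 1)) (adj v)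
  le_length : ∀ v, ∀ i ∈ adj v, i ≤ hs.length
  sound : ∀ v, ∀ i ∈ adj v, ∃ e ∈ hs, e.1 = v ∧ s.warr 4 i = e.2.1 + 1 ∧ s.rarr 1 i = e.2.2
  complete : ∀ e ∈ hs, ∃ i ∈ adj e.1, s.warr 4 i = e.2.1 + 1
  length_eq : ∀ v, (adj v).length = (hs.filter (·.1 = v)).length

theorem Chain.congr {next next' : ℕ → ℕ} {e : ℕ} {l : List ℕ} (h : Chain next e l)
    (hn : ∀ i ∈ l, next' i = next i) : Chain next' e l := by
  induction l generalizing e with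
  | nil => exact h
  | cons i l ih =>
    obtain ⟨h1, h2, h3⟩ := h
    refine ⟨h1, h2, ?_⟩
    rw [hn i (by simp)]
    exact ih h3 fun j hj => hn j (by simp [hj])

theorem linkProg_spec {W : ℕ} {ω : ℕ → Bool} {s : State} {p q : ℕ} {x y : Fin n} {w : ℝ}
    {hs : List (Fin n × Fin n × ℝ)} {adj : Fin n → List ℕ} (h : Links hs adj s)
    (hp : s.wreg p = x + 1) (hq : s.wreg q = y + 1) (hw : s.rarr 0 (s.wreg 12) = w)
    (h14 : s.wreg 14 = hs.length + 1) :
    Runs W ω (linkProg p q) s fun t s' => t ≤ 20 ∧ s'.wreg = s.wreg ∧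
      ∃ adj', Links (hs ++ [(x, y, w)]) adj' s' := by
  simp only [linkProg, runs_seq, runs_wput, runs_rput]
  refine ⟨by simp, rfl, Function.update adj x ((hs.length + 1) :: adj x), ?_⟩
  -- The cell to be written is beyond all cells in use and so disturbs no list; it is also nonzero,
  -- zero being the end marker.
  have hfresh : ∀ v, ∀ i ∈ adj v, i ≠ hs.length + 1 := fun v i hi => by
    have := h.le_length v i hi; omega
  have hmem : ∀ v i, i ∈ Function.update adj x ((hs.length + 1) :: adj x) v →
      (v = x ∧ i = hs.length + 1) ∨ i ∈ adj v := fun v i hi => by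
    by_cases hv : v = x
    · subst hv
      simp at hi
      exact hi.imp_left fun h => ⟨rfl, h⟩
    · rw [Function.update_of_ne hv] at hi
      exact .inr hi
  have hmem' : ∀ v, ∀ i ∈ adj v, i ∈ Function.update adj x ((hs.length + 1) :: adj x) v :=
    fun v i hi => by
      by_cases hv : v = x
      · subst hv; simp [hi]
      · rwa [Function.update_of_ne hv]
  constructor
  · intro v
    by_cases hv : v = x
    · subst hv
      simp [hp, h14, Chain]
      exact (h.chain v).congr fun i hi => Function.update_of_ne (hfresh v i hi) _ _
    · have hne : (v : ℕ) ≠ x := fun h => hv (Fin.ext h)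
      simp [hp, h14, hv, hne]
      exact (h.chain v).congr fun i hi => Function.update_of_ne (hfresh v i hi) _ _
  · intro v i hi
    rw [List.length_append, List.length_singleton]
    rcases hmem v i hi with ⟨-, rfl⟩ | hi
    · exact le_rfl
    · exact (h.le_length v i hi).trans (Nat.le_succ _)
  · intro v i hi
    rcases hmem v i hi with ⟨rfl, rfl⟩ | hi
    · exact ⟨(v, y, w), by simp, rfl, by simp [h14, hq], by simp [h14, hw]⟩
    · obtain ⟨e, he, h1, h2, h3⟩ := h.sound v i hi
      refine ⟨e, by simp [he], h1, ?_, ?_⟩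
      · simp [h14, Function.update_of_ne (hfresh v i hi), h2]
      · simp [h14, Function.update_of_ne (hfresh v i hi), h3]
  · intro e he
    rcases List.mem_append.1 he with he | he
    · obtain ⟨i, hi, h2⟩ := h.complete e he
      exact ⟨i, hmem' _ i hi, by simp [h14, Function.update_of_ne (hfresh _ i hi), h2]⟩
    · rw [List.mem_singleton.1 he]
      exact ⟨hs.length + 1, by simp, by simp [h14, hq]⟩
  · intro v
    rw [List.filter_append, List.length_append, ← h.length_eq]
    by_cases hv : v = x
    · subst hv; simp
    · simp [hv, Ne.symm hv]

/-- Build the adjacency lists. -/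
def adjProg : Prog :=
  .seq (.wset 12 (.lit 0)) <|
  .loop (.wle (.add (.reg 12) (.lit 1)) (.reg 1)) <|
    .seq (.wset 8 (.add (.get 0 (.reg 12)) (.lit 1))) <|
    .seq (.wset 10 (.add (.get 1 (.reg 12)) (.lit 1))) <|
    .seq (.wset 14 (.add (.mul (.lit 2) (.reg 12)) (.lit 1))) <|
    .seq (linkProg 8 10) <|
    .seq (.wset 14 (.add (.reg 14) (.lit 1))) <|
    .seq (linkProg 10 8) (.wset 12 (.add (.reg 12) (.lit 1)))

theorem Links.congr {hs : List (Fin n × Fin n × ℝ)} {adj : Fin n → List ℕ} {s s' : State}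
    (h : Links hs adj s) (h2 : s'.warr 2 = s.warr 2) (h3 : s'.warr 3 = s.warr 3)
    (h4 : s'.warr 4 = s.warr 4) (h1 : s'.rarr 1 = s.rarr 1) : Links hs adj s' := by
  constructor
  · rw [h2, h3]; exact h.chain
  · exact h.le_length
  · rw [h4, h1]; exact h.sound
  · rw [h4]; exact h.complete
  · exact h.length_eq

theorem adjProg_spec {W : ℕ} {ω : ℕ → Bool} {s : State} {es : List (Fin n × Fin n × ℝ)}
    (h1 : s.wreg 1 = es.length) (h2 : ∀ i, s.warr 2 i = 0)
    (hes : ∀ (i : ℕ) (hi : i < es.length), s.warr 0 i = es[i].1 ∧ s.warr 1 i = es[i].2.1 ∧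
      s.rarr 0 i = es[i].2.2) (hW : 2 * es.length + 2 < W) (hnW : n + 2 ≤ W) :
    Runs W ω adjProg s fun t s' => t ≤ 100 * (es.length + 1) ∧ ∃ adj,
      Links (es.flatMap fun e => [(e.1, e.2.1, e.2.2), (e.2.1, e.1, e.2.2)]) adj s' := by
  have m1 : 1 % W = 1 := Nat.mod_eq_of_lt (by omega)
  have m2 : 2 % W = 2 := Nat.mod_eq_of_lt (by omega)
  set dbl : Fin n × Fin n × ℝ → List (Fin n × Fin n × ℝ) :=
    fun e => [(e.1, e.2.1, e.2.2), (e.2.1, e.1, e.2.2)] with hdbl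
  have hlen : ∀ l : List (Fin n × Fin n × ℝ), (l.flatMap dbl).length = 2 * l.length := fun l => by
    induction l with
    | nil => rfl
    | cons e l ih =>
      rw [List.flatMap_cons, List.length_append, ih, List.length_cons]
      simp
      omega
  simp only [adjProg, runs_seq, runs_wset]
  refine (Runs.loop (α := ℕ) (fun k s' => k ≤ es.length ∧ s'.wreg 12 = k ∧
    ∃ adj, Links ((es.take k).flatMap dbl) adj s') (fun k => 90 * (es.length - k)) 0 ?_ ?_).mono ?_
  · refine ⟨Nat.zero_le _, by simp, fun _ => [], ?_, by simp, by simp, by simp, by simp⟩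
    intro v
    simpa [Chain] using h2 _
  · rintro k s₁ hag ⟨hk, hr12, adj, hL⟩ hb
    have e1 : s₁.wreg 1 = es.length := by simpa [h1] using hag.wreg 1 (by decide)
    have m3 : (k + 1) % W = k + 1 := Nat.mod_eq_of_lt (by omega)
    simp only [Test.Holds, WExp.eval, hr12, m1, m3, e1] at hb
    obtain ⟨g1, g2, g3⟩ := hes k hb
    have f0 : s₁.warr 0 = s.warr 0 := by simpa using hag.warr 0 (by decide)
    have f1 : s₁.warr 1 = s.warr 1 := by simpa using hag.warr 1 (by decide)
    have f2 : s₁.rarr 0 = s.rarr 0 := by simpa using hag.rarr 0 (by decide)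
    have m4 : ((es[k].1 : ℕ) + 1) % W = es[k].1 + 1 := Nat.mod_eq_of_lt (by omega)
    have m5 : ((es[k].2.1 : ℕ) + 1) % W = es[k].2.1 + 1 := Nat.mod_eq_of_lt (by omega)
    have m6 : 2 * k % W = 2 * k := Nat.mod_eq_of_lt (by omega)
    have m7 : (2 * k + 1) % W = 2 * k + 1 := Nat.mod_eq_of_lt (by omega)
    have m8 : (2 * k + 1 + 1) % W = 2 * k + 1 + 1 := Nat.mod_eq_of_lt (by omega)
    have htk : ((es.take k).flatMap dbl).length = 2 * k := by
      rw [hlen, List.length_take, min_eq_left hk]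
    simp only [runs_seq, runs_wset]
    refine (linkProg_spec (x := es[k].1) (y := es[k].2.1) (w := es[k].2.2)
      (hL.congr (by simp) (by simp) (by simp) (by simp)) (by simp [hr12, f0, g1, m1, m4])
      (by simp [hr12, f1, g2, m1, m5]) (by simp [hr12, f2, g3])
      (by simp [hr12, m1, m2, m6, m7, htk])).mono ?_
    rintro t₂ s₂ hag₂ ⟨ht₂, hreg₂, adj₂, hL₂⟩
    refine (linkProg_spec (x := es[k].2.1) (y := es[k].1) (w := es[k].2.2)
      (hL₂.congr (by simp) (by simp) (by simp) (by simp)) (by simp [hreg₂, hr12, f1, g2, m1, m5])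
      (by simp [hreg₂, hr12, f0, g1, m1, m4])
      (by simpa [hreg₂, hr12, f2, g3] using congrFun (hag₂.rarr 0 (by decide)) k)
      (by simp [hreg₂, hr12, m1, m2, m6, m7, m8, htk])).mono ?_
    rintro t₃ s₃ hag₃ ⟨ht₃, hreg₃, adj₃, hL₃⟩
    refine ⟨k + 1, ⟨hb, ?_, adj₃, ?_⟩, ?_⟩
    · simp [hreg₃, hreg₂, hr12, m1, m3]
    · have : (es.take (k + 1)).flatMap dbl = (es.take k).flatMap dbl ++
          [(es[k].1, es[k].2.1, es[k].2.2)] ++ [(es[k].2.1, es[k].1, es[k].2.2)] := by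
        rw [List.take_succ_eq_append_getElem hb, List.flatMap_append]
        simp [hdbl]
      rw [this]
      exact hL₃.congr (by simp) (by simp) (by simp) (by simp)
    · simp
      omega
  · rintro t s₁ hag ⟨k, -, ⟨hk, hr12, adj, hL⟩, hb, ht⟩
    have e1 : s₁.wreg 1 = es.length := by simpa [h1] using hag.wreg 1 (by decide)
    have m3 : (k + 1) % W = k + 1 := Nat.mod_eq_of_lt (by omega)
    simp only [Test.Holds, WExp.eval, hr12, m1, m3, e1] at hb
    obtain rfl : k = es.length := by omega
    rw [List.take_length] at hL
    exact ⟨by simp at ht ⊢; omega, adj, hL⟩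

end Hopset

/-! ### The complete program and the graph that it outputs. -/

namespace Hopset

variable {n : ℕ}

/-! ### The algorithm -/

/-- Both orientations of the edges in a list. -/
def bothWays (es : List (Fin n × Fin n × ℝ)) : List (Fin n × Fin n × ℝ) :=
  es.flatMap fun e => [(e.1, e.2.1, e.2.2), (e.2.1, e.1, e.2.2)]

theorem mem_bothWays {es : List (Fin n × Fin n × ℝ)} {u v : Fin n} {x : ℝ} :
    (u, v, x) ∈ bothWays es ↔ (u, v, x) ∈ es ∨ (v, u, x) ∈ es := by
  simp only [bothWays, List.mem_flatMap, List.mem_cons, List.not_mem_nil, or_false, Prod.exists,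
    Prod.mk.injEq]
  constructor
  · rintro ⟨a, b, c, h, ⟨rfl, rfl, rfl⟩ | ⟨rfl, rfl, rfl⟩⟩
    · exact .inl h
    · exact .inr h
  · rintro (h | h)
    · exact ⟨u, v, x, h, .inl ⟨rfl, rfl, rfl⟩⟩
    · exact ⟨v, u, x, h, .inr ⟨rfl, rfl, rfl⟩⟩

theorem length_bothWays (es : List (Fin n × Fin n × ℝ)) :
    (bothWays es).length = 2 * es.length := by
  induction es with
  | nil => rfl
  | cons e l ih =>
    rw [bothWays, List.flatMap_cons, List.length_append, ← bothWays, ih, List.length_cons]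
    simp
    omega

/-- The number of listed edges at a vertex. -/
def listDegree (es : List (Fin n × Fin n × ℝ)) (v : Fin n) : ℕ :=
  ((bothWays es).filter (·.1 = v)).length

theorem sum_listDegree (es : List (Fin n × Fin n × ℝ)) :
    ∑ v, listDegree es v = 2 * es.length := by
  rw [← length_bothWays]
  simp only [listDegree]
  induction bothWays es with
  | nil => simp
  | cons e l ih =>
    simp only [List.filter_cons, List.length_cons, ← ih]
    have : ∀ v, (if decide (e.1 = v) = true then e :: l.filter (·.1 = v)
        else l.filter (·.1 = v)).length =
        (l.filter (·.1 = v)).length + if e.1 = v then 1 else 0 := fun v => by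
      by_cases h : e.1 = v <;> simp [h]
    rw [Finset.sum_congr rfl fun v _ => this v, Finset.sum_add_distrib]
    simp

theorem Links.adjLists {G : WGraph n} {es : List (Fin n × Fin n × ℝ)} (hes : G.IsListedBy es)
    {adj : Fin n → List ℕ} {s : State} (h : Links (bothWays es) adj s) : AdjLists G adj s where
  chain := h.chain
  sound v i hi := by
    obtain ⟨⟨a, b, x⟩, he, h1, h2, h3⟩ := h.sound v i hi
    obtain rfl : a = v := h1
    obtain ⟨h4, h5⟩ := (hes a b x).1 (mem_bothWays.1 he)
    exact ⟨b, h4, h2, h3.trans h5.symm⟩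
  complete v y hvy :=
    h.complete (v, y, G.weight s(v, y)) (mem_bothWays.2 ((hes v y _).2 ⟨hvy, rfl⟩))

theorem WGraph.IsListedOnceBy.length_le {G : WGraph n} {es : List (Fin n × Fin n × ℝ)}
    (h : G.IsListedOnceBy es) : es.length ≤ n * n := by
  have h1 : (es.map fun e => (e.1, e.2.1)).Nodup := by
    refine List.Nodup.of_map (fun p : Fin n × Fin n => s(p.1, p.2)) ?_
    rw [List.map_map]
    exact h.2
  simpa using h1.length_le_card

theorem WGraph.IsListedOnceBy.length_eq {G : WGraph n} {es : List (Fin n × Fin n × ℝ)}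
    (h : G.IsListedOnceBy es) : es.length = G.numEdges := by
  classical
  rw [WGraph.numEdges, ← List.length_map (fun e : Fin n × Fin n × ℝ => s(e.1, e.2.1)),
    ← List.toFinset_card_of_nodup h.2, ← Set.ncard_coe_finset]
  congr 1
  ext e
  induction e with
  | _ u v =>
    rw [SimpleGraph.mem_edgeSet]
    simp only [List.coe_toFinset, List.mem_map, Set.mem_ofPred_eq, Prod.exists, Sym2.eq_iff]
    constructor
    · rintro ⟨a, b, x, he, ⟨rfl, rfl⟩ | ⟨rfl, rfl⟩⟩
      · exact ((h.1 a b x).1 (.inl he)).1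
      · exact ((h.1 b a x).1 (.inr he)).1
    · intro huv
      rcases (h.1 u v _).2 ⟨huv, rfl⟩ with he | he
      · exact ⟨u, v, _, he, .inl ⟨rfl, rfl⟩⟩
      · exact ⟨v, u, _, he, .inr ⟨rfl, rfl⟩⟩

/-- The algorithm. -/
def mainProg : Prog :=
  .seq sizesProg <| .seq paramsProg <| .seq adjProg <| .seq ranksProg <| .seq thresholdsProg <|
  .seq levelsProg <| .wset 0 (.reg 9)

/-- The sets of the hierarchy for the outcome `ω` of the coin tosses. -/
def levels (n l a b L : ℕ) (ω : ℕ → Bool) : ℕ → Set (Fin n) :=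
  hierarchy (fun v => rank l ω v) (thr a b) L

open Classical in
/-- The work on the levels of the hierarchy. -/
noncomputable def totalWork (G : WGraph n) (es : List (Fin n × Fin n × ℝ)) (l a b L : ℕ)
    (ω : ℕ → Bool) : ℕ :=
  ∑ i ∈ Finset.range (L + 1), ∑ u with u ∈ levels n l a b L ω i,
    ∑ v with v ∈ G.cluster (levels n l a b L ω (i + 1)) u, (listDegree es v + 1)

/-- The bound on the number of edges in the output. -/
noncomputable def totalSize (G : WGraph n) (l a b L : ℕ) (ω : ℕ → Bool) : ℕ :=
  ∑ i ∈ Finset.range (L + 1),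
    levelSize G (levels n l a b L ω (i + 1)) (levels n l a b L ω i)

theorem mainProg_spec {κ ρ ε : ℝ} {G : WGraph n} {es : List (Fin n × Fin n × ℝ)} {ω : ℕ → Bool}
    (hn : 16 ≤ n) (hκ : 1 ≤ κ) (hρ : 0 < ρ) (hρ1 : ρ ≤ 1) (hes : G.IsListedOnceBy es) :
    Runs (n ^ 4) ω mainProg (initState κ ρ ε es) fun t s' => ∃ a b L,
      Params κ ρ (n.log2 + 1) a b ∧ LastLevel (n.log2 + 1) a b L ∧
      s'.tossed = n * (n.log2 + 1) ∧
      t ≤ 300 * (n.log2 + 2) * totalWork G es (n.log2 + 1) a b L ω +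
        1000 * (n.log2 + 2) * (n.log2 + 2) * (n + 1) + 100 * (es.length + 1) ∧
      ∃ out : List (Fin n × Fin n × ℝ), (s'.wreg 0 = out.length ∧
          ∀ (i : ℕ) (hi : i < out.length),
          s'.warr 0 i = (out[i].1 : ℕ) ∧ s'.warr 1 i = (out[i].2.1 : ℕ) ∧
          s'.rarr 0 i = out[i].2.2) ∧
        (∀ i ≤ L, LevelOut G (levels n (n.log2 + 1) a b L ω (i + 1))
          (levels n (n.log2 + 1) a b L ω i) out) ∧
        out.length ≤ totalSize G (n.log2 + 1) a b L ω := by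
  set l := n.log2 + 1 with hl
  have hln : l < n := by
    have h1 : 2 ^ (l - 1) ≤ n := Nat.log2_self_le (by omega)
    by_contra hge
    have h2 : n ≤ l - 1 + 1 := by omega
    have h3 : l - 1 + 1 < 2 ^ (l - 1) := by
      have : 4 ≤ l - 1 := by
        rw [hl, Nat.add_sub_cancel, Nat.le_log2 (by omega)]; omega
      obtain ⟨d, hd⟩ := Nat.exists_eq_add_of_le this
      rw [hd, pow_add]
      have := Nat.lt_two_pow_self (n := d)
      omega
    omega
  have h2l : 2 ^ l ≤ 2 * n := by
    rw [hl, pow_succ, mul_comm]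
    exact Nat.mul_le_mul_left _ (Nat.log2_self_le (by omega))
  have hn2l : n < 2 ^ l := Nat.lt_log2_self
  -- Every level outputs at most `n * n + n` entries and there are fewer than `n + 2` levels, so all
  -- counters fit into words below `n ^ 4`.
  have hW : (n + 2) * (n * n + n) + 5 * n + 10 ≤ n ^ 4 := by
    calc (n + 2) * (n * n + n) + 5 * n + 10 ≤ 2 * n * (2 * n * n) + n * n * n := by nlinarith
      _ ≤ n ^ 4 := by nlinarith [Nat.mul_le_mul_left (n * n * n) hn]
  have hnn : n ≤ n * n := Nat.le_mul_self n
  have hW1 : 4 * (n * n) + 2 * n + 5 * n + 10 ≤ n ^ 4 := by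
    refine le_trans ?_ hW
    nlinarith [Nat.mul_le_mul_left (n * n) hn]
  have hm := hes.length_le
  simp only [mainProg, runs_seq]
  refine (sizesProg_spec (n := n) (by omega) (by simp [initState]) (by omega)).mono ?_
  rintro t₁ s₁ hag₁ ⟨ht₁, e2, e3⟩
  have w0 : s₁.wreg 0 = n := by rw [hag₁.wreg 0 (by decide)]; simp [initState]
  have w1 : s₁.wreg 1 = es.length := by rw [hag₁.wreg 1 (by decide)]; simp [initState]
  refine (paramsProg_spec (κ := κ) (ρ := ρ) (l := l) (by omega) hκ hρ hρ1 e2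
    (by rw [hag₁.rreg 0 (by decide)]; simp [initState])
    (by rw [hag₁.rreg 1 (by decide)]; simp [initState]) (by omega)).mono ?_
  rintro t₂ s₂ hag₂ ⟨ht₂, hpar⟩
  refine (adjProg_spec (n := n) (es := es) ((hag₂.wreg 1 (by decide)).trans w1)
    (fun i => by rw [hag₂.warr 2 (by decide), hag₁.warr 2 (by decide)]; simp [initState])
    (fun i hi => ?_) (by omega) (by omega)).mono ?_
  · rw [hag₂.warr 0 (by decide), hag₁.warr 0 (by decide), hag₂.warr 1 (by decide),
      hag₁.warr 1 (by decide), hag₂.rarr 0 (by decide), hag₁.rarr 0 (by decide)]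
    simp [initState, hi]
  rintro t₃ s₃ hag₃ ⟨ht₃, adj, hlinks⟩
  refine (ranksProg_spec (n := n) (l := l)
    (((hag₃.wreg 0 (by decide)).trans (hag₂.wreg 0 (by decide))).trans w0)
    (((hag₃.wreg 2 (by decide)).trans (hag₂.wreg 2 (by decide))).trans e2)
    (((hag₃.tossed (by decide)).trans (hag₂.tossed (by decide))).trans
      ((hag₁.tossed (by decide)).trans rfl)) (by omega) (by omega)).mono ?_
  rintro t₄ s₄ hag₄ ⟨ht₄, htoss, hranks⟩
  have hb1 : 1 ≤ s₂.wreg 5 := by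
    by_contra h
    have h0 : s₂.wreg 5 = 0 := by omega
    have h1 := hpar.le_b
    rw [h0] at h1
    have : (0 : ℝ) < ρ * l := mul_pos hρ (by exact_mod_cast (by omega : 0 < l))
    norm_num at h1
    linarith
  refine (thresholdsProg_spec (l := l) (a := s₂.wreg 4) (b := s₂.wreg 5) hpar.one_le hb1 hpar.a_le
    hpar.b_le ((hag₄.wreg 2 (by decide)).trans
      (((hag₃.wreg 2 (by decide)).trans (hag₂.wreg 2 (by decide))).trans e2))
    ((hag₄.wreg 4 (by decide)).trans (hag₃.wreg 4 (by decide)))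
    ((hag₄.wreg 5 (by decide)).trans (hag₃.wreg 5 (by decide))) ?_ (by omega)).mono ?_
  · rw [hag₄.warr 6 (by decide), hag₃.warr 6 (by decide), hag₂.warr 6 (by decide),
      hag₁.warr 6 (by decide)]
    simp [initState]
  rintro t₅ s₅ hag₅ ⟨ht₅, L, hL, h7, hcells⟩
  have hLl := hL.le_length hpar.one_le hb1
  have wcarry : ∀ x, x ∉ sizesProg.wregs → x ∉ paramsProg.wregs → x ∉ adjProg.wregs →
      x ∉ ranksProg.wregs → x ∉ thresholdsProg.wregs →
      s₅.wreg x = (initState κ ρ ε es).wreg x := fun x h1 h2 h3 h4 h5 => by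
    rw [hag₅.wreg x h5, hag₄.wreg x h4, hag₃.wreg x h3, hag₂.wreg x h2, hag₁.wreg x h1]
  have acarry : ∀ x, x ∉ sizesProg.warrs → x ∉ paramsProg.warrs → x ∉ adjProg.warrs →
      x ∉ ranksProg.warrs → x ∉ thresholdsProg.warrs →
      s₅.warr x = (initState κ ρ ε es).warr x := fun x h1 h2 h3 h4 h5 => by
    rw [hag₅.warr x h5, hag₄.warr x h4, hag₃.warr x h3, hag₂.warr x h2, hag₁.warr x h1]
  have z7 : ∀ i, s₅.warr 7 i = 0 := fun i => by
    rw [acarry 7 (by decide) (by decide) (by decide) (by decide) (by decide)]; simp [initState]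
  have z8 : ∀ i, s₅.warr 8 i = 0 := fun i => by
    rw [acarry 8 (by decide) (by decide) (by decide) (by decide) (by decide)]; simp [initState]
  have z9 : ∀ i, s₅.warr 9 i = 0 := fun i => by
    rw [acarry 9 (by decide) (by decide) (by decide) (by decide) (by decide)]; simp [initState]
  have z10 : ∀ i, s₅.warr 10 i = 0 := fun i => by
    rw [acarry 10 (by decide) (by decide) (by decide) (by decide) (by decide)]; simp [initState]
  -- Zeroed memory is already a valid empty queue, so no initialisation is needed.
  have hidle : Idle n l s₅ := ⟨fun k _ _ => by simp [NodeOK, z7], fun x _ => z7 _,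
    fun v => by rw [z8]; exact Nat.zero_le _⟩
  refine (levelsProg_spec (G := G) (l := l) (adj := adj) (g := fun v => rank l ω v)
    (J := thr (s₂.wreg 4) (s₂.wreg 5)) (L := L) (by omega) hn2l
    (by rw [wcarry 0 (by decide) (by decide) (by decide) (by decide) (by decide)]; simp [initState])
    (by rw [hag₅.wreg 3 (by decide), hag₄.wreg 3 (by decide), hag₃.wreg 3 (by decide),
      hag₂.wreg 3 (by decide), e3])
    ((Links.adjLists hes.1 (es := es) hlinks).congr
      ((hag₅.warr 2 (by decide)).trans (hag₄.warr 2 (by decide)))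
      ((hag₅.warr 3 (by decide)).trans (hag₄.warr 3 (by decide)))
      ((hag₅.warr 4 (by decide)).trans (hag₄.warr 4 (by decide)))
      ((hag₅.rarr 1 (by decide)).trans (hag₄.rarr 1 (by decide))))
    (fun v => by rw [hag₅.warr 5 (by decide)]; exact hranks v) (thr_mono _ _) hcells h7 z9 z10 hidle
    (by rw [wcarry 13 (by decide) (by decide) (by decide) (by decide) (by decide)]
        simp [initState])
    (by rw [wcarry 9 (by decide) (by decide) (by decide) (by decide) (by decide)]
        simp [initState])
    (by have : (L + 2) * (n * n + n) ≤ (n + 2) * (n * n + n) :=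
          Nat.mul_le_mul_right _ (by omega)
        omega)).mono ?_
  rintro t₆ s₆ hag₆ ⟨ht₆, out, hout, hlev, hlen⟩
  rw [runs_wset]
  refine ⟨s₂.wreg 4, s₂.wreg 5, L, hpar, hL, ?_, ?_, out, ⟨by simpa using hout.1, hout.2⟩, hlev,
    hlen⟩
  · rw [State.setWord_tossed, hag₆.tossed (by decide), hag₅.tossed (by decide), htoss]
  · have hsum : ∑ i ∈ Finset.range (L + 1), (300 * (l + 1) * searchWork G adj
        (hierarchy (fun v : Fin n => rank l ω v) (thr (s₂.wreg 4) (s₂.wreg 5)) L (i + 1))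
        (hierarchy (fun v : Fin n => rank l ω v) (thr (s₂.wreg 4) (s₂.wreg 5)) L i) +
        400 * (l + 1) * (n + 1)) =
        300 * (l + 1) * totalWork G es l (s₂.wreg 4) (s₂.wreg 5) L ω +
        (L + 1) * (400 * (l + 1) * (n + 1)) := by
      rw [Finset.sum_add_distrib, ← Finset.mul_sum]
      simp only [searchWork, totalWork, levels, hlinks.length_eq, listDegree, bothWays,
        Finset.sum_const, Finset.card_range, smul_eq_mul]
      congr!
    rw [hsum] at ht₆
    have hLn : (L + 1) * (400 * (l + 1) * (n + 1)) ≤ (l + 1) * (400 * (l + 1) * (n + 1)) :=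
      Nat.mul_le_mul_right _ (by omega)
    have hP : 1 * (l + 1) ≤ (l + 1) * ((l + 1) * (n + 1)) := by nlinarith
    have hQ : (l + 1) * (n + 1) ≤ (l + 1) * ((l + 1) * (n + 1)) := Nat.le_mul_of_pos_left _ (by omega)
    have hR : (l + 1) * (400 * (l + 1) * (n + 1)) = 400 * ((l + 1) * ((l + 1) * (n + 1))) := by ring
    have hS : 1000 * (n.log2 + 2) * (n.log2 + 2) * (n + 1) =
        1000 * ((l + 1) * ((l + 1) * (n + 1))) := by rw [hl]; ring
    have hT : 60 * (l + 1) * (n + 1) = 60 * ((l + 1) * (n + 1)) := by ring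
    rw [hS]
    rw [hT] at ht₄
    rw [hR] at hLn
    have hl2 : n.log2 + 2 = l + 1 := by omega
    rw [hl2] at ht₁ ⊢
    simp only [WExp.cost]
    omega

/-! ### The output -/

namespace WGraph

variable (G : WGraph n)

/-- The graph with the listed edges, weighted by the distances in `G`. -/
noncomputable def ofList (out : List (Fin n × Fin n × ℝ))
    (h : ∀ e ∈ out, G.graph.Reachable e.1 e.2.1 ∧ e.1 ≠ e.2.1 ∧ e.2.2 = G.rdist e.1 e.2.1) :
    WGraph n where
  graph :=
    { Adj u v := ∃ w, (u, v, w) ∈ out ∨ (v, u, w) ∈ out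
      symm := ⟨fun _ _ ⟨w, hw⟩ => ⟨w, hw.symm⟩⟩
      loopless := ⟨fun u ⟨w, hw⟩ => by rcases hw with hw | hw <;> exact (h _ hw).2.1 rfl⟩ }
  weight := Sym2.lift ⟨G.rdist, G.rdist_comm⟩
  weight_pos e he := by
    induction e with
    | _ u v =>
      obtain ⟨w, hw | hw⟩ := he
      · exact G.rdist_pos (h _ hw).1 (h _ hw).2.1
      · exact G.rdist_pos (h _ hw).1.symm (h _ hw).2.1.symm

variable {G} {out : List (Fin n × Fin n × ℝ)}
  {h : ∀ e ∈ out, G.graph.Reachable e.1 e.2.1 ∧ e.1 ≠ e.2.1 ∧ e.2.2 = G.rdist e.1 e.2.1}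

/-- A pair may be listed repeatedly and in both orientations, but always with the same weight, its
distance. -/
theorem ofList_isListedBy : (G.ofList out h).IsListedBy out := by
  intro u v x
  constructor
  · rintro (hx | hx)
    · exact ⟨⟨x, .inl hx⟩, (h _ hx).2.2.symm⟩
    · exact ⟨⟨x, .inr hx⟩, (G.rdist_comm _ _).trans (h _ hx).2.2.symm⟩
  · rintro ⟨⟨w, hw⟩, rfl⟩
    rcases hw with hw | hw
    · have hw' : w = G.rdist u v := (h _ hw).2.2
      exact .inl (show (u, v, G.rdist u v) ∈ out from hw' ▸ hw)
    · have hw' : w = G.rdist u v := (h _ hw).2.2.trans (G.rdist_comm _ _)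
      exact .inr (show (v, u, G.rdist u v) ∈ out from hw' ▸ hw)

theorem ofList_distWeighted : G.DistWeighted (G.ofList out h) := by
  rintro u v ⟨w, hw | hw⟩
  · exact ⟨(h _ hw).1, rfl⟩
  · exact ⟨(h _ hw).1.symm, rfl⟩

theorem ofList_numEdges_le : (G.ofList out h).numEdges ≤ out.length := by
  classical
  have hsub : (G.ofList out h).graph.edgeSet ⊆
      ((out.map fun e => s(e.1, e.2.1)).toFinset : Set (Sym2 (Fin n))) := by
    intro e he
    induction e with
    | _ u v =>
      obtain ⟨w, hw | hw⟩ := he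
      · simp only [List.coe_toFinset, List.mem_map, Set.mem_ofPred_eq]
        exact ⟨_, hw, rfl⟩
      · simp only [List.coe_toFinset, List.mem_map, Set.mem_ofPred_eq]
        exact ⟨_, hw, Sym2.eq_swap⟩
  refine (Set.ncard_le_ncard hsub).trans ?_
  rw [Set.ncard_coe_finset]
  exact (List.toFinset_card_le _).trans (by simp)

theorem ofList_isHopset {l a b L L' N : ℕ} {ω : ℕ → Bool}
    (hlev : ∀ i ≤ L, LevelOut G (levels n l a b L ω (i + 1)) (levels n l a b L ω i) out)
    (hL : L ≤ L') (hN : 0 < N) (hN8 : 8 * (L' : ℝ) ≤ N) {ε : ℝ} (hε : 8 * (L' : ℝ) / N ≤ ε) :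
    IsHopset ((5 * N) ^ L') ε G (G.ofList out h) := by
  refine isHopset_of_hierarchy ofList_distWeighted (levels n l a b L ω)
    (fun x => ⟨Nat.zero_le _, Nat.zero_le _⟩) (fun i x hx y hy hxy => ?_)
    (fun x hx => by have := hx.1; omega) hN hN8 hε
  -- Membership in the `i`-th set includes `i ≤ L`; the levels between `L` and `L'` are empty and
  -- impose no condition.
  refine ((hlev i hx.1).complete x hx y hy hxy).imp_right (Or.imp ?_ ?_)
  · rintro ⟨w, hw⟩
    exact ⟨w, .inr hw⟩
  · rintro ⟨z, hz, h1, h2⟩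
    exact ⟨z, hz, h1.imp_right fun ⟨w, hw⟩ => ⟨w, .inl hw⟩, h2⟩

end WGraph

/-- The program finds `a` and `b` at run time. Uniqueness shows that they are the same for all coin
tosses, so expectations can be taken with fixed parameters. -/
theorem Params.unique {κ ρ : ℝ} {l a b a' b' : ℕ} (hκ : 0 < κ) (h : Params κ ρ l a b)
    (h' : Params κ ρ l a' b') : a = a' ∧ b = b' := by
  have key : ∀ {a b a' b' : ℕ}, Params κ ρ l a b → Params κ ρ l a' b' → a ≤ a' ∧ b ≤ b' := by
    intro a b a' b' h h'
    constructor
    · have h1 := h.mul_lt.trans_le h'.le_mul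
      have h2 := lt_of_mul_lt_mul_right h1 hκ.le
      have : (a : ℝ) < a' + 1 := by linarith
      exact Nat.lt_succ_iff.1 (by exact_mod_cast this)
    · have : (b : ℝ) < b' + 1 := h.b_lt.trans_le (by linarith [h'.le_b])
      exact Nat.lt_succ_iff.1 (by exact_mod_cast this)
  exact ⟨le_antisymm (key h h').1 (key h' h).1, le_antisymm (key h h').2 (key h' h).2⟩

theorem LastLevel.unique {l a b L L' : ℕ} (h : LastLevel l a b L) (h' : LastLevel l a b L') :
    L = L' := by
  rcases lt_trichotomy L L' with hlt | heq | hlt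
  · have := h'.lt L hlt; have := h.le; omega
  · exact heq
  · have := h.lt L' hlt; have := h'.le; omega

end Hopset

/-! ### Probability: independence of ranks, expected work and expected size. -/

namespace Hopset

variable {n : ℕ}

/-! ### Coin tosses -/

instance : IsProbabilityMeasure coinMeasure := by
  unfold coinMeasure
  infer_instance

/-- Such a function factors through the finite discrete space `T → Bool`. -/
theorem measurable_of_dependsOn {β : Type*} [MeasurableSpace β] {f : (ℕ → Bool) → β} {T : Finset ℕ}
    (hf : DependsOn f T) : Measurable f := by
  classical
  have hfac : f = (fun y : T → Bool => f fun i => if h : i ∈ T then y ⟨i, h⟩ else false) ∘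
      fun ω i => ω i := by
    funext ω
    exact hf fun i hi => by simp [Finset.mem_coe.1 hi]
  rw [hfac]
  exact (Measurable.of_discrete).comp (measurable_pi_lambda _ fun i => measurable_pi_apply _)

theorem measurableSet_of_dependsOn {R : Set (ℕ → Bool)} {T : Finset ℕ}
    (hR : DependsOn (· ∈ R) T) : MeasurableSet R :=
  measurableSet_setOfPred.2 (measurable_of_dependsOn hR)

theorem coinMeasure_heads (B : Finset ℕ) :
    coinMeasure {ω | ∀ i ∈ B, ω i = true} = (2 ^ B.card)⁻¹ := by
  have : {ω : ℕ → Bool | ∀ i ∈ B, ω i = true} = Set.pi B fun _ => {true} := by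
    ext ω; simp
  rw [this, coinMeasure, Measure.infinitePi_pi _ fun _ _ => measurableSet_singleton _]
  simp [ENNReal.inv_pow]

theorem coinMeasure_heads_inter {B T : Finset ℕ} (hd : Disjoint B T) {R : Set (ℕ → Bool)}
    (hR : DependsOn (· ∈ R) T) :
    coinMeasure ({ω | ∀ i ∈ B, ω i = true} ∩ R) = (2 ^ B.card)⁻¹ * coinMeasure R := by
  classical
  have hind : ProbabilityTheory.iIndepFun (fun (i : ℕ) (ω : ℕ → Bool) => ω i) coinMeasure :=
    ProbabilityTheory.iIndepFun_infinitePi (X := fun _ b => b) fun _ => measurable_id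
  have h := hind.indepFun_finset B T hd fun i => measurable_pi_apply i
  rw [ProbabilityTheory.indepFun_iff_measure_inter_preimage_eq_mul] at h
  have h' := h {y | ∀ i, y i = true}
    {y | (fun i => if h : i ∈ T then y ⟨i, h⟩ else false) ∈ R} .of_discrete .of_discrete
  have e1 : (fun (ω : ℕ → Bool) (i : B) => ω i) ⁻¹' {y | ∀ i, y i = true} =
      {ω | ∀ i ∈ B, ω i = true} := by
    ext ω; simp
  have e2 : (fun (ω : ℕ → Bool) (i : T) => ω i) ⁻¹'
      {y | (fun i => if h : i ∈ T then y ⟨i, h⟩ else false) ∈ R} = R := by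
    ext ω
    exact iff_of_eq (hR fun i hi => by simp [Finset.mem_coe.1 hi])
  rw [e1, e2, coinMeasure_heads] at h'
  exact h'

/-! ### Ranks -/

/-- The coins that determine the ranks of the vertices in `U`. -/
def coins (l : ℕ) (U : Finset (Fin n)) : Finset ℕ :=
  U.biUnion fun u => Finset.Ico (u * l) (u * l + l)

theorem le_rank_iff {l J : ℕ} (hJ : J ≤ l) (ω : ℕ → Bool) (u : ℕ) :
    J ≤ rank l ω u ↔ ∀ i ∈ Finset.Ico (u * l) (u * l + J), ω i = true := by
  rw [rank, le_lead_iff _ hJ]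
  constructor
  · intro h i hi
    rw [Finset.mem_Ico] at hi
    simpa [Nat.add_sub_cancel' hi.1] using h (i - u * l) (by omega)
  · exact fun h i hi => h _ (Finset.mem_Ico.2 ⟨by omega, by omega⟩)

theorem lead_congr {c c' : ℕ → Bool} {t : ℕ} (h : ∀ i < t, c i = c' i) : lead c t = lead c' t := by
  refine eq_of_forall_le_iff fun j => ?_
  by_cases hj : j ≤ t
  · rw [le_lead_iff _ hj, le_lead_iff _ hj]
    exact forall₂_congr fun i hi => by rw [h i (by omega)]
  · have := lead_le c t
    have := lead_le c' t
    exact iff_of_false (by omega) (by omega)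

theorem rank_congr {l : ℕ} {U : Finset (Fin n)} {ω ω' : ℕ → Bool}
    (h : ∀ i ∈ (coins l U : Set ℕ), ω i = ω' i) {u : Fin n} (hu : u ∈ U) :
    rank l ω u = rank l ω' u :=
  lead_congr fun i hi => h _ (Finset.mem_coe.2 (Finset.mem_biUnion.2
    ⟨u, hu, Finset.mem_Ico.2 ⟨by omega, by omega⟩⟩))

/-- The block of coins of `u` is disjoint from those of the vertices in `U`. -/
theorem coinMeasure_le_rank_inter {l J : ℕ} (hJ : J ≤ l) {u : Fin n} {U : Finset (Fin n)}
    (hu : u ∉ U) {R : Set (ℕ → Bool)} (hR : DependsOn (· ∈ R) (coins l U)) :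
    coinMeasure ({ω | J ≤ rank l ω u} ∩ R) = (2 ^ J)⁻¹ * coinMeasure R := by
  have hd : Disjoint (Finset.Ico (u * l) (u * l + J)) (coins l U) := by
    rw [coins, Finset.disjoint_biUnion_right]
    intro w hw
    rw [Finset.disjoint_left]
    intro i hi hi'
    rw [Finset.mem_Ico] at hi hi'
    rcases lt_trichotomy (u : ℕ) w with h | h | h
    · have := Nat.mul_le_mul_right l h
      rw [Nat.succ_mul] at this
      omega
    · exact hu (Fin.ext h ▸ hw)
    · have := Nat.mul_le_mul_right l h
      rw [Nat.succ_mul] at this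
      omega
  have := coinMeasure_heads_inter hd hR
  simp only [← le_rank_iff hJ, Nat.card_Ico, Nat.add_sub_cancel_left] at this
  exact this

theorem coinMeasure_le_rank {l J : ℕ} (hJ : J ≤ l) (u : Fin n) :
    coinMeasure {ω | J ≤ rank l ω u} = (2 ^ J)⁻¹ := by
  have := coinMeasure_le_rank_inter (U := ∅) hJ (u := u) (by simp) (R := Set.univ)
    (fun _ _ _ => by simp)
  simpa using this

/-- The vertex `w` comes before `u` in the order of the keys `f`. -/
def Before (f : Fin n → ℝ) (w u : Fin n) : Prop := f w < f u ∨ f w = f u ∧ w < u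

theorem Before.trichotomy (f : Fin n → ℝ) {w u : Fin n} (h : w ≠ u) : Before f w u ∨ Before f u w := by
  rcases lt_trichotomy (f w) (f u) with h1 | h1 | h1
  · exact .inl (.inl h1)
  · exact (lt_or_gt_of_ne h).imp (fun h => .inr ⟨h1, h⟩) fun h => .inr ⟨h1.symm, h⟩
  · exact .inr (.inl h1)

theorem Before.irrefl {f : Fin n → ℝ} {u : Fin n} : ¬ Before f u u := by
  simp [Before]

/-- The vertex `u` has rank at least `J`, and no vertex before it has rank at least `J'`. -/
def firstEvent (l J J' : ℕ) (f : Fin n → ℝ) (U : Finset (Fin n)) (u : Fin n) : Set (ℕ → Bool) :=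
  {ω | J ≤ rank l ω u ∧ ∀ w ∈ U, Before f w u → rank l ω w < J'}

variable {l J J' : ℕ} {f : Fin n → ℝ} {U : Finset (Fin n)}

theorem dependsOn_firstEvent {u : Fin n} (hu : u ∈ U) :
    DependsOn (· ∈ firstEvent l J J' f U u) (coins l U) := by
  intro ω ω' h
  simp only [firstEvent, Set.mem_ofPred_eq, eq_iff_iff]
  rw [rank_congr h hu]
  exact and_congr_right fun _ => forall₂_congr fun w hw => by rw [rank_congr h hw]

/-- The second condition involves only vertices strictly before `u`, never `u` itself, and is
independent of the rank of `u`. -/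
theorem coinMeasure_firstEvent (hJ : J ≤ l) {u : Fin n} :
    coinMeasure (firstEvent l J J' f U u) =
      (2 ^ J)⁻¹ * coinMeasure {ω | ∀ w ∈ U, Before f w u → rank l ω w < J'} := by
  classical
  rw [← coinMeasure_le_rank_inter hJ (u := u) (U := U.erase u) (by simp)]
  · rfl
  · intro ω ω' h
    simp only [Set.mem_ofPred_eq, eq_iff_iff]
    refine forall₃_congr fun w hw hwu => ?_
    have hne : w ≠ u := fun hne => Before.irrefl (hne ▸ hwu)
    rw [rank_congr h (Finset.mem_erase.2 ⟨hne, hw⟩)]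

/-- Raising the requirement on `u` from `J` to `J'` multiplies each probability by the same factor
`2 ^ (-(J' - J))`. After that the events say that `u` is the first vertex of rank at least `J'`;
they are disjoint, and their probabilities sum to at most `1`. -/
theorem sum_coinMeasure_firstEvent (hJ : J ≤ J') (hJ' : J' ≤ l) :
    ∑ u ∈ U, coinMeasure (firstEvent l J J' f U u) ≤ 2 ^ (J' - J) := by
  have h1 : ∀ u, coinMeasure (firstEvent l J J' f U u) =
      2 ^ (J' - J) * coinMeasure (firstEvent l J' J' f U u) := fun u => by
    rw [coinMeasure_firstEvent (hJ.trans hJ'), coinMeasure_firstEvent hJ', ← mul_assoc]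
    congr 1
    obtain ⟨d, rfl⟩ := Nat.exists_eq_add_of_le hJ
    rw [Nat.add_sub_cancel_left, pow_add, ENNReal.mul_inv (by simp) (by simp), mul_comm, mul_assoc,
      ENNReal.inv_mul_cancel (by simp) (by simp), mul_one]
  have h2 : ∑ u ∈ U, coinMeasure (firstEvent l J' J' f U u) ≤ 1 := by
    rw [← measure_biUnion_finset]
    · exact prob_le_one
    · intro u hu w hw huw
      refine Set.disjoint_left.2 fun ω h h' => ?_
      rcases Before.trichotomy f huw with hb | hb
      · exact absurd h.1 (not_le.2 (h'.2 u hu hb))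
      · exact absurd h'.1 (not_le.2 (h.2 w hw hb))
    · exact fun u hu => measurableSet_of_dependsOn (dependsOn_firstEvent hu)
  calc ∑ u ∈ U, coinMeasure (firstEvent l J J' f U u)
      = 2 ^ (J' - J) * ∑ u ∈ U, coinMeasure (firstEvent l J' J' f U u) := by
        rw [Finset.mul_sum]; exact Finset.sum_congr rfl fun u _ => h1 u
    _ ≤ 2 ^ (J' - J) * 1 := by gcongr
    _ = _ := mul_one _

end Hopset

namespace Hopset

variable {n : ℕ}

/-! ### Expected work and size -/

theorem levels_congr {l a b L : ℕ} {ω ω' : ℕ → Bool}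
    (h : ∀ i ∈ (coins l (Finset.univ : Finset (Fin n)) : Set ℕ), ω i = ω' i) :
    levels n l a b L ω = levels n l a b L ω' := by
  have : ∀ v : Fin n, rank l ω v = rank l ω' v := fun v => rank_congr h (Finset.mem_univ v)
  simp only [levels, this]

theorem dependsOn_levels {β : Type*} (l a b L : ℕ) (F : (ℕ → Set (Fin n)) → β) :
    DependsOn (fun ω => F (levels n l a b L ω)) (coins l (Finset.univ : Finset (Fin n))) :=
  fun _ _ h => by simp only [levels_congr h]

theorem measurable_levels {β : Type*} [MeasurableSpace β] (l a b L : ℕ)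
    (F : (ℕ → Set (Fin n)) → β) : Measurable fun ω => F (levels n l a b L ω) :=
  measurable_of_dependsOn (dependsOn_levels l a b L F)

theorem lintegral_sum_natCast {ι : Type*} {s : Finset ι} {f : ι → (ℕ → Bool) → ℕ}
    (hf : ∀ x ∈ s, Measurable (f x)) :
    ∫⁻ ω, ((∑ x ∈ s, f x ω : ℕ) : ℝ≥0∞) ∂coinMeasure =
      ∑ x ∈ s, ∫⁻ ω, (f x ω : ℝ≥0∞) ∂coinMeasure := by
  push_cast
  exact lintegral_finsetSum' _ fun x hx => (measurable_from_nat.comp (hf x hx)).aemeasurable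

open Classical in
theorem lintegral_ite {R : Set (ℕ → Bool)} (hR : MeasurableSet R) (c : ℕ) :
    ∫⁻ ω, ((if ω ∈ R then c else 0 : ℕ) : ℝ≥0∞) ∂coinMeasure = c * coinMeasure R := by
  rw [← lintegral_indicator_const hR]
  refine lintegral_congr fun ω => ?_
  by_cases h : ω ∈ R <;> simp [h]

theorem natCast_mul_inv_le {m p q : ℕ} (h : m ≤ 2 ^ (p + q)) :
    (m : ℝ≥0∞) * (2 ^ p)⁻¹ ≤ 2 ^ q := by
  rw [← div_eq_mul_inv]
  refine ENNReal.div_le_of_le_mul ?_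
  rw [← pow_add, add_comm]
  exact_mod_cast h

variable {G : WGraph n} {l a b L : ℕ}

/-- The vertex `v` is in the cluster of the vertex `u` on level `i`. -/
def clusterEvent (G : WGraph n) (l a b L i : ℕ) (u v : Fin n) : Set (ℕ → Bool) :=
  {ω | u ∈ levels n l a b L ω i ∧ v ∈ G.cluster (levels n l a b L ω (i + 1)) u}

theorem measurableSet_clusterEvent (i : ℕ) (u v : Fin n) :
    MeasurableSet (clusterEvent G l a b L i u v) :=
  measurableSet_setOfPred.2 (measurable_levels l a b L fun A => u ∈ A i ∧ v ∈ G.cluster (A (i + 1)) u)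

/-- A vertex before `u`, in the order of the distances to `v`, that reached the next set would be at
least as near to `v` as `u` and expel `v` from the cluster. -/
theorem clusterEvent_subset {i : ℕ} (hi : i < L) {u v : Fin n} {U : Finset (Fin n)}
    (hU : ∀ w ∈ U, G.graph.Reachable w v) :
    clusterEvent G l a b L i u v ⊆
      firstEvent l (thr a b i) (thr a b (i + 1)) (G.rdist · v) U u := by
  rintro ω ⟨h1, h2⟩
  refine ⟨h1.2, fun w hw hb => ?_⟩
  by_contra hge
  have h3 := h2.2 w ⟨hi, not_lt.1 hge⟩ (hU w hw)
  rcases hb with hb | ⟨hb, -⟩ <;> linarith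

open Classical in
/-- The bound on the expected number of clusters that contain a given vertex. -/
noncomputable def overlap (a b L i : ℕ) : ℕ :=
  if i < L then 2 ^ min (thr a b i + a) b else 2 ^ (b + 2)

/-- Below the top the bound is the inverse of the sampling probability. At the top there is no
pruning, and all `n * 2 ^ (-thr a b L)` expected members count; the stopping rule for thresholds
makes this at most `2 ^ (b + 2)`. -/
theorem sum_clusterEvent_le (hL : LastLevel l a b L) (hn : n ≤ 2 ^ l) {i : ℕ} (hi : i ≤ L)
    (v : Fin n) : ∑ u, coinMeasure (clusterEvent G l a b L i u v) ≤ overlap a b L i := by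
  classical
  have hthr : thr a b i ≤ l := (thr_mono a b hi).trans hL.thr_le
  rw [overlap]
  split_ifs with h
  · calc ∑ u, coinMeasure (clusterEvent G l a b L i u v)
        = ∑ u with G.graph.Reachable u v, coinMeasure (clusterEvent G l a b L i u v) := by
          rw [Finset.sum_filter_of_ne]
          intro u _ hu
          by_contra hr
          refine hu ?_
          convert measure_empty (μ := coinMeasure)
          exact Set.eq_empty_of_forall_notMem fun ω hω => hr hω.2.1
      _ ≤ ∑ u with G.graph.Reachable u v, coinMeasure (firstEvent l (thr a b i) (thr a b (i + 1))
            (G.rdist · v) (Finset.univ.filter (G.graph.Reachable · v)) u) :=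
          Finset.sum_le_sum fun u _ => measure_mono
            (clusterEvent_subset h fun w hw => (Finset.mem_filter.1 hw).2)
      _ ≤ 2 ^ (thr a b (i + 1) - thr a b i) := sum_coinMeasure_firstEvent
            (thr_mono a b (Nat.le_succ i)) ((thr_mono a b h).trans hL.thr_le)
      _ = _ := by
          rw [thr, Nat.add_sub_cancel_left]
          push_cast
          rfl
  · obtain rfl : i = L := by omega
    calc ∑ u, coinMeasure (clusterEvent G l a b i i u v)
        ≤ ∑ u : Fin n, coinMeasure {ω | thr a b i ≤ rank l ω u} :=
          Finset.sum_le_sum fun u _ => measure_mono fun ω hω => hω.1.2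
      _ = n * (2 ^ thr a b i)⁻¹ := by
          rw [Finset.sum_congr rfl fun u _ => coinMeasure_le_rank hthr u]
          simp
      _ ≤ 2 ^ (b + 2) := natCast_mul_inv_le (hn.trans (Nat.pow_le_pow_right (by norm_num)
            (hL.le.trans (by omega))))
      _ = _ := by push_cast; rfl

/-- Double counting: each vertex is charged its degree plus one for every cluster that contains it.
-/
theorem lintegral_totalWork_le (hL : LastLevel l a b L) (hn : n ≤ 2 ^ l)
    (es : List (Fin n × Fin n × ℝ)) :
    ∫⁻ ω, (totalWork G es l a b L ω : ℝ≥0∞) ∂coinMeasure ≤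
      ((∑ i ∈ Finset.range (L + 1), overlap a b L i) * (2 * es.length + n) : ℕ) := by
  classical
  have h1 : ∀ ω, totalWork G es l a b L ω = ∑ i ∈ Finset.range (L + 1), ∑ v, ∑ u,
      if ω ∈ clusterEvent G l a b L i u v then listDegree es v + 1 else 0 := fun ω => by
    refine Finset.sum_congr rfl fun i _ => ?_
    rw [Finset.sum_comm, Finset.sum_filter]
    refine Finset.sum_congr rfl fun u _ => ?_
    split_ifs with hu
    · rw [Finset.sum_filter]
      exact Finset.sum_congr rfl fun v _ => if_congr (by simp [clusterEvent, hu]) rfl rfl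
    · exact (Finset.sum_eq_zero fun v _ => if_neg fun h => hu h.1).symm
  have hm : ∀ i v u, Measurable fun ω =>
      if ω ∈ clusterEvent G l a b L i u v then listDegree es v + 1 else 0 := fun i v u =>
    measurable_const.ite (measurableSet_clusterEvent i u v) measurable_const
  simp only [h1]
  rw [lintegral_sum_natCast fun i _ => Finset.measurable_sum _ fun v _ =>
    Finset.measurable_sum _ fun u _ => hm i v u, Finset.sum_mul, Nat.cast_sum]
  refine Finset.sum_le_sum fun i hi => ?_
  rw [lintegral_sum_natCast fun v _ => Finset.measurable_sum _ fun u _ => hm i v u]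
  have h2 : 2 * es.length + n = ∑ v : Fin n, (listDegree es v + 1) := by
    rw [Finset.sum_add_distrib, sum_listDegree]; simp
  rw [h2, Finset.mul_sum, Nat.cast_sum]
  refine Finset.sum_le_sum fun v _ => ?_
  rw [lintegral_sum_natCast fun u _ => hm i v u,
    Finset.sum_congr rfl fun u _ => lintegral_ite (measurableSet_clusterEvent i u v) _,
    ← Finset.mul_sum, mul_comm, Nat.cast_mul]
  gcongr
  exact sum_clusterEvent_le hL hn (by simpa [Nat.lt_succ_iff] using hi) v

/-- The vertex `v` of level `i` is in the cluster of the vertex `u` on that level. -/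
def pairEvent (G : WGraph n) (l a b L i : ℕ) (u v : Fin n) : Set (ℕ → Bool) :=
  {ω | thr a b i ≤ rank l ω v} ∩ clusterEvent G l a b L i u v

theorem measurableSet_le_rank (J : ℕ) (v : Fin n) : MeasurableSet {ω | J ≤ rank l ω v} :=
  measurableSet_of_dependsOn (T := coins l {v}) fun ω ω' h => by
    simp only [Set.mem_ofPred_eq, rank_congr h (Finset.mem_singleton_self v)]

theorem measurableSet_pairEvent (i : ℕ) (u v : Fin n) :
    MeasurableSet (pairEvent G l a b L i u v) :=
  (measurableSet_le_rank _ v).inter (measurableSet_clusterEvent i u v)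

/-- With `v` removed from the competing vertices, its own rank is independent of the events and
contributes `2 ^ (-thr a b i)`. Since the gap to the next threshold is at most `thr a b i + a`, the
product is at most `2 ^ a`. -/
theorem sum_pairEvent_le (hL : LastLevel l a b L) {i : ℕ} (hi : i < L) (v : Fin n) :
    ∑ u with u ≠ v, coinMeasure (pairEvent G l a b L i u v) ≤ 2 ^ a := by
  classical
  have hthr : thr a b i ≤ l := (thr_mono a b hi.le).trans hL.thr_le
  set U : Finset (Fin n) := (Finset.univ.filter (· ≠ v)).filter (G.graph.Reachable · v) with hU
  calc ∑ u with u ≠ v, coinMeasure (pairEvent G l a b L i u v)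
      = ∑ u ∈ U, coinMeasure (pairEvent G l a b L i u v) := by
        rw [hU]
        refine (Finset.sum_filter_of_ne fun u _ hu => ?_).symm
        by_contra hr
        refine hu ?_
        convert measure_empty (μ := coinMeasure)
        exact Set.eq_empty_of_forall_notMem fun ω hω => hr hω.2.2.1
    _ ≤ ∑ u ∈ U, (2 ^ thr a b i)⁻¹ * coinMeasure (firstEvent l (thr a b i) (thr a b (i + 1))
          (G.rdist · v) U u) := by
        refine Finset.sum_le_sum fun u hu => ?_
        rw [← coinMeasure_le_rank_inter hthr (u := v) (by simp [hU]) (dependsOn_firstEvent hu)]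
        exact measure_mono (Set.inter_subset_inter_right _
          (clusterEvent_subset hi fun w hw => (Finset.mem_filter.1 hw).2))
    _ ≤ (2 ^ thr a b i)⁻¹ * 2 ^ (thr a b (i + 1) - thr a b i) := by
        rw [← Finset.mul_sum]
        gcongr
        exact sum_coinMeasure_firstEvent (thr_mono a b (Nat.le_succ i))
          ((thr_mono a b hi).trans hL.thr_le)
    _ ≤ 2 ^ a := by
        rw [mul_comm, thr, Nat.add_sub_cancel_left]
        have := natCast_mul_inv_le (m := 2 ^ min (thr a b i + a) b) (p := thr a b i) (q := a)
          (Nat.pow_le_pow_right (by norm_num) (min_le_left _ _))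
        exact_mod_cast this

/-- On the top level all pairs may be joined, so the bound is the square of the expected size of
that set, by independence of two distinct vertices. -/
theorem sum_sum_pairEvent_le (hL : LastLevel l a b L) (hn : n ≤ 2 ^ l) :
    ∑ v, ∑ u with u ≠ v, coinMeasure (pairEvent G l a b L L u v) ≤ 2 ^ (b + 2) * 2 ^ (b + 2) := by
  classical
  have hthr : thr a b L ≤ l := hL.thr_le
  have hle : (n : ℝ≥0∞) * (2 ^ thr a b L)⁻¹ ≤ 2 ^ (b + 2) := natCast_mul_inv_le
    (hn.trans (Nat.pow_le_pow_right (by norm_num) (hL.le.trans (by omega))))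
  calc ∑ v, ∑ u with u ≠ v, coinMeasure (pairEvent G l a b L L u v)
      ≤ ∑ _v : Fin n, ∑ _u : Fin n, ((2 ^ thr a b L)⁻¹ * (2 ^ thr a b L)⁻¹ : ℝ≥0∞) := by
        refine Finset.sum_le_sum fun v _ => ?_
        refine (Finset.sum_le_sum fun u hu => ?_).trans
          (Finset.sum_le_sum_of_subset (Finset.filter_subset _ _))
        have hne : u ≠ v := (Finset.mem_filter.1 hu).2
        have hind := coinMeasure_le_rank_inter hthr (u := v) (U := {u}) (by simpa using hne.symm)
          (R := {ω | thr a b L ≤ rank l ω u}) fun ω ω' h => by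
            simp only [Set.mem_ofPred_eq, rank_congr h (Finset.mem_singleton_self u)]
        rw [coinMeasure_le_rank hthr u] at hind
        rw [← hind]
        exact measure_mono fun ω hω => ⟨hω.1, hω.2.1.2⟩
    _ = (n * (2 ^ thr a b L)⁻¹) * (n * (2 ^ thr a b L)⁻¹) := by
        simp
        ring
    _ ≤ _ := by gcongr

theorem lintegral_numPairs (i : ℕ) :
    ∫⁻ ω, (numPairs G (levels n l a b L ω (i + 1)) (levels n l a b L ω i) : ℝ≥0∞) ∂coinMeasure ≤
      ∑ v, ∑ u with u ≠ v, coinMeasure (pairEvent G l a b L i u v) := by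
  classical
  have h1 : ∀ ω, numPairs G (levels n l a b L ω (i + 1)) (levels n l a b L ω i) ≤
      ∑ v, ∑ u with u ≠ v, if ω ∈ pairEvent G l a b L i u v then 1 else 0 := fun ω => by
    rw [numPairs]
    simp only [Finset.card_eq_sum_ones, Finset.sum_filter]
    rw [Finset.sum_comm]
    refine Finset.sum_le_sum fun u _ => ?_
    split_ifs with hu
    · refine Finset.sum_le_sum fun v _ => ?_
      split_ifs with h2 h3 h4 h5 <;> first | exact Nat.zero_le _ | exact le_rfl | skip
      · exact absurd ⟨h3.2.2, hu, h2⟩ h5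
      · exact absurd h3.1.symm h4
    · exact Nat.zero_le _
  have hm : ∀ v u, Measurable fun ω => if ω ∈ pairEvent G l a b L i u v then 1 else 0 := fun v u =>
    measurable_const.ite (measurableSet_pairEvent i u v) measurable_const
  refine (lintegral_mono fun ω => Nat.cast_le.2 (h1 ω)).trans_eq ?_
  rw [lintegral_sum_natCast fun v _ => Finset.measurable_sum _ fun u _ => hm v u]
  refine Finset.sum_congr rfl fun v _ => ?_
  rw [lintegral_sum_natCast fun u _ => hm v u]
  refine Finset.sum_congr rfl fun u _ => ?_
  rw [lintegral_ite (measurableSet_pairEvent i u v)]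
  simp

/-- The three terms are the cluster edges below the top, those at the top, and at most `n` pivot
edges per level. -/
theorem lintegral_totalSize_le (hL : LastLevel l a b L) (hn : n ≤ 2 ^ l) :
    ∫⁻ ω, (totalSize G l a b L ω : ℝ≥0∞) ∂coinMeasure ≤
      (L * (n * 2 ^ a) + 2 ^ (b + 2) * 2 ^ (b + 2) + (L + 1) * n : ℕ) := by
  classical
  have h1 : ∀ ω, totalSize G l a b L ω ≤ ∑ i ∈ Finset.range (L + 1),
      numPairs G (levels n l a b L ω (i + 1)) (levels n l a b L ω i) + (L + 1) * n := fun ω => by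
    rw [totalSize]
    simp only [levelSize, Finset.sum_add_distrib]
    gcongr
    refine (Finset.sum_le_card_nsmul _ _ n fun i _ => (Finset.card_le_univ _).trans ?_).trans ?_
    · simp
    · simp
  have hm : ∀ i, Measurable fun ω =>
      numPairs G (levels n l a b L ω (i + 1)) (levels n l a b L ω i) := fun i =>
    measurable_levels l a b L fun A => numPairs G (A (i + 1)) (A i)
  refine (lintegral_mono fun ω => Nat.cast_le.2 (h1 ω)).trans ?_
  simp only [Nat.cast_add]
  rw [lintegral_add_right _ measurable_const, lintegral_sum_natCast fun i _ => hm i,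
    Finset.sum_range_succ, lintegral_const, measure_univ, mul_one]
  gcongr
  · refine (Finset.sum_le_card_nsmul _ _ ((n * 2 ^ a : ℕ) : ℝ≥0∞) fun i hi => ?_).trans ?_
    · refine (lintegral_numPairs i).trans ((Finset.sum_le_card_nsmul _ _ (2 ^ a) fun v _ =>
        sum_pairEvent_le hL (Finset.mem_range.1 hi) v).trans ?_)
      simp
    · simp
  · refine (lintegral_numPairs L).trans ((sum_sum_pairEvent_le hL hn).trans ?_)
    push_cast
    rfl

end Hopset

/-! ### Estimates for the parameters, the hopbound, and measurable choice of runs. -/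

namespace Hopset

variable {n : ℕ}

/-! ### The parameters -/

/-- An amortised bound. While `thr + a` is below `b`, the summands at least double and the last one
pays for the sum. Afterwards each summand is `2 ^ b` and is paid for by the growth of the threshold
by `b`. -/
theorem mul_sum_two_pow_le {a : ℕ} (ha : 1 ≤ a) (b L : ℕ) :
    b * ∑ i ∈ Finset.range L, 2 ^ min (thr a b i + a) b ≤
      b * 2 ^ min (thr a b L + a) b + thr a b L * 2 ^ b := by
  induction L with
  | zero => simp
  | succ L ih =>
    rw [Finset.sum_range_succ, Nat.mul_add, thr]
    rcases lt_or_ge (thr a b L + a) b with h | h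
    · rw [min_eq_left h.le] at ih ⊢
      have h1 : b * 2 ^ (thr a b L + a) + b * 2 ^ (thr a b L + a) ≤
          b * 2 ^ min (thr a b L + (thr a b L + a) + a) b := by
        rw [← mul_add, ← two_mul, ← pow_succ']
        exact Nat.mul_le_mul_left _ (Nat.pow_le_pow_right (by norm_num)
          (le_min (by omega) (by omega)))
      have h2 : thr a b L * 2 ^ b ≤ (thr a b L + (thr a b L + a)) * 2 ^ b :=
        Nat.mul_le_mul_right _ (by omega)
      omega
    · rw [min_eq_right h] at ih ⊢
      rw [min_eq_right (by omega), add_mul]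
      omega

theorem Params.b_pos {κ ρ : ℝ} {l a b : ℕ} (h : Params κ ρ l a b) (hρ : 0 < ρ) (hl : 0 < l) :
    1 ≤ b := by
  have h1 : (0 : ℝ) < ρ * l := mul_pos hρ (by exact_mod_cast hl)
  have h2 : (0 : ℝ) < b := h1.trans_le h.le_b
  exact_mod_cast h2

/-- Because thresholds never exceed `l ≤ b / ρ`, the sum over the levels costs a factor `O(1 / ρ)`
without any `log κ`. Of the `5`, the top level accounts for `4`. -/
theorem sum_overlap_le {κ ρ : ℝ} {l a b L : ℕ} (h : Params κ ρ l a b) (hL : LastLevel l a b L)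
    (hρ : 0 < ρ) (hl : 0 < l) :
    ((∑ i ∈ Finset.range (L + 1), overlap a b L i : ℕ) : ℝ) ≤ 2 ^ b * (5 + 1 / ρ) := by
  have hb := h.b_pos hρ hl
  have hb0 : (0 : ℝ) < b := by exact_mod_cast hb
  have h1 : ∑ i ∈ Finset.range (L + 1), overlap a b L i =
      ∑ i ∈ Finset.range L, 2 ^ min (thr a b i + a) b + 2 ^ (b + 2) := by
    rw [Finset.sum_range_succ]
    congr 1
    · exact Finset.sum_congr rfl fun i hi => if_pos (Finset.mem_range.1 hi)
    · exact if_neg (lt_irrefl L)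
  have h2 : b * ∑ i ∈ Finset.range L, 2 ^ min (thr a b i + a) b ≤ b * 2 ^ b + l * 2 ^ b :=
    (mul_sum_two_pow_le h.one_le b L).trans (Nat.add_le_add
      (Nat.mul_le_mul_left _ (Nat.pow_le_pow_right (by norm_num) (min_le_right _ _)))
      (Nat.mul_le_mul_right _ hL.thr_le))
  rw [h1]
  set S := ∑ i ∈ Finset.range L, 2 ^ min (thr a b i + a) b
  have h3 : (b : ℝ) * S ≤ b * 2 ^ b + l * 2 ^ b := by exact_mod_cast h2
  have h4 : (l : ℝ) ≤ b * (1 / ρ) := by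
    rw [mul_one_div, le_div_iff₀ hρ, mul_comm]
    exact h.le_b
  have h5 : (S : ℝ) ≤ 2 ^ b * (1 + 1 / ρ) := by
    refine le_of_mul_le_mul_left (h3.trans ?_) hb0
    have := mul_le_mul_of_nonneg_right h4 (by positivity : (0 : ℝ) ≤ 2 ^ b)
    linarith
  push_cast
  rw [pow_add]
  linarith

theorem two_pow_le_rpow {l m : ℕ} (hl : 2 ^ l ≤ 2 * n) {p c : ℝ} (hp : 0 ≤ p) (hp1 : p ≤ 1)
    (hm : (m : ℝ) ≤ l * p + c) : (2 : ℝ) ^ m ≤ 2 ^ c * (2 * (n : ℝ) ^ p) := by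
  have hl' : (2 : ℝ) ^ l ≤ 2 * n := by exact_mod_cast hl
  calc (2 : ℝ) ^ m = 2 ^ (m : ℝ) := (Real.rpow_natCast _ _).symm
    _ ≤ 2 ^ (l * p + c) := Real.rpow_le_rpow_of_exponent_le (by norm_num) hm
    _ = 2 ^ c * ((2 : ℝ) ^ l) ^ p := by
      rw [Real.rpow_add (by norm_num), Real.rpow_mul (by norm_num), Real.rpow_natCast, mul_comm]
    _ ≤ 2 ^ c * (2 * n) ^ p := by gcongr
    _ = 2 ^ c * (2 ^ p * n ^ p) := by rw [Real.mul_rpow (by norm_num) (by positivity)]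
    _ ≤ 2 ^ c * (2 ^ (1 : ℝ) * n ^ p) := by
      gcongr
      norm_num
    _ = _ := by rw [Real.rpow_one]

theorem Params.two_pow_a_le {κ ρ : ℝ} {l a b : ℕ} (h : Params κ ρ l a b) (hκ : 1 ≤ κ)
    (hl : 2 ^ l ≤ 2 * n) : (2 : ℝ) ^ a ≤ 8 * (n : ℝ) ^ (1 / κ) := by
  have hκ0 : 0 < κ := by linarith
  have h1 : (a : ℝ) ≤ l * (1 / κ) + 2 := by
    have := h.mul_lt
    rw [mul_one_div, ← sub_le_iff_le_add, le_div_iff₀ hκ0]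
    nlinarith
  have := two_pow_le_rpow hl (by positivity) ((div_le_one hκ0).2 hκ) h1
  norm_num at this ⊢
  linarith

theorem Params.two_pow_b_le {κ ρ : ℝ} {l a b : ℕ} (h : Params κ ρ l a b) (hρ : 0 ≤ ρ) (hρ1 : ρ ≤ 1)
    (hl : 2 ^ l ≤ 2 * n) : (2 : ℝ) ^ b ≤ 4 * (n : ℝ) ^ ρ := by
  have := two_pow_le_rpow (c := 1) hl hρ hρ1 (m := b) (by linarith [h.b_lt])
  norm_num at this
  linarith

/-- Here `j` is the end of the doubling phase, where `thr + a` first reaches `b`; every later step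
adds `b`. The second alternative is that doubling still goes on. -/
theorem thr_dichotomy {a b : ℕ} (i : ℕ) :
    (∃ j ≤ i, (j = 0 ∨ 2 ^ j * a ≤ 2 * b) ∧ (i + 1 - j) * b ≤ thr a b i + a) ∨
      thr a b i + a = 2 ^ i * a ∧ 2 ^ i * a ≤ b := by
  induction i with
  | zero =>
    rcases le_total a b with h | h
    · exact .inr (by simpa [thr] using h)
    · exact .inl ⟨0, le_rfl, .inl rfl, by simpa [thr] using h⟩
  | succ i ih =>
    rcases ih with ⟨j, hj, h1, h2⟩ | ⟨h1, h2⟩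
    · refine .inl ⟨j, by omega, h1, ?_⟩
      obtain ⟨d, rfl⟩ := Nat.exists_eq_add_of_le hj
      rw [show j + d + 1 - j = d + 1 by omega, add_mul] at h2
      rw [show j + d + 1 + 1 - j = d + 1 + 1 by omega, thr, min_eq_right (by omega), add_mul,
        add_mul]
      omega
    · have h3 : thr a b (i + 1) + a = 2 ^ (i + 1) * a := by
        rw [thr, min_eq_left (by omega), h1, pow_succ', mul_assoc]
        omega
      rcases le_total (2 ^ (i + 1) * a) b with h | h
      · exact .inr ⟨h3, h⟩
      · refine .inl ⟨i + 1, le_rfl, .inr ?_, ?_⟩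
        · rw [pow_succ', mul_assoc]; omega
        · rw [Nat.add_sub_cancel_left, one_mul, h3]; exact h

/-- The doubling phase lasts at most `log κ` levels because `2 ^ j * a ≤ 2 * b` and `b ≤ ρ κ a` with
`ρ < 1 / 2`. The linear phase lasts fewer than `l / b ≤ 1 / ρ` levels. -/
theorem LastLevel.le_log {κ ρ : ℝ} {l a b L : ℕ} (hL : LastLevel l a b L) (h : Params κ ρ l a b)
    (hκ : 2 ≤ κ) (hκρ : 1 / κ ≤ ρ) (hρ1 : ρ < 1 / 2) (hl : 0 < l) :
    (L : ℝ) ≤ Real.logb 2 κ + 1 / ρ := by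
  have hκ0 : 0 < κ := by linarith
  have hρ : 0 < ρ := lt_of_lt_of_le (by positivity) hκρ
  have hb := h.b_pos hρ hl
  have hb0 : (0 : ℝ) < b := by exact_mod_cast hb
  have ha0 : (0 : ℝ) < a := by exact_mod_cast h.one_le
  have hprod : 1 ≤ ρ * κ := by rwa [div_le_iff₀ hκ0] at hκρ
  have hlogκ : 0 ≤ Real.logb 2 κ := Real.logb_nonneg (by norm_num) (by linarith)
  -- The extra `1` in `a = ⌈l / κ⌉ + 1` compensates for the rounding up of `b`.
  have hba : (b : ℝ) ≤ ρ * κ * a := by nlinarith [h.le_mul, h.b_lt]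
  have hpow : ∀ j : ℕ, (2 : ℝ) ^ j ≤ 2 * (ρ * κ) → (j : ℝ) ≤ Real.logb 2 κ := fun j hj => by
    rw [Real.le_logb_iff_rpow_le (by norm_num) hκ0, Real.rpow_natCast]
    nlinarith
  rcases Nat.eq_zero_or_pos L with rfl | hLpos
  · simp only [Nat.cast_zero]
    positivity
  obtain ⟨i, rfl⟩ : ∃ i, L = i + 1 := ⟨L - 1, by omega⟩
  have hlt := hL.lt i (Nat.lt_succ_self i)
  rcases thr_dichotomy (a := a) (b := b) i with ⟨j, hj, h1, h2⟩ | ⟨-, h2⟩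
  · have hab : a ≤ b + 2 := by
      have h3 : ((a : ℝ) - 1) < l * ρ + 1 := by
        refine lt_of_mul_lt_mul_right (h.mul_lt.trans_le ?_) hκ0.le
        nlinarith [Nat.cast_nonneg (α := ℝ) l]
      have h4 : (a : ℝ) < ((b + 2 : ℕ) : ℝ) := by push_cast; linarith [h.le_b]
      exact le_of_lt (by exact_mod_cast h4)
    have h5 : (i + 1 - j) * b < l := by omega
    have h6 : (((i + 1 - j : ℕ) : ℝ)) < 1 / ρ := by
      rw [lt_div_iff₀ hρ]
      have h7 : ((i + 1 - j : ℕ) : ℝ) * b < l := by exact_mod_cast h5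
      refine lt_of_mul_lt_mul_right (a := (b : ℝ)) ?_ hb0.le
      nlinarith [h.le_b]
    have h8 : (j : ℝ) ≤ Real.logb 2 κ := by
      refine hpow j ?_
      rcases h1 with rfl | h1
      · norm_num; linarith
      · have h9 : (2 : ℝ) ^ j * a ≤ 2 * b := by exact_mod_cast h1
        refine le_of_mul_le_mul_right (h9.trans ?_) ha0
        linarith
    rw [Nat.cast_sub (by omega)] at h6
    linarith
  · have h3 : (2 : ℝ) ^ i * a ≤ b := by exact_mod_cast h2
    have h4 : ((i + 1 : ℕ) : ℝ) ≤ Real.logb 2 κ := by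
      refine hpow _ (le_of_mul_le_mul_right (a := (a : ℝ)) ?_ ha0)
      rw [pow_succ]
      linarith
    have : 0 < 1 / ρ := by positivity
    linarith

/-- The number of levels. -/
noncomputable def maxLevel (κ ρ : ℝ) : ℕ := ⌊Real.logb 2 κ + 1 / ρ⌋₊

/-- The number of segments of a path on each level. -/
noncomputable def numSegments (κ ρ ε : ℝ) : ℕ := ⌈8 * (maxLevel κ ρ : ℝ) / ε⌉₊

/-- The hopbound. -/
noncomputable def hopbound (κ ρ ε : ℝ) : ℕ := (5 * numSegments κ ρ ε) ^ maxLevel κ ρ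

section hopbound

variable {κ ρ ε : ℝ}

theorem three_le_log (hκ : 2 ≤ κ) (hκρ : 1 / κ ≤ ρ) (hρ1 : ρ < 1 / 2) :
    3 ≤ Real.logb 2 κ + 1 / ρ := by
  have hρ : 0 < ρ := lt_of_lt_of_le (by positivity) hκρ
  have h1 : 1 ≤ Real.logb 2 κ := by
    rw [Real.le_logb_iff_rpow_le (by norm_num) (by linarith)]
    simpa using hκ
  have h2 : 2 ≤ 1 / ρ := by rw [le_div_iff₀ hρ]; linarith
  linarith

theorem three_le_maxLevel (hκ : 2 ≤ κ) (hκρ : 1 / κ ≤ ρ) (hρ1 : ρ < 1 / 2) :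
    3 ≤ maxLevel κ ρ := Nat.le_floor (by exact_mod_cast three_le_log hκ hκρ hρ1)

theorem le_numSegments (hε : 0 < ε) (hε1 : ε < 1 / 2) :
    8 * (maxLevel κ ρ : ℝ) ≤ numSegments κ ρ ε := by
  refine le_trans ?_ (Nat.le_ceil _)
  rw [le_div_iff₀ hε]
  nlinarith [Nat.cast_nonneg (α := ℝ) (maxLevel κ ρ)]

theorem numSegments_pos (hκ : 2 ≤ κ) (hκρ : 1 / κ ≤ ρ) (hρ1 : ρ < 1 / 2) (hε : 0 < ε) :
    0 < numSegments κ ρ ε := by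
  have : 0 < maxLevel κ ρ := (by norm_num : 0 < 3).trans_le (three_le_maxLevel hκ hκρ hρ1)
  exact Nat.ceil_pos.2 (by positivity)

theorem div_numSegments_le (hκ : 2 ≤ κ) (hκρ : 1 / κ ≤ ρ) (hρ1 : ρ < 1 / 2) (hε : 0 < ε) :
    8 * (maxLevel κ ρ : ℝ) / numSegments κ ρ ε ≤ ε := by
  have h : (0 : ℝ) < numSegments κ ρ ε := by exact_mod_cast numSegments_pos hκ hκρ hρ1 hε
  rw [div_le_iff₀ h, ← div_le_iff₀' hε]
  exact Nat.le_ceil _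

theorem hopbound_pos (hκ : 2 ≤ κ) (hκρ : 1 / κ ≤ ρ) (hρ1 : ρ < 1 / 2) (hε : 0 < ε) :
    0 < hopbound κ ρ ε :=
  Nat.pow_pos (Nat.mul_pos (by norm_num) (numSegments_pos hκ hκρ hρ1 hε))

theorem hopbound_le (hκ : 2 ≤ κ) (hκρ : 1 / κ ≤ ρ) (hρ1 : ρ < 1 / 2) (hε : 0 < ε)
    (hε1 : ε < 1 / 2) {C : ℝ} (hC : 45 ≤ C) :
    (hopbound κ ρ ε : ℝ) ≤
      (C * ((Real.logb 2 κ + 1 / ρ) / ε)) ^ (Real.logb 2 κ + 1 / ρ) := by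
  set x := Real.logb 2 κ + 1 / ρ with hx
  have h3 : 3 ≤ x := three_le_log hκ hκρ hρ1
  have hM : (maxLevel κ ρ : ℝ) ≤ x := Nat.floor_le (by linarith)
  have hxε : 1 ≤ x / ε := by rw [le_div_iff₀ hε]; linarith
  -- Rounding up costs one more `x / ε`, which is at least `1`; this makes `45 = 5 * 9` a sufficient
  -- constant.
  have hN : (numSegments κ ρ ε : ℝ) ≤ 9 * (x / ε) := by
    have h1 : (numSegments κ ρ ε : ℝ) < 8 * (maxLevel κ ρ : ℝ) / ε + 1 :=
      Nat.ceil_lt_add_one (by positivity)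
    have h2 : 8 * (maxLevel κ ρ : ℝ) / ε ≤ 8 * (x / ε) := by
      rw [mul_div_assoc]; gcongr
    linarith
  calc (hopbound κ ρ ε : ℝ) = (5 * (numSegments κ ρ ε : ℝ)) ^ maxLevel κ ρ := by
        rw [hopbound]; push_cast; rfl
    _ ≤ (C * (x / ε)) ^ maxLevel κ ρ := by
        refine pow_le_pow_left₀ (by positivity) ?_ _
        nlinarith
    _ = (C * (x / ε)) ^ (maxLevel κ ρ : ℝ) := (Real.rpow_natCast _ _).symm
    _ ≤ (C * (x / ε)) ^ x := Real.rpow_le_rpow_of_exponent_le (by nlinarith) hM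

end hopbound

/-! ### The main theorem -/

/-- The outcomes of the first `k` coin tosses, followed by zeros. -/
def truncate (k : ℕ) (ω : ℕ → Bool) : ℕ → Bool := fun i => if i < k then ω i else false

theorem dependsOn_truncate {β : Type*} (k : ℕ) (F : (ℕ → Bool) → β) :
    DependsOn (fun ω => F (truncate k ω)) (Finset.range k) := by
  intro ω ω' h
  have : truncate k ω = truncate k ω' := by
    funext i
    by_cases hi : i < k
    · simpa [truncate, hi] using h i (by simpa using hi)
    · simp [truncate, hi]
  simp only [this]

theorem levels_truncate (l a b L : ℕ) (ω : ℕ → Bool) :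
    levels n l a b L (truncate (n * l) ω) = levels n l a b L ω := by
  refine levels_congr fun i hi => if_pos ?_
  obtain ⟨u, -, hu⟩ := Finset.mem_biUnion.1 (Finset.mem_coe.1 hi)
  have h1 := (Finset.mem_Ico.1 hu).2
  have h2 := Nat.mul_le_mul_right l u.2
  rw [Nat.succ_mul] at h2
  exact h1.trans_le h2

theorem totalWork_truncate (G : WGraph n) (es : List (Fin n × Fin n × ℝ)) (l a b L : ℕ)
    (ω : ℕ → Bool) :
    totalWork G es l a b L (truncate (n * l) ω) = totalWork G es l a b L ω := by
  rw [totalWork, levels_truncate, totalWork]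

theorem totalSize_truncate (G : WGraph n) (l a b L : ℕ) (ω : ℕ → Bool) :
    totalSize G l a b L (truncate (n * l) ω) = totalSize G l a b L ω := by
  rw [totalSize, levels_truncate, totalSize]

theorem exists_run {κ ρ ε : ℝ} {G : WGraph n} {es : List (Fin n × Fin n × ℝ)} (ω : ℕ → Bool)
    (hn : 16 ≤ n) (hκ : 2 ≤ κ) (hκρ : 1 / κ ≤ ρ) (hρ1 : ρ < 1 / 2) (hε : 0 < ε) (hε1 : ε < 1 / 2)
    (hes : G.IsListedOnceBy es) :
    ∃ a b L t H, Params κ ρ (n.log2 + 1) a b ∧ LastLevel (n.log2 + 1) a b L ∧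
      (∀ ω', truncate (n * (n.log2 + 1)) ω' = truncate (n * (n.log2 + 1)) ω →
        Computes mainProg 4 κ ρ ε es ω' t H) ∧
      WGraph.IsHopset (hopbound κ ρ ε) ε G H ∧
      t ≤ 300 * (n.log2 + 2) * totalWork G es (n.log2 + 1) a b L ω +
        1000 * (n.log2 + 2) * (n.log2 + 2) * (n + 1) + 100 * (es.length + 1) ∧
      H.numEdges ≤ totalSize G (n.log2 + 1) a b L ω := by
  have hρ : 0 < ρ := lt_of_lt_of_le (by positivity) hκρ
  obtain ⟨t, s, hexec, a, b, L, hpar, hL, htoss, ht, out, ho, hlev, hlen⟩ :=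
    mainProg_spec (κ := κ) (ε := ε) (ω := ω) hn (by linarith) hρ (by linarith) hes
  have hsound := (hlev 0 (Nat.zero_le _)).sound
  refine ⟨a, b, L, t, G.ofList out hsound, hpar, hL, fun ω' h => ⟨s, ?_, ?_⟩, ?_, ht,
    WGraph.ofList_numEdges_le.trans hlen⟩
  · refine hexec.congr_coins fun i hi => ?_
    rw [htoss] at hi
    simpa [truncate, hi] using (congrFun h i).symm
  · exact ⟨out, WGraph.ofList_isListedBy, ho.1, ho.2⟩
  · exact WGraph.ofList_isHopset hlev
      (Nat.le_floor (hL.le_log hpar hκ hκρ hρ1 (Nat.succ_pos _)))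
      (numSegments_pos hκ hκρ hρ1 hε) (le_numSegments hε hε1) (div_numSegments_le hκ hκρ hρ1 hε)

/-- Choosing a run for each `ω` need not be measurable. Evaluating the choice at the truncation of
`ω` makes time and output depend on finitely many coins, and these runs are still runs for `ω` since
no further coins are read. -/
theorem exists_measurable_run {κ ρ ε : ℝ} {G : WGraph n} {es : List (Fin n × Fin n × ℝ)}
    (hn : 16 ≤ n) (hκ : 2 ≤ κ) (hκρ : 1 / κ ≤ ρ) (hρ1 : ρ < 1 / 2) (hε : 0 < ε) (hε1 : ε < 1 / 2)
    (hes : G.IsListedOnceBy es) :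
    ∃ a b L, Params κ ρ (n.log2 + 1) a b ∧ LastLevel (n.log2 + 1) a b L ∧
      ∃ (T : (ℕ → Bool) → ℕ) (H : (ℕ → Bool) → WGraph n),
        (∀ ω, Computes mainProg 4 κ ρ ε es ω (T ω) (H ω) ∧
          WGraph.IsHopset (hopbound κ ρ ε) ε G (H ω)) ∧
        Measurable T ∧ (Measurable fun ω => (H ω).numEdges) ∧
        (∀ ω, T ω ≤ 300 * (n.log2 + 2) * totalWork G es (n.log2 + 1) a b L ω +
          (1000 * (n.log2 + 2) * (n.log2 + 2) * (n + 1) + 100 * (es.length + 1))) ∧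
        ∀ ω, (H ω).numEdges ≤ totalSize G (n.log2 + 1) a b L ω := by
  set k := n * (n.log2 + 1) with hk
  have hidem : ∀ ω, truncate k (truncate k ω) = truncate k ω := fun ω => by
    funext i
    by_cases hi : i < k <;> simp [truncate, hi]
  choose a b L T H hpar hL hcomp hhop hT hH using fun ω : ℕ → Bool =>
    exists_run (G := G) (es := es) ω hn hκ hκρ hρ1 hε hε1 hes
  refine ⟨a default, b default, L default, hpar _, hL _, fun ω => T (truncate k ω),
    fun ω => H (truncate k ω), fun ω => ⟨hcomp _ ω (hidem ω).symm, hhop _⟩,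
    measurable_of_dependsOn (dependsOn_truncate k T),
    measurable_of_dependsOn (dependsOn_truncate k fun ω => (H ω).numEdges), fun ω => ?_,
    fun ω => ?_⟩
  all_goals
    obtain ⟨ha, hb⟩ := (hpar default).unique (by linarith) (hpar (truncate k ω))
    have hL' := hL default
    rw [ha, hb] at hL' ⊢
    rw [hL'.unique (hL (truncate k ω))]
  · refine (hT (truncate k ω)).trans_eq ?_
    rw [totalWork_truncate, add_assoc]
  · refine (hH (truncate k ω)).trans_eq ?_
    rw [totalSize_truncate]

end Hopset

/-! ### Expected size and running time in terms of `n`. -/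

namespace Hopset

variable {n : ℕ}

/-! ### Expectations -/

theorem sixteen_le_of_logb (h : 8 ≤ Real.logb 2 n) : 16 ≤ n := by
  have hn : 0 < n := by
    rcases Nat.eq_zero_or_pos n with rfl | hn
    · norm_num at h
    · exact hn
  rw [Real.le_logb_iff_rpow_le (by norm_num) (by exact_mod_cast hn)] at h
  norm_num at h
  have : 256 ≤ n := by exact_mod_cast h
  omega

theorem log2_add_two_le (h : 8 ≤ Real.logb 2 n) : ((n.log2 + 2 : ℕ) : ℝ) ≤ 2 * Real.logb 2 n := by
  have hn := sixteen_le_of_logb h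
  have h1 : (n.log2 : ℝ) ≤ Real.logb 2 n := by
    rw [Real.le_logb_iff_rpow_le (by norm_num) (by exact_mod_cast (by omega : 0 < n)),
      Real.rpow_natCast]
    exact_mod_cast Nat.log2_self_le (by omega)
  push_cast
  linarith

theorem two_pow_log2_succ_le (hn : n ≠ 0) : 2 ^ (n.log2 + 1) ≤ 2 * n := by
  rw [pow_succ, mul_comm]
  exact Nat.mul_le_mul_left _ (Nat.log2_self_le hn)

theorem natCast_le_ofReal {k : ℕ} {x : ℝ} (h : (k : ℝ) ≤ x) : (k : ℝ≥0∞) ≤ ENNReal.ofReal x := by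
  rw [← ENNReal.ofReal_natCast]
  exact ENNReal.ofReal_le_ofReal h

section

variable {κ ρ : ℝ} {a b L : ℕ} {G : WGraph n}

theorem lintegral_size_le {f : (ℕ → Bool) → WGraph n} (hκ : 2 ≤ κ) (hκρ : 1 / κ ≤ ρ)
    (hρ1 : ρ < 1 / 2) (hlog : 8 ≤ Real.logb 2 n) (hpar : Params κ ρ (n.log2 + 1) a b)
    (hL : LastLevel (n.log2 + 1) a b L)
    (hf : ∀ ω, (f ω).numEdges ≤ totalSize G (n.log2 + 1) a b L ω) :
    ∫⁻ ω, ((f ω).numEdges : ℝ≥0∞) ∂coinMeasure ≤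
      ENNReal.ofReal (30000 * ((n : ℝ) ^ (1 + 1 / κ) * Real.logb 2 n)) := by
  have hρ : 0 < ρ := lt_of_lt_of_le (by positivity) hκρ
  have hn := sixteen_le_of_logb hlog
  have hn1 : (1 : ℝ) ≤ n := by exact_mod_cast (by omega : 1 ≤ n)
  have h2l := two_pow_log2_succ_le (n := n) (by omega)
  have hl := log2_add_two_le hlog
  have hLl : ((L + 1 : ℕ) : ℝ) ≤ ((n.log2 + 2 : ℕ) : ℝ) := by
    have := hL.le_length hpar.one_le (hpar.b_pos hρ (Nat.succ_pos _))
    exact_mod_cast (by omega)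
  have ha := hpar.two_pow_a_le (by linarith) h2l
  have hb := hpar.two_pow_b_le hρ.le (by linarith) h2l
  refine (lintegral_mono fun ω => Nat.cast_le.2 (hf ω)).trans
    ((lintegral_totalSize_le hL Nat.lt_log2_self.le).trans (natCast_le_ofReal ?_))
  set g := Real.logb 2 n
  -- The edges on the top level are linear in number because `ρ < 1 / 2`.
  have hsq : ((2 : ℝ) ^ b) * 2 ^ b ≤ 16 * n := by
    calc ((2 : ℝ) ^ b) * 2 ^ b ≤ (4 * (n : ℝ) ^ ρ) * (4 * (n : ℝ) ^ ρ) := by gcongr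
      _ = 16 * (n : ℝ) ^ (ρ + ρ) := by
        rw [Real.rpow_add (by linarith)]; ring
      _ ≤ 16 * (n : ℝ) ^ (1 : ℝ) := by
        gcongr
        linarith
      _ = _ := by rw [Real.rpow_one]
  have hZ : (n : ℝ) ^ (1 + 1 / κ) = n * (n : ℝ) ^ (1 / κ) := by
    rw [Real.rpow_add (by linarith), Real.rpow_one]
  have hz : 1 ≤ (n : ℝ) ^ (1 / κ) := Real.one_le_rpow hn1 (by positivity)
  rw [hZ]
  set z := (n : ℝ) ^ (1 / κ)
  push_cast at hLl hl ⊢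
  have hL2 : (L : ℝ) + 1 ≤ 2 * g := hLl.trans hl
  have hnz : (n : ℝ) ≤ n * z := le_mul_of_one_le_right (by linarith) hz
  have hnz0 : (0 : ℝ) ≤ n * z := by positivity
  have h1 : (L : ℝ) * (n * 2 ^ a) ≤ (2 * g) * (n * (8 * z)) := by
    gcongr
    linarith
  have h2 : (2 : ℝ) ^ (b + 2) * 2 ^ (b + 2) ≤ 256 * (n * z) := by
    rw [pow_add]; linarith
  have h3 : ((L : ℝ) + 1) * n ≤ (2 * g) * (n * z) := by gcongr
  have h4 : 1 * (n * z) ≤ g * (n * z) := by gcongr; linarith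
  linarith

theorem lintegral_time_le {f : (ℕ → Bool) → ℕ} {es : List (Fin n × Fin n × ℝ)} (hκ : 2 ≤ κ)
    (hκρ : 1 / κ ≤ ρ) (hρ1 : ρ < 1 / 2) (hlog : 8 ≤ Real.logb 2 n)
    (hpar : Params κ ρ (n.log2 + 1) a b) (hL : LastLevel (n.log2 + 1) a b L)
    (hf : ∀ ω, f ω ≤ 300 * (n.log2 + 2) * totalWork G es (n.log2 + 1) a b L ω +
      (1000 * (n.log2 + 2) * (n.log2 + 2) * (n + 1) + 100 * (es.length + 1))) :
    ∫⁻ ω, (f ω : ℝ≥0∞) ∂coinMeasure ≤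
      ENNReal.ofReal (30000 * (((es.length : ℝ) + n * Real.logb 2 n) *
        ((n : ℝ) ^ ρ / ρ) * Real.logb 2 n)) := by
  have hρ : 0 < ρ := lt_of_lt_of_le (by positivity) hκρ
  have hn := sixteen_le_of_logb hlog
  have hn1 : (1 : ℝ) ≤ n := by exact_mod_cast (by omega : 1 ≤ n)
  have h2l := two_pow_log2_succ_le (n := n) (by omega)
  have hl := log2_add_two_le hlog
  have hb := hpar.two_pow_b_le hρ.le (by linarith) h2l
  have hS := sum_overlap_le hpar hL hρ (Nat.succ_pos _)
  have hE : ∫⁻ ω, (f ω : ℝ≥0∞) ∂coinMeasure ≤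
      ((300 * (n.log2 + 2) * ((∑ i ∈ Finset.range (L + 1), overlap a b L i) *
        (2 * es.length + n)) + (1000 * (n.log2 + 2) * (n.log2 + 2) * (n + 1) +
        100 * (es.length + 1)) : ℕ) : ℝ≥0∞) := by
    refine (lintegral_mono fun ω => Nat.cast_le.2 (hf ω)).trans ?_
    simp only [Nat.cast_add _ (1000 * (n.log2 + 2) * (n.log2 + 2) * (n + 1) +
      100 * (es.length + 1)), Nat.cast_mul (300 * (n.log2 + 2))]
    rw [lintegral_add_right _ measurable_const,
      lintegral_const_mul' _ _ (ENNReal.natCast_ne_top _), lintegral_const, measure_univ, mul_one]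
    gcongr
    exact lintegral_totalWork_le hL Nat.lt_log2_self.le es
  refine hE.trans (natCast_le_ofReal ?_)
  set S := ∑ i ∈ Finset.range (L + 1), overlap a b L i
  set g := Real.logb 2 n
  have hY1 : 1 ≤ (n : ℝ) ^ ρ := Real.one_le_rpow hn1 hρ.le
  have hρ2 : 2 ≤ 1 / ρ := by rw [le_div_iff₀ hρ]; linarith
  rw [div_eq_mul_one_div ((n : ℝ) ^ ρ)]
  set r := 1 / ρ
  set y := (n : ℝ) ^ ρ
  -- Since `2 ≤ 1 / ρ`, the `5` is at most `5 / 2` times `1 / ρ`.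
  have hS' : (S : ℝ) ≤ 14 * (y * r) := by
    calc (S : ℝ) ≤ 2 ^ b * (5 + r) := hS
      _ ≤ (4 * y) * (7 / 2 * r) := by gcongr; linarith
      _ = _ := by ring
  have hm : (0 : ℝ) ≤ es.length := Nat.cast_nonneg _
  set m := (es.length : ℝ) with hmdef
  set X := m + n * g with hX
  have hng : (n : ℝ) * 8 ≤ n * g := by gcongr
  have hX0 : 0 ≤ X := by linarith
  have hyr : 1 ≤ y * r := by nlinarith
  have hXY : X ≤ X * (y * r) := le_mul_of_one_le_right hX0 hyr
  push_cast at hl ⊢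
  rw [← hmdef]
  have h1 : 300 * ((n.log2 : ℝ) + 2) * (S * (2 * m + n)) ≤
      300 * (2 * g) * ((14 * (y * r)) * (2 * X)) := by
    gcongr
    linarith
  have h2 : 1000 * ((n.log2 : ℝ) + 2) * ((n.log2 : ℝ) + 2) * (n + 1) ≤
      1000 * (2 * g) * (2 * g) * (2 * n) := by
    gcongr
    linarith
  -- The overhead of order `n * g ^ 2`, for coins and loops over all vertices on every level, is
  -- paid for by the summand `n * g` of `X`.
  have h3 : g * (n * g) ≤ g * (X * (y * r)) :=
    mul_le_mul_of_nonneg_left (by linarith) (by linarith)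
  have h4 : 1 * (X * (y * r)) ≤ g * (X * (y * r)) := by
    gcongr
    linarith
  linarith

end

end Hopset
theorem mainTheorem1 :
    ∃ (P : Hopset.Prog) (c : ℕ) (C : ℝ) (β : ℝ → ℝ → ℝ → ℕ),
      (∀ κ ρ ε : ℝ, 2 ≤ κ → 1 / κ ≤ ρ → ρ < 1 / 2 → 0 < ε → ε < 1 / 2 →
        0 < β κ ρ ε ∧
        (β κ ρ ε : ℝ) ≤
          (C * ((Real.logb 2 κ + 1 / ρ) / ε)) ^ (Real.logb 2 κ + 1 / ρ)) ∧
      ∀ (n : ℕ) (κ ρ ε : ℝ), 2 ≤ κ → κ ≤ Real.logb 2 n / 4 → 1 / κ ≤ ρ → ρ < 1 / 2 →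
        0 < ε → ε < 1 / 2 →
        ∀ (G : Hopset.WGraph n) (l : List (Fin n × Fin n × ℝ)), G.IsListedOnceBy l →
          ∃ (T : (ℕ → Bool) → ℕ) (H : (ℕ → Bool) → Hopset.WGraph n),
            (∀ ω, Hopset.Computes P c κ ρ ε l ω (T ω) (H ω) ∧
              Hopset.WGraph.IsHopset (β κ ρ ε) ε G (H ω)) ∧
            Measurable T ∧ Measurable (fun ω => (H ω).numEdges) ∧
            ∫⁻ ω, ((H ω).numEdges : ℝ≥0∞) ∂Hopset.coinMeasure ≤
              ENNReal.ofReal (C * ((n : ℝ) ^ (1 + 1 / κ) * Real.logb 2 n)) ∧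
            ∫⁻ ω, (T ω : ℝ≥0∞) ∂Hopset.coinMeasure ≤
              ENNReal.ofReal (C * (((G.numEdges : ℝ) + n * Real.logb 2 n) *
                ((n : ℝ) ^ ρ / ρ) * Real.logb 2 n)) := by
  refine ⟨Hopset.mainProg, 4, 30000, Hopset.hopbound, fun κ ρ ε hκ hκρ hρ1 hε hε1 =>
    ⟨Hopset.hopbound_pos hκ hκρ hρ1 hε, Hopset.hopbound_le hκ hκρ hρ1 hε hε1 (by norm_num)⟩,
    fun n κ ρ ε hκ hκn hκρ hρ1 hε hε1 G es hes => ?_⟩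
  have hρ : 0 < ρ := lt_of_lt_of_le (by positivity) hκρ
  -- The upper bound on `κ`, together with `2 ≤ κ`, makes `n` large enough for all word sizes.
  have hlog : 8 ≤ Real.logb 2 n := by linarith
  obtain ⟨a, b, L, hpar, hL, T, H, hrun, hTm, hHm, hT, hH⟩ :=
    Hopset.exists_measurable_run (Hopset.sixteen_le_of_logb hlog) hκ hκρ hρ1 hε hε1 hes
  exact ⟨T, H, hrun, hTm, hHm,
    Hopset.lintegral_size_le hκ hκρ hρ1 hlog hpar hL hH,
    hes.length_eq ▸ Hopset.lintegral_time_le hκ hκρ hρ1 hlog hpar hL hT⟩
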